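/- Let $(M,g,J,\nabla,\xi)$ be a conical affine special Kähler (CASK) manifold. That is, $(M,g,J)$ is a pseudo-Kähler manifold with Kähler form $\omega=g(J\cdot,\cdot)$; $\nabla$ is a flat torsion-free connection with $\nabla\omega=0$ and $d^\nabla J=0$; $\xi$ is a complete vector field with $D\xi=\nabla\xi=\mathrm{Id}$, where $D$ is the Levi-Civita connection of $g$; $g$ is negative definite on $\mathrm{span}\{\xi,J\xi\}$ and positive definite on its orthogonal complement; and $\xi$, $J\xi$ generate a principal $\mathbb{C}^*$-action on $M$. An infinitesimal automorphism of $M$ is a vector field $X$ on $M$ whose local flow preserves $g$, $J$, $\nabla$ and $\xi$; these vector fields form a Lie algebra $\mathfrak{aut}(M)$. Let $\pi:N=T^*M\to M$, and let $\lambda$ be the tautological section of $\pi^*(T^*M)$, $\lambda_\alpha=\alpha$. The connection $\nabla$ induces the splitting $$TN\cong\pi^*(TM)\oplus\pi^*(T^*M),\qquad A\mapsto\bigl(d\pi(A),(\pi^*\nabla)_A\lambda\bigr).$$ With respect to it put $g_N=g\oplus g^{-1}$ and $I_1=J\oplus J^*$. Let $Z=-\widetilde{J\xi}$, where the tilde denotes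 the $\nabla$-horizontal lift, let $\omega_1=g_N(I_1\cdot,\cdot)$ and $\omega_{\mathrm H}=\omega_1+d\,\iota_Zg_N$. Let $\omega^{-1}$ be the bilinear form on $T^*M$ given in coordinates by $\omega^{-1}(a,b)=\omega^{jk}a_jb_k$, where $(\omega^{jk})$ is the inverse matrix of $(\omega_{jk})$. For $X\in\mathfrak{aut}(M)$ let $Y$ be its canonical lift to $N$, namely $$Y=\pi^*X-\lambda\circ(\pi^*\nabla)(\pi^*X)$$ with respect to the above splitting, i.e. $d\pi(Y_\alpha)=X_{\pi(\alpha)}$ and $((\pi^*\nabla)_Y\lambda)_\alpha=-\alpha(\nabla X)$. Then: 1. $Y$ is a smooth vector field on $N$ and is the infinitesimal generator of the induced local flow on covectors: if $\varphi_t$ is a local flow of $X$, then $Y_\alpha=\frac{d}{dt}\big|_{t=0}\,\alpha\circ(d\varphi_t)^{-1}$. 2. The function $$\mu_Y=\tfrac12\bigl(g_N(Z,Y)+\pi^*\omega^{-1}(\lambda\circ(\pi^*\nabla)(\pi^*X),\lambda)\bigr)$$ is smooth and is an $\omega_{\mathrm H}$-Hamiltonian function for $Y$, that is, $\iota_Y\omega_{\mathrm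 H}=-d\mu_Y$. 3. The assignment $X\mapsto Y$ is a homomorphism of Lie algebras from $\mathfrak{aut}(M)$ to the vector fields on $N$, and $X\mapsto\mu_X:=\mu_Y$ is an equivariant comoment map $\mathfrak{aut}(M)\to\mathcal C^\infty(N)$ for this action: it is linear, $\mu_X$ is an $\omega_{\mathrm H}$-Hamiltonian function for the canonical lift of $X$, and $\mathcal L_{Y_1}(\mu_{X_2})=\mu_{[X_1,X_2]}$ for all $X_1,X_2\in\mathfrak{aut}(M)$, where $Y_1$ is the canonical lift of $X_1$. -/

import Mathlib

open Bundle VectorField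
open scoped Manifold ContDiff Topology

noncomputable section

set_option linter.unusedSectionVars false

/-! ### Smooth vector fields and their Lie algebra -/

/-- The space `Γ(TM)` of smooth vector fields. -/
abbrev SmoothVectorField {E : Type*} [NormedAddCommGroup E] [NormedSpace ℝ E] {H : Type*}
    [TopologicalSpace H] (I : ModelWithCorners ℝ E H) (M : Type*) [TopologicalSpace M]
    [ChartedSpace H M] [IsManifold I ∞ M] : Type _ :=
  ContMDiffSection I E ∞ (TangentSpace I : M → Type _)

namespace SmoothVectorField

variable {E : Type*} [NormedAddCommGroup E] [NormedSpace ℝ E] [CompleteSpace E] {H : Type*}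
  [TopologicalSpace H] {I : ModelWithCorners ℝ E H} {M : Type*} [TopologicalSpace M]
  [ChartedSpace H M] [IsManifold I ∞ M]

theorem contMDiff_mlieBracket (X Y : SmoothVectorField I M) :
    ContMDiff I I.tangent ∞ (fun x => (⟨x, mlieBracket I X Y x⟩ : TangentBundle I M)) := by
  have : IsManifold I (((⊤ : ℕ∞) : ℕ∞ω) + 1) M := ‹IsManifold I ∞ M›
  have h2 : IsManifold I (minSmoothness ℝ 2) M := by
    simp only [minSmoothness_of_isRCLikeNormedField]; infer_instance
  exact ContDiff.mlieBracket_vectorField (m := ⊤) (n := ⊤) X.contMDiff Y.contMDiff (by simp)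

/-- The Lie bracket of smooth vector fields. -/
instance : Bracket (SmoothVectorField I M) (SmoothVectorField I M) :=
  ⟨fun X Y => ⟨fun x => mlieBracket I X Y x, contMDiff_mlieBracket X Y⟩⟩

theorem lie_apply (X Y : SmoothVectorField I M) (x : M) : ⁅X, Y⁆ x = mlieBracket I X Y x := rfl

theorem mdiff (X : SmoothVectorField I M) (x : M) :
    MDifferentiableAt I I.tangent (fun y => (⟨y, X y⟩ : TangentBundle I M)) x :=
  X.contMDiff.mdifferentiable (by simp) x

instance : LieRing (SmoothVectorField I M) where
  add_lie X Y Z := by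
    ext x
    exact mlieBracket_add_left (X.mdiff x) (Y.mdiff x)
  lie_add X Y Z := by
    ext x
    exact mlieBracket_add_right (Y.mdiff x) (Z.mdiff x)
  lie_self X := by
    ext x
    simp [lie_apply]
  leibniz_lie X Y Z := by
    ext x
    have : IsManifold I (minSmoothness ℝ 3) M := by
      simp only [minSmoothness_of_isRCLikeNormedField]; infer_instance
    have h : minSmoothness ℝ 2 ≤ ∞ := by
      simp only [minSmoothness_of_isRCLikeNormedField]; exact WithTop.coe_le_coe.2 le_top
    exact leibniz_identity_mlieBracket_apply ((X.contMDiff x).of_le h) ((Y.contMDiff x).of_le h)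
      ((Z.contMDiff x).of_le h)

instance : LieAlgebra ℝ (SmoothVectorField I M) where
  lie_smul c X Y := by
    ext x
    exact mlieBracket_const_smul_right (Y.mdiff x)

end SmoothVectorField

/-! ### Tensors and connections -/

section Base

variable {E M : Type*} [NormedAddCommGroup E] [NormedSpace ℝ E] [FiniteDimensional ℝ E]
  [CompleteSpace E] [TopologicalSpace M] [ChartedSpace E M] [IsManifold 𝓘(ℝ, E) ∞ M]

/-- Smoothness of a field of bilinear forms on the tangent spaces. -/
def IsSmoothBilin
    (b : Π x : M, TangentSpace 𝓘(ℝ, E) x →L[ℝ] TangentSpace 𝓘(ℝ, E) x →L[ℝ] ℝ) : Prop :=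
  ContMDiff 𝓘(ℝ, E) (𝓘(ℝ, E).prod 𝓘(ℝ, E →L[ℝ] E →L[ℝ] ℝ)) ∞
    (fun x => TotalSpace.mk' (E →L[ℝ] E →L[ℝ] ℝ)
      (E := fun x : M => TangentSpace 𝓘(ℝ, E) x →L[ℝ] TangentSpace 𝓘(ℝ, E) x →L[ℝ] ℝ) x (b x))

/-- Smoothness of a field of endomorphisms of the tangent spaces. -/
def IsSmoothEndo (J : Π x : M, TangentSpace 𝓘(ℝ, E) x →L[ℝ] TangentSpace 𝓘(ℝ, E) x) : Prop :=
  ContMDiff 𝓘(ℝ, E) (𝓘(ℝ, E).prod 𝓘(ℝ, E →L[ℝ] E)) ∞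
    (fun x => TotalSpace.mk' (E →L[ℝ] E)
      (E := fun x : M => TangentSpace 𝓘(ℝ, E) x →L[ℝ] TangentSpace 𝓘(ℝ, E) x) x (J x))

/-- Connections on the tangent bundle; `D Y x v` is `(D_v Y)(x)`. -/
abbrev AffineConnection (E M : Type*) [NormedAddCommGroup E] [NormedSpace ℝ E]
    [TopologicalSpace M] [ChartedSpace E M] [IsManifold 𝓘(ℝ, E) ∞ M] : Type _ :=
  CovariantDerivative 𝓘(ℝ, E) E (TangentSpace 𝓘(ℝ, E) : M → Type _)

namespace AffineConnection

/-- `D` is smooth: it maps smooth vector fields to smooth sections of `Hom(TM, TM)`. -/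
def IsSmooth (D : AffineConnection E M) : Prop :=
  ∀ Y : SmoothVectorField 𝓘(ℝ, E) M, IsSmoothEndo (fun x => D Y x)

/-- `D b = 0` for a field `b` of bilinear forms. -/
def IsParallelBilin (D : AffineConnection E M)
    (b : Π x : M, TangentSpace 𝓘(ℝ, E) x →L[ℝ] TangentSpace 𝓘(ℝ, E) x →L[ℝ] ℝ) : Prop :=
  ∀ (Y Z : SmoothVectorField 𝓘(ℝ, E) M) (x : M) (v : TangentSpace 𝓘(ℝ, E) x),
    mvfderiv 𝓘(ℝ, E) (fun y => b y (Y y) (Z y)) x v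
      = b x (D Y x v) (Z x) + b x (Y x) (D Z x v)

/-- `D J = 0` for a field `J` of endomorphisms. -/
def IsParallelEndo (D : AffineConnection E M)
    (J : Π x : M, TangentSpace 𝓘(ℝ, E) x →L[ℝ] TangentSpace 𝓘(ℝ, E) x) : Prop :=
  ∀ (Y : SmoothVectorField 𝓘(ℝ, E) M) (x : M) (v : TangentSpace 𝓘(ℝ, E) x),
    D (fun y => J y (Y y)) x v = J x (D Y x v)

/-- `d^D J = 0`, where `J` is regarded as a one-form with values in the tangent bundle. -/
def IsClosedEndo (D : AffineConnection E M)
    (J : Π x : M, TangentSpace 𝓘(ℝ, E) x →L[ℝ] TangentSpace 𝓘(ℝ, E) x) : Prop :=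
  ∀ (X Y : SmoothVectorField 𝓘(ℝ, E) M) (x : M),
    D (fun y => J y (Y y)) x (X x) - D (fun y => J y (X y)) x (Y x) - J x (⁅X, Y⁆ x) = 0

/-- The curvature of `D` vanishes. -/
def IsFlat (D : AffineConnection E M) : Prop :=
  ∀ (X Y Z : SmoothVectorField 𝓘(ℝ, E) M) (x : M),
    D (fun y => D Z y (Y y)) x (X x) - D (fun y => D Z y (X y)) x (Y x) - D Z x (⁅X, Y⁆ x) = 0

/-- `D` is the Levi-Civita connection of `g`: it is smooth, torsion-free and metric. -/
structure IsLeviCivita (D : AffineConnection E M)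
    (g : Π x : M, TangentSpace 𝓘(ℝ, E) x →L[ℝ] TangentSpace 𝓘(ℝ, E) x →L[ℝ] ℝ) : Prop where
  smooth : D.IsSmooth
  torsion_eq_zero : CovariantDerivative.torsion D = 0
  metric : D.IsParallelBilin g

end AffineConnection

/-! ### Conical affine special Kähler manifolds -/

/-- The unit `e^z` of `ℂ`. -/
def expUnit (z : ℂ) : ℂˣ := Units.mk0 (Complex.exp z) (Complex.exp_ne_zero z)

/-- `ρ` is a principal `ℂ^*`-action (smooth, free and proper) whose fundamental vector fields
belonging to `1` and `i` in the Lie algebra `ℂ` are `V` and `W`. -/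
structure IsPrincipalAction (ρ : ℂˣ →* Equiv.Perm M)
    (V W : Π x : M, TangentSpace 𝓘(ℝ, E) x) : Prop where
  smooth : ContMDiff (𝓘(ℝ, ℂ).prod 𝓘(ℝ, E)) 𝓘(ℝ, E) ∞ (fun p : ℂˣ × M => ρ p.1 p.2)
  free : ∀ (z : ℂˣ) (x : M), ρ z x = x → z = 1
  proper : IsProperMap (fun p : ℂˣ × M => (ρ p.1 p.2, p.2))
  generator_one : ∀ x : M, IsMIntegralCurve (fun t : ℝ => ρ (expUnit t) x) V
  generator_I : ∀ x : M, IsMIntegralCurve (fun t : ℝ => ρ (expUnit (t * Complex.I)) x) W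

variable (E M) in
/-- A conical affine special Kähler manifold `(M, g, J, ∇, ξ)`. -/
structure CASKManifold where
  /-- the pseudo-Riemannian metric `g` -/
  g : Π x : M, TangentSpace 𝓘(ℝ, E) x →L[ℝ] TangentSpace 𝓘(ℝ, E) x →L[ℝ] ℝ
  g_smooth : IsSmoothBilin g
  g_symm : ∀ x u v, g x u v = g x v u
  g_nondegenerate : ∀ x u, (∀ v, g x u v = 0) → u = 0
  /-- the complex structure `J` -/
  J : Π x : M, TangentSpace 𝓘(ℝ, E) x →L[ℝ] TangentSpace 𝓘(ℝ, E) x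
  J_smooth : IsSmoothEndo J
  J_sq : ∀ x u, J x (J x u) = -u
  g_J : ∀ x u v, g x (J x u) (J x v) = g x u v
  /-- the special connection `∇` -/
  conn : AffineConnection E M
  conn_smooth : conn.IsSmooth
  conn_flat : conn.IsFlat
  conn_torsion : CovariantDerivative.torsion conn = 0
  /-- `∇ω = 0` for the Kähler form `ω = g(J·,·)` -/
  conn_omega : conn.IsParallelBilin (fun x => (g x).comp (J x))
  /-- `d^∇ J = 0` -/
  conn_J : conn.IsClosedEndo J
  /-- the Euler vector field `ξ` -/
  ξ : SmoothVectorField 𝓘(ℝ, E) M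
  ξ_complete : ∀ x : M, ∃ γ : ℝ → M, γ 0 = x ∧ IsMIntegralCurve γ ξ
  g_neg : ∀ x, ∀ u ∈ Submodule.span ℝ {ξ x, J x (ξ x)}, u ≠ 0 → g x u u < 0
  g_pos : ∀ x u, g x u (ξ x) = 0 → g x u (J x (ξ x)) = 0 → u ≠ 0 → 0 < g x u u
  /-- The Levi-Civita connection `D` satisfies `DJ = 0`, i.e. `(M, g, J)` is (pseudo-)Kähler, and
  `Dξ = Id`. -/
  leviCivita : ∃ D : AffineConnection E M, D.IsLeviCivita g ∧ D.IsParallelEndo J ∧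
    ∀ x v, D ξ x v = v
  /-- `∇ξ = Id` -/
  conn_ξ : ∀ x v, conn ξ x v = v
  principal : ∃ ρ : ℂˣ →* Equiv.Perm M, IsPrincipalAction ρ ξ (fun x => J x (ξ x))

/-! ### Infinitesimal automorphisms -/

/-- `φ` is a (smooth) local flow of `X`, defined on the open set `U` for times `|t| < ε`. -/
structure IsLocalFlow (X : SmoothVectorField 𝓘(ℝ, E) M) (ε : ℝ) (U : Set M) (φ : ℝ → M → M) :
    Prop where
  pos : 0 < ε
  isOpen : IsOpen U
  smooth : ContMDiffOn (𝓘(ℝ, ℝ).prod 𝓘(ℝ, E)) 𝓘(ℝ, E) ∞ (fun p : ℝ × M => φ p.1 p.2)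
    (Set.Ioo (-ε) ε ×ˢ U)
  zero : ∀ x ∈ U, φ 0 x = x
  integralCurve : ∀ x ∈ U, IsMIntegralCurveOn (fun t => φ t x) X (Set.Ioo (-ε) ε)

namespace CASKManifold

/-- The map `f` preserves `g`, `J`, `∇` and `ξ` at the point `x`. For the connection this means
`f^*∇ = ∇`, where `(f^*∇)_u (f^*W) = f^*(∇_{df(u)} W)`. -/
structure PreservesAt (S : CASKManifold E M) (f : M → M) (x : M) : Prop where
  g : ∀ u v, S.g (f x) (mfderiv 𝓘(ℝ, E) 𝓘(ℝ, E) f x u) (mfderiv 𝓘(ℝ, E) 𝓘(ℝ, E) f x v)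
    = S.g x u v
  J : ∀ u, mfderiv 𝓘(ℝ, E) 𝓘(ℝ, E) f x (S.J x u)
    = S.J (f x) (mfderiv 𝓘(ℝ, E) 𝓘(ℝ, E) f x u)
  conn : ∀ (W : SmoothVectorField 𝓘(ℝ, E) M) (u : TangentSpace 𝓘(ℝ, E) x),
    mfderiv 𝓘(ℝ, E) 𝓘(ℝ, E) f x (S.conn (mpullback 𝓘(ℝ, E) 𝓘(ℝ, E) f W) x u)
      = S.conn W (f x) (mfderiv 𝓘(ℝ, E) 𝓘(ℝ, E) f x u)
  ξ : mfderiv 𝓘(ℝ, E) 𝓘(ℝ, E) f x (S.ξ x) = S.ξ (f x)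

/-- `X` is an infinitesimal automorphism: its local flow preserves the CASK data. -/
def IsInfinitesimalAutomorphism (S : CASKManifold E M) (X : SmoothVectorField 𝓘(ℝ, E) M) : Prop :=
  ∀ x : M, ∃ (ε : ℝ) (U : Set M) (φ : ℝ → M → M), x ∈ U ∧ IsLocalFlow X ε U φ ∧
    ∀ t ∈ Set.Ioo (-ε) ε, ∀ y ∈ U, S.PreservesAt (φ t) y

/-- The Lie algebra `𝔞𝔲𝔱(M)` of infinitesimal automorphisms. (The infinitesimal automorphisms are
closed under linear combinations and brackets, so the Lie subalgebra spanned by them consists of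
infinitesimal automorphisms only; writing the span provides the Lie algebra structure.) -/
def aut (S : CASKManifold E M) : LieSubalgebra ℝ (SmoothVectorField 𝓘(ℝ, E) M) :=
  LieSubalgebra.lieSpan ℝ (SmoothVectorField 𝓘(ℝ, E) M)
    {X | S.IsInfinitesimalAutomorphism X}

end CASKManifold

/-! ### The cotangent bundle and its splitting -/

/-- The total space `N = T^*M` of the cotangent bundle. -/
abbrev Cotangent (E M : Type*) [NormedAddCommGroup E] [NormedSpace ℝ E]
    [TopologicalSpace M] [ChartedSpace E M] : Type _ :=
  TotalSpace (E →L[ℝ] ℝ) (fun x : M => TangentSpace 𝓘(ℝ, E) x →L[ℝ] ℝ)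

/-- The model with corners of `T^*M`. -/
abbrev cotangentModel (E : Type*) [NormedAddCommGroup E] [NormedSpace ℝ E] :
    ModelWithCorners ℝ (E × (E →L[ℝ] ℝ)) (ModelProd E (E →L[ℝ] ℝ)) :=
  𝓘(ℝ, E).prod 𝓘(ℝ, E →L[ℝ] ℝ)

/-- The differential `dπ : T_αN → T_{π(α)}M` of the projection `π : T^*M → M`. -/
def dproj (α : Cotangent E M) :
    TangentSpace (cotangentModel E) α →L[ℝ] TangentSpace 𝓘(ℝ, E) α.proj :=
  mfderiv (cotangentModel E) 𝓘(ℝ, E) (TotalSpace.proj : Cotangent E M → M) α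

/-- The function `α ↦ λ(W) = α(W)` on `T^*M` given by a vector field `W` on `M`, where `λ` is the
tautological section. -/
def pairing (W : Π x : M, TangentSpace 𝓘(ℝ, E) x) (α : Cotangent E M) : ℝ := α.2 (W α.proj)

theorem mdifferentiableAt_proj (α : Cotangent E M) : MDifferentiableAt (cotangentModel E) 𝓘(ℝ, E)
     (TotalSpace.proj : Cotangent E M → M) α :=
  (contMDiff_proj (n := 1) _ ).mdifferentiable (by simp) α

theorem mdifferentiableAt_pairing {W : Π x : M, TangentSpace 𝓘(ℝ, E) x} {α : Cotangent E M}
    (hW : MDiffAt (T% W) α.proj) : MDifferentiableAt (cotangentModel E) 𝓘(ℝ, ℝ) (pairing W) α := by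
  have h1 : MDifferentiableAt (cotangentModel E) (cotangentModel E)
     (fun β : Cotangent E M => (⟨β.proj, β.2⟩ : Cotangent E M)) α := mdifferentiableAt_id
  have h2 : MDifferentiableAt (cotangentModel E) (𝓘(ℝ, E).tangent)
     (fun β : Cotangent E M => (⟨β.proj, W β.proj⟩ : TangentBundle 𝓘(ℝ, E) M)) α :=
    MDifferentiableAt.comp α hW (mdifferentiableAt_proj α)
  have := MDifferentiableAt.clm_bundle_apply (E₂ := Bundle.Trivial M ℝ) (F₂ := ℝ) h1 h2
  exact ((mdifferentiableAt_totalSpace _ _).1 this).2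

/-- `((π^*D)_A λ)(W)` for the tautological section `λ` of `π^*T^*M`, computed with the connection on
`π^*T^*M` that is dual to the pullback connection: `A(λ(W)) - λ(D_{dπ(A)} W)`. -/
def verticalPartAux (D : AffineConnection E M)
    (α : Cotangent E M) (A : TangentSpace (cotangentModel E) α)
    (W : Π x : M, TangentSpace 𝓘(ℝ, E) x) : ℝ :=
  mvfderiv (cotangentModel E) (pairing W) α A - α.2 (D W α.proj (dproj α A))

theorem tensorialAt_verticalPartAux
    (D : AffineConnection E M)
    (α : Cotangent E M) (A : TangentSpace (cotangentModel E) α) :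
    TensorialAt 𝓘(ℝ, E) E (verticalPartAux D α A) α.proj where
  smul {f σ} hf hσ := by
    have h1 : pairing (f • σ) = fun β : Cotangent E M => f β.proj * pairing σ β := by
      ext β; simp [pairing]
    have hp : MDifferentiableAt (cotangentModel E) 𝓘(ℝ, ℝ) (fun β : Cotangent E M => f β.proj) α :=
      MDifferentiableAt.comp α hf (mdifferentiableAt_proj α)
    have hc : mvfderiv (cotangentModel E) (fun β : Cotangent E M => f β.proj) α A
        = mvfderiv 𝓘(ℝ, E) f α.proj (dproj α A) := by
      have := mfderiv_comp α hf (mdifferentiableAt_proj α)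
      simp only [mvfderiv, dproj]
      erw [this]; rfl
    simp only [verticalPartAux, h1]
    rw [mvfderiv_fun_mul hp (mdifferentiableAt_pairing hσ)]
    rw [D.isCovariantDerivativeOnUniv.leibniz hσ hf]
    simp only [_root_.add_apply, _root_.smul_apply,
      ContinuousLinearMap.smulRight_apply, map_add, map_smul, smul_eq_mul, hc]
    simp only [pairing]
    ring
  add {σ σ'} hσ hσ' := by
    have h1 : pairing (σ + σ') = fun β : Cotangent E M => pairing σ β + pairing σ' β := by
      ext β; simp [pairing]
    simp only [verticalPartAux, h1]
    rw [mvfderiv_fun_add (mdifferentiableAt_pairing hσ) (mdifferentiableAt_pairing hσ')]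
    rw [D.isCovariantDerivativeOnUniv.add hσ hσ']
    simp only [_root_.add_apply, map_add]
    ring

/-- `A ↦ (π^*D)_A λ`, the vertical component of `A ∈ T_αN` with respect to `D`. -/
def verticalPart (D : AffineConnection E M)
    (α : Cotangent E M) : TangentSpace (cotangentModel E) α →ₗ[ℝ]
      (TangentSpace 𝓘(ℝ, E) α.proj →L[ℝ] ℝ) where
  toFun A := TensorialAt.mkHom _ α.proj (tensorialAt_verticalPartAux D α A)
  map_add' A B := by
    ext w
    simp only [_root_.add_apply, TensorialAt.mkHom_apply_eq_extend, verticalPartAux,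
      ContinuousLinearMap.map_add]
    ring
  map_smul' c A := by
    ext w
    simp only [_root_.smul_apply, TensorialAt.mkHom_apply_eq_extend, verticalPartAux,
      ContinuousLinearMap.map_smul,
      smul_eq_mul, RingHom.id_apply]
    ring

theorem clm_mfderiv_extChartAt_eq {F : Type*} [NormedAddCommGroup F] [NormedSpace ℝ F]
    (α : Cotangent E M) (L : (E × (E →L[ℝ] ℝ)) →L[ℝ] F) (g : Cotangent E M → F)
    (g' : TangentSpace (cotangentModel E) α →L[ℝ] F)
    (hg : HasMFDerivAt (cotangentModel E) 𝓘(ℝ, F) g α g')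
    (hev : ∀ᶠ β in 𝓝 α, L (extChartAt (cotangentModel E) α β) = g β)
    (A : TangentSpace (cotangentModel E) α) :
    L (mfderiv (cotangentModel E) 𝓘(ℝ, E × (E →L[ℝ] ℝ)) (extChartAt (cotangentModel E) α) α A)
      = g' A := by
  have hd : HasMFDerivAt (cotangentModel E) 𝓘(ℝ, E × (E →L[ℝ] ℝ))
      (extChartAt (cotangentModel E) α) α
      (mfderiv (cotangentModel E) 𝓘(ℝ, E × (E →L[ℝ] ℝ)) (extChartAt (cotangentModel E) α) α) :=
    (mdifferentiableAt_extChartAt (mem_chart_source _ α)).hasMFDerivAt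
  have h3 := HasMFDerivAt.comp α
    (L.hasMFDerivAt (x := extChartAt (cotangentModel E) α α)) hd
  have h4 := h3.congr_of_eventuallyEq (hev.mono fun β h => h.symm)
  exact DFunLike.congr_fun (hasMFDerivAt_unique h4 hg) A

theorem splitting_injective (D : AffineConnection E M)
    (α : Cotangent E M) :
    Function.Injective ((dproj α).toLinearMap.prod (verticalPart D α)) := by
  rw [← LinearMap.ker_eq_bot, LinearMap.ker_eq_bot']
  intro A hA
  have h1 : dproj α A = 0 := congrArg Prod.fst hA
  have h2 : verticalPart D α A = 0 := congrArg Prod.snd hA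
  set e := extChartAt (cotangentModel E) α with he
  have hinv : (mfderiv (cotangentModel E) 𝓘(ℝ, E × (E →L[ℝ] ℝ)) e α).IsInvertible :=
    isInvertible_mfderiv_extChartAt (I := cotangentModel E) (mem_extChartAt_source α)
  set T := mfderiv (cotangentModel E) 𝓘(ℝ, E × (E →L[ℝ] ℝ)) e α
  have hT : T A = (0 : E × (E →L[ℝ] ℝ)) := by
    apply Prod.ext
    · have hb : HasMFDerivAt (cotangentModel E) 𝓘(ℝ, E)
          (fun β : Cotangent E M => extChartAt 𝓘(ℝ, E) α.proj β.proj) α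
          ((mfderiv 𝓘(ℝ, E) 𝓘(ℝ, E) (extChartAt 𝓘(ℝ, E) α.proj) α.proj).comp (dproj α)) :=
        HasMFDerivAt.comp α
          (mdifferentiableAt_extChartAt (mem_chart_source _ α.proj)).hasMFDerivAt
          (mdifferentiableAt_proj α).hasMFDerivAt
      refine (clm_mfderiv_extChartAt_eq α (ContinuousLinearMap.fst ℝ E (E →L[ℝ] ℝ)) _ _ hb ?_ A).trans ?_
      · filter_upwards with β
        simp only [FiberBundle.extChartAt]
        rfl
      · change mfderiv 𝓘(ℝ, E) 𝓘(ℝ, E) (extChartAt 𝓘(ℝ, E) α.proj) α.proj (dproj α A) = _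
        rw [h1]
        exact ContinuousLinearMap.map_zero _
    · ext w
      set t := trivializationAt E (TangentSpace 𝓘(ℝ, E) : M → Type _) α.proj
      have hx : α.proj ∈ t.baseSet := FiberBundle.mem_baseSet_trivializationAt' α.proj
      set v : TangentSpace 𝓘(ℝ, E) α.proj := t.symm α.proj w
      have hsm : MDiffAt (T% (FiberBundle.extend E v)) α.proj :=
        FiberBundle.mdifferentiableAt_extend 𝓘(ℝ, E) E v
      have hb : HasMFDerivAt (cotangentModel E) 𝓘(ℝ, ℝ)
          (pairing (FiberBundle.extend E v)) α
          (mfderiv (cotangentModel E) 𝓘(ℝ, ℝ) (pairing (FiberBundle.extend E v)) α) :=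
        (mdifferentiableAt_pairing hsm).hasMFDerivAt
      refine (clm_mfderiv_extChartAt_eq α ((ContinuousLinearMap.apply ℝ ℝ w).comp
        (ContinuousLinearMap.snd ℝ E (E →L[ℝ] ℝ))) _ _ hb ?_ A).trans ?_
      · have hmem : ∀ᶠ β : Cotangent E M in 𝓝 α, β.proj ∈ t.baseSet :=
          (FiberBundle.continuous_proj (E →L[ℝ] ℝ)
            (fun x : M => TangentSpace 𝓘(ℝ, E) x →L[ℝ] ℝ)).continuousAt.eventually
            (t.open_baseSet.mem_nhds hx)
        filter_upwards [hmem] with β hβ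
        have h6 : FiberBundle.extend E v β.proj = t.symm β.proj w := by
          simp only [FiberBundle.extend, v]
          rw [t.apply_mk_symm hx]
        have h7 : ContinuousLinearMap.inCoordinates E (TangentSpace 𝓘(ℝ, E) : M → Type _) ℝ
            (Bundle.Trivial M ℝ) α.proj β.proj α.proj β.proj β.2 w = β.2 (t.symm β.proj w) := by
          rw [ContinuousLinearMap.inCoordinates_eq hβ (Set.mem_univ _)]
          simp [t]
        simp only [pairing, h6]
        rw [← h7, FiberBundle.extChartAt]
        rfl
      · have h5 : verticalPart D α A v = 0 := by rw [h2]; rfl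
        change verticalPartAux D α A (FiberBundle.extend E v) = 0 at h5
        rw [verticalPartAux, h1] at h5
        rw [ContinuousLinearMap.map_zero] at h5
        rw [ContinuousLinearMap.map_zero, sub_zero] at h5
        exact h5
  exact hinv.injective (hT.trans (ContinuousLinearMap.map_zero T).symm)


theorem splitting_bijective
    (D : AffineConnection E M)
    (α : Cotangent E M) :
    Function.Bijective ((dproj α).toLinearMap.prod (verticalPart D α)) := by
  have hinj := splitting_injective D α
  refine ⟨hinj, ?_⟩
  let L : (E × (E →L[ℝ] ℝ)) →ₗ[ℝ] (E × (E →L[ℝ] ℝ)) :=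
    (dproj α).toLinearMap.prod (verticalPart D α)
  have hL : Function.Injective L := hinj
  exact (LinearMap.injective_iff_surjective (f := L)).1 hL

/-- The splitting `T_αN ≅ T_{π(α)}M ⊕ T_{π(α)}^*M`, `A ↦ (dπ(A), (π^*D)_A λ)`, induced by `D`. -/
def splitting (D : AffineConnection E M)
    (α : Cotangent E M) : TangentSpace (cotangentModel E) α ≃ₗ[ℝ]
      (TangentSpace 𝓘(ℝ, E) α.proj × (TangentSpace 𝓘(ℝ, E) α.proj →L[ℝ] ℝ)) :=
  LinearEquiv.ofBijective ((dproj α).toLinearMap.prod (verticalPart D α))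
    (splitting_bijective D α)

namespace CASKManifold

/-! ### The rigid c-map structure -/

/-- The Kähler form `ω = g(J·,·)`, as the map `v ↦ ω(v,·)`. -/
def omega (S : CASKManifold E M) (x : M) :
    TangentSpace 𝓘(ℝ, E) x →L[ℝ] TangentSpace 𝓘(ℝ, E) x →L[ℝ] ℝ := (S.g x).comp (S.J x)

/-- The dual metric `g⁻¹` on `T_x^*M`. -/
def gInv (S : CASKManifold E M) (x : M) (a b : TangentSpace 𝓘(ℝ, E) x →L[ℝ] ℝ) : ℝ :=
  b ((S.g x).inverse a)

/-- The bivector `ω⁻¹` as a bilinear form on `T_x^*M`; in coordinates `ω⁻¹(a,b) = ω^{jk} a_j b_k`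
with the inverse matrix `(ω^{jk})` of `(ω_{jk})`. -/
def omegaInv (S : CASKManifold E M) (x : M) (a b : TangentSpace 𝓘(ℝ, E) x →L[ℝ] ℝ) : ℝ :=
  b ((S.omega x).inverse a)

/-- The metric `g_N = g ⊕ g⁻¹` on `N = T^*M`. -/
def gN (S : CASKManifold E M) (α : Cotangent E M) (A B : TangentSpace (cotangentModel E) α) : ℝ :=
  S.g α.proj (splitting S.conn α A).1 (splitting S.conn α B).1
    + S.gInv α.proj (splitting S.conn α A).2 (splitting S.conn α B).2

/-- The complex structure `I₁ = J ⊕ J^*` on `N = T^*M`. -/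
def I₁ (S : CASKManifold E M) (α : Cotangent E M) (A : TangentSpace (cotangentModel E) α) :
    TangentSpace (cotangentModel E) α :=
  (splitting S.conn α).symm
    (S.J α.proj (splitting S.conn α A).1, ((splitting S.conn α A).2).comp (S.J α.proj))

/-- The form `ω₁ = g_N(I₁·,·)`. -/
def omega₁ (S : CASKManifold E M) (α : Cotangent E M)
    (A B : TangentSpace (cotangentModel E) α) : ℝ := S.gN α (S.I₁ α A) B

/-- The horizontal lift of a vector field on `M` to `N = T^*M`. -/
def horizontalLift (S : CASKManifold E M) (X : Π x : M, TangentSpace 𝓘(ℝ, E) x)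
    (α : Cotangent E M) : TangentSpace (cotangentModel E) α :=
  (splitting S.conn α).symm (X α.proj, 0)

/-- The rotating vector field `Z`, minus the horizontal lift of `Jξ`. -/
def Z (S : CASKManifold E M) (α : Cotangent E M) : TangentSpace (cotangentModel E) α :=
  -S.horizontalLift (fun x => S.J x (S.ξ x)) α

/-- The value on two vector fields of the exterior derivative of a one-form,
`dθ(A,B) = A(θ(B)) - B(θ(A)) - θ([A,B])`. -/
def extDerivOneForm (θ : Π α : Cotangent E M, TangentSpace (cotangentModel E) α → ℝ)
    (A B : Π α : Cotangent E M, TangentSpace (cotangentModel E) α) (α : Cotangent E M) : ℝ :=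
  mvfderiv (cotangentModel E) (fun β => θ β (B β)) α (A α)
    - mvfderiv (cotangentModel E) (fun β => θ β (A β)) α (B α)
    - θ α (mlieBracket (cotangentModel E) A B α)

/-- The two-form `ω_H = ω₁ + d(ι_Z g_N)`, evaluated on two vector fields. -/
def omegaH (S : CASKManifold E M)
    (A B : Π α : Cotangent E M, TangentSpace (cotangentModel E) α) (α : Cotangent E M) : ℝ :=
  S.omega₁ α (A α) (B α) + extDerivOneForm (fun β C => S.gN β (S.Z β) C) A B α

/-- The one-form `λ ∘ (π^*∇)(π^*X)` at `α`, i.e. `v ↦ α(∇_v X)`. -/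
def lambdaNabla (S : CASKManifold E M) (X : Π x : M, TangentSpace 𝓘(ℝ, E) x)
    (α : Cotangent E M) : TangentSpace 𝓘(ℝ, E) α.proj →L[ℝ] ℝ :=
  α.2.comp (S.conn X α.proj)

/-- The canonical lift `Y = π^*X - λ ∘ (π^*∇)(π^*X)` of `X` to `N = T^*M`. -/
def canonicalLift (S : CASKManifold E M) (X : Π x : M, TangentSpace 𝓘(ℝ, E) x)
    (α : Cotangent E M) : TangentSpace (cotangentModel E) α :=
  (splitting S.conn α).symm (X α.proj, -S.lambdaNabla X α)

/-- `μ_Y = ½ (g_N(Z,Y) + π^*ω⁻¹(λ ∘ (π^*∇)(π^*X), λ))`. -/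
def momentMap (S : CASKManifold E M) (X : Π x : M, TangentSpace 𝓘(ℝ, E) x)
    (α : Cotangent E M) : ℝ :=
  (1 / 2 : ℝ) * (S.gN α (S.Z α) (S.canonicalLift X α)
    + S.omegaInv α.proj (S.lambdaNabla X α) α.2)

end CASKManifold

end Base

/-! ### Hamiltonian functions and comoment maps -/

section Comoment

variable {F H N : Type*} [NormedAddCommGroup F] [NormedSpace ℝ F] [CompleteSpace F]
  [TopologicalSpace H] {I : ModelWithCorners ℝ F H} [TopologicalSpace N] [ChartedSpace H N]
  [IsManifold I ∞ N]

/-- `f` is an `Ω`-Hamiltonian function for `Y`: `ι_Y Ω = -df`. -/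
def IsHamiltonianFunction
    (Ω : (Π p : N, TangentSpace I p) → (Π p : N, TangentSpace I p) → N → ℝ)
    (Y : Π p : N, TangentSpace I p) (f : N → ℝ) : Prop :=
  ∀ (B : SmoothVectorField I N) (p : N), Ω Y B p = -mvfderiv I f p (B p)

/-- `μ` is an equivariant comoment map for the infinitesimal action `ρ` of the Lie algebra `𝔤`:
it is linear, `μ_X` is an `Ω`-Hamiltonian function for `ρ(X)`, and
`ρ(X₁)(μ_{X₂}) = μ_{[X₁,X₂]}`. -/
structure IsEquivariantComomentMap {𝔤 : Type*} [LieRing 𝔤] [LieAlgebra ℝ 𝔤]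
    (Ω : (Π p : N, TangentSpace I p) → (Π p : N, TangentSpace I p) → N → ℝ)
    (ρ : 𝔤 →ₗ⁅ℝ⁆ SmoothVectorField I N) (μ : 𝔤 →ₗ[ℝ] C^∞⟮I, N; 𝓘(ℝ, ℝ), ℝ⟯) : Prop where
  hamiltonian : ∀ X : 𝔤, IsHamiltonianFunction Ω (ρ X) (μ X)
  equivariant : ∀ (X₁ X₂ : 𝔤) (p : N), mvfderiv I (μ X₂) p (ρ X₁ p) = μ ⁅X₁, X₂⁆ p

end Comoment

end

open Bundle VectorField
open scoped Manifold ContDiff Topology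

noncomputable section

set_option linter.unusedSectionVars false

/-! ### Derivatives of vector-valued functions in charts -/

/-! Write `A = ∇X`. Everything about an infinitesimal automorphism that matters here is contained in
three linear conditions, collected in `IsInfinitesimalSymmetry`: `A` is skew for `ω`, `Aξ = X`, and
`A` is parallel. They come from differentiating the invariance of `ω`, `ξ` and `∇` along the flow at
time zero, which gives `L_X ω = 0`, `[X, ξ] = 0` and `[X, ∇_V W] = ∇_V [X, W] + ∇_{[X,V]} W`; these
are then rewritten with `∇ω = 0`, `∇ξ = Id`, vanishing torsion and flatness. The conditions are
stable under linear combinations and brackets, with `∇[X₁, X₂] = A₂A₁ - A₁A₂`, hence hold on the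
whole Lie algebra `aut`, which is defined as a Lie span.

A tangent vector of `T^*M` is determined by its projection and its derivatives of the functions
`λ(W)`, `W` a vector field on `M` (`cotangent_tangent_ext`). Since `∇` is torsion-free, the
canonical lift satisfies `Y(λ(W)) = λ([X, W])`. This one formula gives smoothness of `Y`, the
generation of the flow on covectors (the derivative of `φ_t^*W` at time zero is `[X, W]`), and
compatibility with brackets (the Jacobi identity).

The form `ω_H` becomes explicit in the splitting. One has `ι_Z g_N = -π^*(ω(ξ, ·))`, and `∇ξ = Id`,
`∇ω = 0` and vanishing torsion make its differential `-2 π^*ω`. As `ω₁ = π^*ω ⊕ ω⁻¹`, it follows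
that `ω_H = -π^*ω ⊕ ω⁻¹` (`omegaH_apply`).

Correspondingly `μ_X = ½(-ω(ξ, X) + ω⁻¹(α ∘ A, α))`. By skewness and `Aξ = X` the first term
contributes `ω(X, ·)` to `dμ_X`. The second is a quadratic form in `α`, symmetric because `A` is
skew, with parallel coefficients because `A` and `ω` are parallel, so only the vertical derivative
survives and contributes `ω⁻¹(α ∘ A, ·)`. Their sum is `-ι_Y ω_H`. Equivariance is then pointwise
algebra: write `α = ω(s, ·)` and use skewness together with the formulas for `[X₁, X₂]` and `∇[X₁,
X₂]`. -/

theorem two_le_infty : (2 : ℕ∞ω) ≤ ∞ := WithTop.coe_le_coe.2 le_top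

section Calculus

variable {E : Type*} [NormedAddCommGroup E] [NormedSpace ℝ E] {H : Type*} [TopologicalSpace H]
  {I : ModelWithCorners ℝ E H} {P : Type*} [TopologicalSpace P] [ChartedSpace H P]
  {E' : Type*} [NormedAddCommGroup E'] [NormedSpace ℝ E'] {H' : Type*} [TopologicalSpace H']
  {I' : ModelWithCorners ℝ E' H'} {P' : Type*} [TopologicalSpace P'] [ChartedSpace H' P']
  {F : Type*} [NormedAddCommGroup F] [NormedSpace ℝ F]
  {F' : Type*} [NormedAddCommGroup F'] [NormedSpace ℝ F']
  {F'' : Type*} [NormedAddCommGroup F''] [NormedSpace ℝ F'']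

theorem mvfderiv_fun_comp_apply {g : P' → F} {f : P → P'} {p : P}
    (hg : MDifferentiableAt I' 𝓘(ℝ, F) g (f p)) (hf : MDifferentiableAt I I' f p)
    (v : TangentSpace I p) :
    mvfderiv I (fun q => g (f q)) p v = mvfderiv I' g (f p) (mfderiv I I' f p v) :=
  DFunLike.congr_fun (mfderiv_comp p hg hf) v

theorem mvfderiv_eq_fderiv {g : E → F} {x : E} : mvfderiv 𝓘(ℝ, E) g x = fderiv ℝ g x := by
  ext v
  exact DFunLike.congr_fun mfderiv_eq_fderiv v

theorem Filter.EventuallyEq.mvfderiv_eq {f g : P → F} {p : P} (h : f =ᶠ[𝓝 p] g) :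
    mvfderiv I f p = mvfderiv I g p := by
  ext v
  exact DFunLike.congr_fun h.mfderiv_eq v

theorem HasFDerivAt.mvfderiv_comp_apply {g : F → F'} {g' : F →L[ℝ] F'} {f : P → F} {p : P}
    (hg : HasFDerivAt g g' (f p)) (hf : MDifferentiableAt I 𝓘(ℝ, F) f p) (v : TangentSpace I p) :
    mvfderiv I (fun q => g (f q)) p v = g' (mvfderiv I f p v) :=
  DFunLike.congr_fun (HasMFDerivAt.mfderiv
    (HasMFDerivAt.comp p hg.hasMFDerivAt hf.hasMFDerivAt)) v

theorem mvfderiv_clm_apply_apply {L : P → F →L[ℝ] F'} {f : P → F} {p : P}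
    (hL : MDifferentiableAt I 𝓘(ℝ, F →L[ℝ] F') L p) (hf : MDifferentiableAt I 𝓘(ℝ, F) f p)
    (v : TangentSpace I p) :
    mvfderiv I (fun q => L q (f q)) p v
      = mvfderiv I L p v (f p) + L p (mvfderiv I f p v) := by
  have hb : HasFDerivAt (fun z : (F →L[ℝ] F') × F => z.1 z.2)
      ((isBoundedBilinearMap_apply (𝕜 := ℝ) (E := F) (F := F')).deriv (L p, f p)) (L p, f p) :=
    (isBoundedBilinearMap_apply (𝕜 := ℝ) (E := F) (F := F')).hasFDerivAt _
  have hLf : MDifferentiableAt I 𝓘(ℝ, (F →L[ℝ] F') × F) (fun q => (L q, f q)) p :=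
    hL.prodMk_space hf
  have h1 := HasFDerivAt.mvfderiv_comp_apply
    (ContinuousLinearMap.fst ℝ (F →L[ℝ] F') F).hasFDerivAt hLf v
  have h2 := HasFDerivAt.mvfderiv_comp_apply
    (ContinuousLinearMap.snd ℝ (F →L[ℝ] F') F).hasFDerivAt hLf v
  refine (HasFDerivAt.mvfderiv_comp_apply (f := fun q => (L q, f q)) hb hLf v).trans ?_
  change (L p) (mvfderiv I (fun q => (L q, f q)) p v).2
    + (mvfderiv I (fun q => (L q, f q)) p v).1 (f p) = _
  simp only [ContinuousLinearMap.coe_fst', ContinuousLinearMap.coe_snd'] at h1 h2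
  rw [h1, h2]
  exact add_comm _ _

variable [I.Boundaryless] [IsManifold I ∞ P]

theorem mdifferentiableAt_comp_extChartAt_symm {f : P → F} {p₀ p : P}
    (hp : p ∈ (extChartAt I p₀).source) (hf : MDifferentiableAt I 𝓘(ℝ, F) f p) :
    DifferentiableAt ℝ (fun z => f ((extChartAt I p₀).symm z)) (extChartAt I p₀ p) := by
  have : IsManifold I 1 P := IsManifold.of_le (n := ∞) (by simp)
  rw [← mdifferentiableAt_iff_differentiableAt]
  have h1 : MDifferentiableAt 𝓘(ℝ, E) I (extChartAt I p₀).symm (extChartAt I p₀ p) := by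
    have := mdifferentiableWithinAt_extChartAt_symm (I := I) (x := p₀)
      ((extChartAt I p₀).map_source hp)
    rwa [I.range_eq_univ, mdifferentiableWithinAt_univ] at this
  have h2 : MDifferentiableAt I 𝓘(ℝ, F) f ((extChartAt I p₀).symm (extChartAt I p₀ p)) := by
    rwa [(extChartAt I p₀).left_inv hp]
  exact h2.comp _ h1

theorem contDiffAt_comp_extChartAt_symm {f : P → F} {p₀ p : P} {n : ℕ∞ω} (hn : n ≤ ∞)
    (hp : p ∈ (extChartAt I p₀).source) (hf : ContMDiffAt I 𝓘(ℝ, F) n f p) :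
    ContDiffAt ℝ n (fun z => f ((extChartAt I p₀).symm z)) (extChartAt I p₀ p) := by
  have : IsManifold I n P := IsManifold.of_le (n := ∞) hn
  rw [← contMDiffAt_iff_contDiffAt]
  have h1 : ContMDiffAt 𝓘(ℝ, E) I n (extChartAt I p₀).symm (extChartAt I p₀ p) :=
    (contMDiffOn_extChartAt_symm p₀).contMDiffAt
      ((isOpen_extChartAt_target p₀).mem_nhds ((extChartAt I p₀).map_source hp))
  have h2 : ContMDiffAt I 𝓘(ℝ, F) n f ((extChartAt I p₀).symm (extChartAt I p₀ p)) := by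
    rwa [(extChartAt I p₀).left_inv hp]
  exact h2.comp _ h1

theorem mdifferentiableAt_extChartAt_of_mem {p₀ p : P} (hp : p ∈ (extChartAt I p₀).source) :
    MDifferentiableAt I 𝓘(ℝ, E) (extChartAt I p₀) p := by
  have : IsManifold I 1 P := IsManifold.of_le (n := ∞) (by simp)
  exact mdifferentiableAt_extChartAt (by rwa [extChartAt_source] at hp)

theorem mvfderiv_eq_fderiv_comp_extChartAt_symm {f : P → F} {p₀ p : P}
    (hp : p ∈ (extChartAt I p₀).source) (hf : MDifferentiableAt I 𝓘(ℝ, F) f p)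
    (A : TangentSpace I p) :
    mvfderiv I f p A = fderiv ℝ (fun z => f ((extChartAt I p₀).symm z)) (extChartAt I p₀ p)
      (mvfderiv I (extChartAt I p₀) p A) := by
  have h := mdifferentiableAt_comp_extChartAt_symm hp hf
  have he := mdifferentiableAt_extChartAt_of_mem hp
  rw [← HasFDerivAt.mvfderiv_comp_apply h.hasFDerivAt he]
  refine DFunLike.congr_fun (Filter.EventuallyEq.mvfderiv_eq ?_) A
  filter_upwards [(isOpen_extChartAt_source p₀).mem_nhds hp] with q hq
  rw [(extChartAt I p₀).left_inv hq]

theorem mvfderiv_extChartAt_self (p : P) (A : TangentSpace I p) :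
    mvfderiv I (extChartAt I p) p A = A := by
  have : IsManifold I 1 P := IsManifold.of_le (n := ∞) (by simp)
  exact DFunLike.congr_fun (mfderiv_extChartAt_self (I := I) (x := p)) A

theorem trivializationAt_tangent_apply {p₀ p : P} (hp : p ∈ (extChartAt I p₀).source)
    (A : TangentSpace I p) :
    (trivializationAt E (TangentSpace I) p₀ ⟨p, A⟩).2 = mvfderiv I (extChartAt I p₀) p A := by
  have : IsManifold I 1 P := IsManifold.of_le (n := ∞) (by simp)
  rw [extChartAt_source] at hp
  have h := DFunLike.congr_fun (TangentBundle.continuousLinearMapAt_trivializationAt (I := I) hp) A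
  refine Eq.trans ?_ h
  rw [Bundle.Trivialization.continuousLinearMapAt_apply,
    Bundle.Trivialization.coe_linearMapAt_of_mem _ (by simpa using hp)]

/-- Smoothness of a vector field is smoothness of its coordinates in a chart. -/
theorem contMDiffAt_vectorField_iff {V : Π p : P, TangentSpace I p} {p₀ p : P}
    (hp : p ∈ (extChartAt I p₀).source) :
    ContMDiffAt I I.tangent ∞ (fun q => (⟨q, V q⟩ : TangentBundle I P)) p ↔
      ContMDiffAt I 𝓘(ℝ, E) ∞ (fun q => mvfderiv I (extChartAt I p₀) q (V q)) p := by
  have hp' := hp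
  rw [extChartAt_source] at hp'
  rw [(trivializationAt E (TangentSpace I) p₀).contMDiffAt_section_iff (by simpa using hp')]
  apply Filter.EventuallyEq.contMDiffAt_iff
  filter_upwards [(isOpen_extChartAt_source p₀).mem_nhds hp] with q hq
  exact trivializationAt_tangent_apply hq _

theorem mdifferentiableAt_vectorField_iff {V : Π p : P, TangentSpace I p} {p₀ p : P}
    (hp : p ∈ (extChartAt I p₀).source) :
    MDifferentiableAt I I.tangent (fun q => (⟨q, V q⟩ : TangentBundle I P)) p ↔
      MDifferentiableAt I 𝓘(ℝ, E) (fun q => mvfderiv I (extChartAt I p₀) q (V q)) p := by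
  have hp' := hp
  rw [extChartAt_source] at hp'
  rw [(trivializationAt E (TangentSpace I) p₀).mdifferentiableAt_section_iff I V
    (by simpa using hp')]
  have : (fun q => mvfderiv I (extChartAt I p₀) q (V q)) =ᶠ[𝓝 p]
      fun q => (trivializationAt E (TangentSpace I) p₀ ⟨q, V q⟩).2 := by
    filter_upwards [(isOpen_extChartAt_source p₀).mem_nhds hp] with q hq
    exact (trivializationAt_tangent_apply hq _).symm
  exact ⟨fun h => h.congr_of_eventuallyEq this, fun h => h.congr_of_eventuallyEq this.symm⟩

theorem mpullbackWithin_extChartAt_symm_apply (V : Π p : P, TangentSpace I p) {p₀ : P} {z : E}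
    (hz : z ∈ (extChartAt I p₀).target) :
    mpullbackWithin 𝓘(ℝ, E) I (extChartAt I p₀).symm V (Set.range I) z
      = mvfderiv I (extChartAt I p₀) ((extChartAt I p₀).symm z) (V ((extChartAt I p₀).symm z)) := by
  have : IsManifold I 1 P := IsManifold.of_le (n := ∞) (by simp)
  have hi := isInvertible_mfderivWithin_extChartAt_symm (I := I) hz
  rw [mpullbackWithin_apply]
  have h1 := mfderiv_extChartAt_comp_mfderivWithin_extChartAt_symm (I := I) hz
  obtain ⟨e, he⟩ := hi
  rw [← he, ContinuousLinearMap.inverse_equiv]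
  rw [← he] at h1
  have h2 := DFunLike.congr_fun h1 (e.symm (V ((extChartAt I p₀).symm z)))
  refine Eq.trans h2.symm ?_
  change mfderiv I 𝓘(ℝ, E) (extChartAt I p₀) _ (e (e.symm _)) = _
  rw [e.apply_symm_apply]
  rfl

/-- In the chart centred at `p` itself the derivative of the chart at `p` is the identity, so the
bracket needs no change of fibre. -/
theorem mlieBracket_eq_lieBracket [CompleteSpace E] (V W : Π p : P, TangentSpace I p) (p : P) :
    (mlieBracket I V W p : E) = lieBracket ℝ
      (fun z => mvfderiv I (extChartAt I p) ((extChartAt I p).symm z) (V ((extChartAt I p).symm z)))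
      (fun z => mvfderiv I (extChartAt I p) ((extChartAt I p).symm z) (W ((extChartAt I p).symm z)))
      (extChartAt I p p) := by
  have : IsManifold I 1 P := IsManifold.of_le (n := ∞) (by simp)
  rw [← mlieBracketWithin_univ, mlieBracketWithin_apply, mfderiv_extChartAt_self,
    Set.preimage_univ, Set.univ_inter]
  have hinv : (ContinuousLinearMap.id ℝ (TangentSpace I p)).inverse = ContinuousLinearMap.id ℝ _ :=
    ContinuousLinearMap.inverse_id
  refine (DFunLike.congr_fun hinv _).trans ?_
  rw [I.range_eq_univ]
  change lieBracketWithin (E := E) ℝ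
    (mpullbackWithin 𝓘(ℝ, E) I (extChartAt I p).symm V Set.univ)
    (mpullbackWithin 𝓘(ℝ, E) I (extChartAt I p).symm W Set.univ) Set.univ (extChartAt I p p) = _
  refine (congrFun (lieBracketWithin_univ (E := E)) _).trans ?_
  have ht : ∀ᶠ z in 𝓝 (extChartAt I p p), z ∈ (extChartAt I p).target :=
    extChartAt_target_mem_nhds p
  apply Filter.EventuallyEq.lieBracket_vectorField_eq
  all_goals
    filter_upwards [ht] with z hz
    rw [← mpullbackWithin_extChartAt_symm_apply _ hz, I.range_eq_univ]

/-- The Lie bracket is the commutator of the derivations given by vector fields. -/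
theorem mvfderiv_mlieBracket [CompleteSpace E] {V W : Π p : P, TangentSpace I p} {p : P}
    {f : P → F}
    (hV : MDifferentiableAt I I.tangent (fun q => (⟨q, V q⟩ : TangentBundle I P)) p)
    (hW : MDifferentiableAt I I.tangent (fun q => (⟨q, W q⟩ : TangentBundle I P)) p)
    (hf : ContMDiffAt I 𝓘(ℝ, F) ∞ f p) :
    mvfderiv I f p (mlieBracket I V W p)
      = mvfderiv I (fun q => mvfderiv I f q (W q)) p (V p)
        - mvfderiv I (fun q => mvfderiv I f q (V q)) p (W p) := by
  have hp : p ∈ (extChartAt I p).source := mem_extChartAt_source p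
  have hf2 : ContMDiffAt I 𝓘(ℝ, F) 2 f p := hf.of_le two_le_infty
  set e := extChartAt I p with he
  set g : E → F := fun z => f (e.symm z) with hg
  have hgd : ContDiffAt ℝ 2 g (e p) :=
    contDiffAt_comp_extChartAt_symm two_le_infty hp hf2
  have hfev : ∀ᶠ q in 𝓝 p, MDifferentiableAt I 𝓘(ℝ, F) f q := by
    have : IsManifold I 2 P := IsManifold.of_le (n := ∞) two_le_infty
    filter_upwards [(contMDiffAt_iff_contMDiffAt_nhds (by simp)).1 hf2] with q hq
    exact hq.mdifferentiableAt (by simp)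
  have hdg : DifferentiableAt ℝ (fderiv ℝ g) (e p) :=
    (hgd.fderiv_right (m := 1) (by norm_num)).differentiableAt (by simp)
  have key : ∀ {U : Π p : P, TangentSpace I p},
      MDifferentiableAt I I.tangent (fun q => (⟨q, U q⟩ : TangentBundle I P)) p →
      DifferentiableAt ℝ (fun z => mvfderiv I e (e.symm z) (U (e.symm z))) (e p) ∧
      ∀ A : TangentSpace I p, mvfderiv I (fun q => mvfderiv I f q (U q)) p A
        = fderiv ℝ (fun z => fderiv ℝ g z (mvfderiv I e (e.symm z) (U (e.symm z)))) (e p) A := by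
    intro U hU
    have h1 := (mdifferentiableAt_vectorField_iff hp).1 hU
    have h2 := mdifferentiableAt_comp_extChartAt_symm hp h1
    refine ⟨h2, fun A => ?_⟩
    have hd : DifferentiableAt ℝ
        (fun z => fderiv ℝ g z (mvfderiv I e (e.symm z) (U (e.symm z)))) (e p) :=
      hdg.clm_apply h2
    rw [← congrArg (fderiv ℝ _ (e p)) (mvfderiv_extChartAt_self p A),
      ← HasFDerivAt.mvfderiv_comp_apply hd.hasFDerivAt (mdifferentiableAt_extChartAt_of_mem hp)]
    refine DFunLike.congr_fun (Filter.EventuallyEq.mvfderiv_eq ?_) A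
    filter_upwards [(isOpen_extChartAt_source p).mem_nhds hp, hfev] with q hq hfq
    rw [mvfderiv_eq_fderiv_comp_extChartAt_symm hq hfq, e.left_inv hq]
  obtain ⟨hV1, hV2⟩ := key hV
  obtain ⟨hW1, hW2⟩ := key hW
  rw [hW2, hV2, mvfderiv_eq_fderiv_comp_extChartAt_symm hp (hfev.self_of_nhds),
    mvfderiv_extChartAt_self]
  have h3 := mlieBracket_eq_lieBracket V W p
  rw [lieBracket] at h3
  refine (congrArg (fderiv ℝ g (e p)) h3).trans ?_
  rw [fderiv_clm_apply hdg hV1, fderiv_clm_apply hdg hW1]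
  -- The second-order terms `D²g(V, W)` and `D²g(W, V)` of the two iterated derivatives cancel; what
  -- remains is `Dg` of the coordinate bracket.
  have hs : IsSymmSndFDerivAt ℝ g (e p) := hgd.isSymmSndFDerivAt (by simp)
  have hVe : mvfderiv I e (e.symm (e p)) (V (e.symm (e p))) = (V p : E) := by
    rw [e.left_inv hp]; exact mvfderiv_extChartAt_self p _
  have hWe : mvfderiv I e (e.symm (e p)) (W (e.symm (e p))) = (W p : E) := by
    rw [e.left_inv hp]; exact mvfderiv_extChartAt_self p _
  have h4 := hs.eq (V p : E) (W p : E)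
  simp only [← he, hVe, hWe, map_sub]
  change _ = (fderiv ℝ g (e p)) _ + (fderiv ℝ (fderiv ℝ g) (e p) (V p)) _ -
    ((fderiv ℝ g (e p)) _ + (fderiv ℝ (fderiv ℝ g) (e p) (W p)) _)
  rw [hWe, hVe]
  erw [h4]
  abel

end Calculus

/-! ### Lie derivatives along a flow in a vector space -/

section VectorSpace

variable {E : Type*} [NormedAddCommGroup E] [NormedSpace ℝ E]
  {F : Type*} [NormedAddCommGroup F] [NormedSpace ℝ F]

theorem hasDerivAt_partial_left {σ : ℝ × E → F} {t : ℝ} {z : E}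
    (h : DifferentiableAt ℝ σ (t, z)) :
    HasDerivAt (fun s => σ (s, z)) (fderiv ℝ σ (t, z) (1, 0)) t := by
  have h1 : HasDerivAt (fun s : ℝ => (s, z)) ((1 : ℝ), (0 : E)) t :=
    (hasDerivAt_id t).prodMk (hasDerivAt_const t z)
  exact h.hasFDerivAt.comp_hasDerivAt t h1

theorem hasFDerivAt_partial_right {σ : ℝ × E → F} {t : ℝ} {z : E}
    (h : DifferentiableAt ℝ σ (t, z)) :
    HasFDerivAt (fun w => σ (t, w))
      ((fderiv ℝ σ (t, z)).comp (ContinuousLinearMap.inr ℝ ℝ E)) z := by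
  have h1 : HasFDerivAt (fun w : E => (t, w)) (ContinuousLinearMap.inr ℝ ℝ E) z :=
    hasFDerivAt_prodMk_right t z
  exact h.hasFDerivAt.comp z h1

/-- Derivatives in the time and space directions commute. -/
theorem hasDerivAt_fderiv_partial_right {σ : ℝ × E → F} {z : E}
    (h : ContDiffAt ℝ 2 σ (0, z)) :
    HasDerivAt (fun t => (fderiv ℝ σ (t, z)).comp (ContinuousLinearMap.inr ℝ ℝ E))
      (fderiv ℝ (fun w => fderiv ℝ σ (0, w) (1, 0)) z) 0 := by
  have hd : DifferentiableAt ℝ (fderiv ℝ σ) (0, z) :=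
    (h.fderiv_right (m := 1) (by norm_num)).differentiableAt (by simp)
  have h1 := (hasDerivAt_partial_left hd).clm_comp
    (hasDerivAt_const (0 : ℝ) (ContinuousLinearMap.inr ℝ ℝ E))
  have h2 : HasFDerivAt (fun w => fderiv ℝ σ (0, w) (1, 0)) _ z :=
    (hasFDerivAt_partial_right hd).clm_apply (hasFDerivAt_const ((1 : ℝ), (0 : E)) z)
  convert! h1 using 1
  rw [h2.fderiv]
  ext v
  have hs : IsSymmSndFDerivAt ℝ σ (0, z) := h.isSymmSndFDerivAt (by simp)
  simpa using! hs.eq (0, v) (1, 0)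

variable [CompleteSpace E]

/-- The pullback of the vector field `W` under the time `t` map of `ψ`. -/
def flowPullback (ψ : ℝ × E → E) (W : E → E) (p : ℝ × E) : E :=
  ((fderiv ℝ ψ p).comp (ContinuousLinearMap.inr ℝ ℝ E)).inverse (W (ψ p))

theorem fderiv_flow_zero {ψ : ℝ × E → E} {z : E} (hψ : DifferentiableAt ℝ ψ (0, z))
    (h0 : ∀ᶠ w in 𝓝 z, ψ (0, w) = w) :
    (fderiv ℝ ψ (0, z)).comp (ContinuousLinearMap.inr ℝ ℝ E) = ContinuousLinearMap.id ℝ E :=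
  (hasFDerivAt_partial_right hψ).unique ((hasFDerivAt_id z).congr_of_eventuallyEq h0)

/-- At time zero the space derivative of `ψ` is the identity, and inversion of operators is smooth
there. -/
theorem contDiffAt_flowPullback {ψ : ℝ × E → E} {W : E → E} {z : E}
    (hψ : ContDiffAt ℝ ∞ ψ (0, z)) (h0 : ∀ᶠ w in 𝓝 z, ψ (0, w) = w) (hW : ContDiffAt ℝ ∞ W z) :
    ContDiffAt ℝ ∞ (flowPullback ψ W) (0, z) := by
  have h1 : ContDiffAt ℝ ∞ (fderiv ℝ ψ) (0, z) := hψ.fderiv_right (m := ∞) (by simp)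
  have h2 : ContDiffAt ℝ ∞
      (fun p => (fderiv ℝ ψ p).comp (ContinuousLinearMap.inr ℝ ℝ E)) (0, z) :=
    h1.clm_comp contDiffAt_const
  have h3 : ContDiffAt ℝ ∞ (fun A : E →L[ℝ] E => A.inverse)
      ((fderiv ℝ ψ (0, z)).comp (ContinuousLinearMap.inr ℝ ℝ E)) := by
    rw [fderiv_flow_zero (hψ.differentiableAt (by simp)) h0]
    exact contDiffAt_map_inverse (ContinuousLinearEquiv.refl ℝ E)
  have h4 : ContDiffAt ℝ ∞ W (ψ (0, z)) := by rwa [h0.self_of_nhds]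
  exact (ContDiffAt.comp (0, z) h3 h2).clm_apply (h4.comp _ hψ)

theorem flowPullback_zero {ψ : ℝ × E → E} {W : E → E} {z : E}
    (hψ : ContDiffAt ℝ ∞ ψ (0, z)) (h0 : ∀ᶠ w in 𝓝 z, ψ (0, w) = w) :
    flowPullback ψ W (0, z) = W z := by
  rw [flowPullback, fderiv_flow_zero (hψ.differentiableAt (by simp)) h0, h0.self_of_nhds,
    ContinuousLinearMap.inverse_id]
  rfl

theorem eventually_isInvertible_flow {ψ : ℝ × E → E} {z : E}
    (hψ : ContDiffAt ℝ ∞ ψ (0, z)) (h0 : ∀ᶠ w in 𝓝 z, ψ (0, w) = w) :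
    ∀ᶠ p in 𝓝 ((0 : ℝ), z),
      ((fderiv ℝ ψ p).comp (ContinuousLinearMap.inr ℝ ℝ E)).IsInvertible := by
  have hc : ContinuousAt (fun p => (fderiv ℝ ψ p).comp (ContinuousLinearMap.inr ℝ ℝ E))
      (0, z) :=
    ((hψ.fderiv_right (m := ∞) (by simp)).clm_comp contDiffAt_const).continuousAt
  refine hc.eventually (p := ContinuousLinearMap.IsInvertible) ?_
  dsimp only
  rw [fderiv_flow_zero (hψ.differentiableAt (by simp)) h0]
  exact (ContinuousLinearEquiv.refl ℝ E).nhds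

/-- Differentiating `∂ψ_t (ψ_t^*W) = W ∘ ψ_t` at `t = 0` avoids the derivative of the inverse: since
`∂_t ∂ψ_t = DX` at `t = 0`, it reads `DX(W) + ∂_t(ψ_t^*W) = DW(X)`. -/
theorem fderiv_flowPullback {ψ : ℝ × E → E} {X W : E → E} {z : E}
    (hψ : ContDiffAt ℝ ∞ ψ (0, z)) (h0 : ∀ᶠ w in 𝓝 z, ψ (0, w) = w)
    (hX : ∀ᶠ w in 𝓝 z, fderiv ℝ ψ (0, w) (1, 0) = X w) (hW : ContDiffAt ℝ ∞ W z) :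
    fderiv ℝ (flowPullback ψ W) (0, z) (1, 0) = lieBracket ℝ X W z := by
  have hσ := (contDiffAt_flowPullback hψ h0 hW).differentiableAt (by simp)
  have hψ2 : ContDiffAt ℝ 2 ψ (0, z) := hψ.of_le two_le_infty
  have hψd := hψ.differentiableAt (by simp)
  have hid := fderiv_flow_zero hψd h0
  have h1 := hasDerivAt_partial_left hσ
  have h2 := hasDerivAt_fderiv_partial_right hψ2
  have h3 := h2.clm_apply h1
  have h4 : HasDerivAt (fun t => W (ψ (t, z))) (fderiv ℝ W z (X z)) 0 := by
    have hWd : HasFDerivAt W (fderiv ℝ W z) (ψ (0, z)) := by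
      rw [h0.self_of_nhds]; exact (hW.differentiableAt (by simp)).hasFDerivAt
    have := hWd.comp_hasDerivAt 0 (hasDerivAt_partial_left hψd)
    rwa [hX.self_of_nhds] at this
  have hinv := eventually_isInvertible_flow hψ h0
  have hev : ∀ᶠ t in 𝓝 (0 : ℝ), W (ψ (t, z))
      = ((fderiv ℝ ψ (t, z)).comp (ContinuousLinearMap.inr ℝ ℝ E)) (flowPullback ψ W (t, z)) := by
    have hc : ContinuousAt (fun t : ℝ => (t, z)) 0 := by fun_prop
    filter_upwards [hc.eventually hinv] with t ht
    obtain ⟨e, he⟩ := ht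
    rw [flowPullback, ← he, ContinuousLinearMap.inverse_equiv]
    exact (e.apply_symm_apply _).symm
  have h5 := (h3.congr_of_eventuallyEq hev).unique h4
  have hXd : fderiv ℝ (fun w => fderiv ℝ ψ (0, w) (1, 0)) z = fderiv ℝ X z :=
    Filter.EventuallyEq.fderiv_eq hX
  rw [hid, hXd, flowPullback_zero hψ h0] at h5
  rw [lieBracket, ← h5]
  simp

end VectorSpace

/-! ### Lie derivatives along a local flow -/

section Flow

variable {E M : Type*} [NormedAddCommGroup E] [NormedSpace ℝ E] [FiniteDimensional ℝ E]
  [CompleteSpace E] [TopologicalSpace M] [ChartedSpace E M] [IsManifold 𝓘(ℝ, E) ∞ M]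

/-- The coordinate expression of a vector field in the chart at `x`. -/
def chartField (x : M) (X : Π x : M, TangentSpace 𝓘(ℝ, E) x) (z : E) : E :=
  mvfderiv 𝓘(ℝ, E) (extChartAt 𝓘(ℝ, E) x) ((extChartAt 𝓘(ℝ, E) x).symm z)
    (X ((extChartAt 𝓘(ℝ, E) x).symm z))

/-- The coordinate expression of a local flow in the chart at `x`. -/
def flowChart (φ : ℝ → M → M) (x : M) (p : ℝ × E) : E :=
  extChartAt 𝓘(ℝ, E) x (φ p.1 ((extChartAt 𝓘(ℝ, E) x).symm p.2))

theorem chartField_extChartAt (X : Π x : M, TangentSpace 𝓘(ℝ, E) x) {x y : M}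
    (hy : y ∈ (extChartAt 𝓘(ℝ, E) x).source) :
    chartField x X (extChartAt 𝓘(ℝ, E) x y)
      = mvfderiv 𝓘(ℝ, E) (extChartAt 𝓘(ℝ, E) x) y (X y) := by
  rw [chartField, (extChartAt 𝓘(ℝ, E) x).left_inv hy]

theorem contDiffAt_chartField (X : SmoothVectorField 𝓘(ℝ, E) M) {x y : M}
    (hy : y ∈ (extChartAt 𝓘(ℝ, E) x).source) :
    ContDiffAt ℝ ∞ (chartField x X) (extChartAt 𝓘(ℝ, E) x y) :=
  contDiffAt_comp_extChartAt_symm le_rfl hy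
    ((contMDiffAt_vectorField_iff hy).1 (X.contMDiff.contMDiffAt))

/-- The commutator formula is applied to the chart map itself as a vector-valued function. The chart
is centred at `x` but `y` varies, because the identity will be differentiated in space. -/
theorem lieBracket_chartField (X Y : SmoothVectorField 𝓘(ℝ, E) M) {x y : M}
    (hy : y ∈ (extChartAt 𝓘(ℝ, E) x).source) :
    lieBracket ℝ (chartField x X) (chartField x Y) (extChartAt 𝓘(ℝ, E) x y)
      = chartField x (⁅X, Y⁆ : SmoothVectorField 𝓘(ℝ, E) M) (extChartAt 𝓘(ℝ, E) x y) := by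
  have key : ∀ U V : SmoothVectorField 𝓘(ℝ, E) M,
      mvfderiv 𝓘(ℝ, E) (fun q => mvfderiv 𝓘(ℝ, E) (extChartAt 𝓘(ℝ, E) x) q (U q)) y (V y)
        = fderiv ℝ (chartField x U) (extChartAt 𝓘(ℝ, E) x y)
            (chartField x V (extChartAt 𝓘(ℝ, E) x y)) := by
    intro U V
    rw [chartField_extChartAt _ hy, mvfderiv_eq_fderiv_comp_extChartAt_symm hy
      ((mdifferentiableAt_vectorField_iff hy).1 (U.mdiff y))]
    rfl
  rw [chartField_extChartAt _ hy, SmoothVectorField.lie_apply,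
    mvfderiv_mlieBracket (X.mdiff y) (Y.mdiff y)
      (contMDiffAt_extChartAt' (by rwa [extChartAt_source] at hy)), key, key, lieBracket]

namespace IsLocalFlow

variable {X : SmoothVectorField 𝓘(ℝ, E) M} {ε : ℝ} {U : Set M} {φ : ℝ → M → M}

theorem contMDiffAt (h : IsLocalFlow X ε U φ) {t : ℝ} (ht : t ∈ Set.Ioo (-ε) ε) {y : M}
    (hy : y ∈ U) :
    ContMDiffAt (𝓘(ℝ, ℝ).prod 𝓘(ℝ, E)) 𝓘(ℝ, E) ∞ (fun p : ℝ × M => φ p.1 p.2) (t, y) :=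
  h.smooth.contMDiffAt ((isOpen_Ioo.prod h.isOpen).mem_nhds ⟨ht, hy⟩)

theorem zero_mem (h : IsLocalFlow X ε U φ) : (0 : ℝ) ∈ Set.Ioo (-ε) ε :=
  ⟨by linarith [h.pos], h.pos⟩

theorem mdifferentiableAt (h : IsLocalFlow X ε U φ) {t : ℝ} (ht : t ∈ Set.Ioo (-ε) ε) {y : M}
    (hy : y ∈ U) : MDifferentiableAt 𝓘(ℝ, E) 𝓘(ℝ, E) (φ t) y :=
  (ContMDiffAt.comp (f := fun q : M => (t, q)) y (h.contMDiffAt ht hy)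
    (contMDiffAt_const.prodMk contMDiffAt_id)).mdifferentiableAt (by simp)

theorem contDiffAt_flowChart (h : IsLocalFlow X ε U φ) {t : ℝ} (ht : t ∈ Set.Ioo (-ε) ε)
    {x y : M} (hy : y ∈ U) (hy' : y ∈ (extChartAt 𝓘(ℝ, E) x).source)
    (hφ : φ t y ∈ (extChartAt 𝓘(ℝ, E) x).source) :
    ContDiffAt ℝ ∞ (flowChart φ x) (t, extChartAt 𝓘(ℝ, E) x y) := by
  rw [← contMDiffAt_iff_contDiffAt]
  have hs : ContMDiffAt 𝓘(ℝ, E) 𝓘(ℝ, E) ∞ (extChartAt 𝓘(ℝ, E) x).symm (extChartAt 𝓘(ℝ, E) x y) :=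
    (contMDiffOn_extChartAt_symm x).contMDiffAt
      ((isOpen_extChartAt_target x).mem_nhds ((extChartAt 𝓘(ℝ, E) x).map_source hy'))
  have h1 : ContMDiffAt 𝓘(ℝ, ℝ × E) (𝓘(ℝ, ℝ).prod 𝓘(ℝ, E)) ∞
      (fun p : ℝ × E => (p.1, (extChartAt 𝓘(ℝ, E) x).symm p.2)) (t, extChartAt 𝓘(ℝ, E) x y) :=
    ContMDiffAt.prodMk contDiffAt_fst.contMDiffAt
      (ContMDiffAt.comp (t, extChartAt 𝓘(ℝ, E) x y) hs contDiffAt_snd.contMDiffAt)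
  have h2 : ContMDiffAt (𝓘(ℝ, ℝ).prod 𝓘(ℝ, E)) 𝓘(ℝ, E) ∞ (fun p : ℝ × M => φ p.1 p.2)
      (t, (extChartAt 𝓘(ℝ, E) x).symm (extChartAt 𝓘(ℝ, E) x y)) := by
    rw [(extChartAt 𝓘(ℝ, E) x).left_inv hy']
    exact h.contMDiffAt ht hy
  have h3 : ContMDiffAt 𝓘(ℝ, E) 𝓘(ℝ, E) ∞ (extChartAt 𝓘(ℝ, E) x)
      (φ t ((extChartAt 𝓘(ℝ, E) x).symm (extChartAt 𝓘(ℝ, E) x y))) := by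
    rw [(extChartAt 𝓘(ℝ, E) x).left_inv hy']
    exact contMDiffAt_extChartAt' (by rwa [extChartAt_source] at hφ)
  exact ContMDiffAt.comp (t, extChartAt 𝓘(ℝ, E) x y) h3
    (ContMDiffAt.comp (t, extChartAt 𝓘(ℝ, E) x y) h2 h1)

theorem eventually_symm_mem (h : IsLocalFlow X ε U φ) {x y : M} (hy : y ∈ U)
    (hy' : y ∈ (extChartAt 𝓘(ℝ, E) x).source) :
    ∀ᶠ w in 𝓝 (extChartAt 𝓘(ℝ, E) x y), w ∈ (extChartAt 𝓘(ℝ, E) x).target ∧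
      (extChartAt 𝓘(ℝ, E) x).symm w ∈ U := by
  have ht := (isOpen_extChartAt_target (I := 𝓘(ℝ, E)) x).mem_nhds
    ((extChartAt 𝓘(ℝ, E) x).map_source hy')
  have hc : ContinuousAt (extChartAt 𝓘(ℝ, E) x).symm (extChartAt 𝓘(ℝ, E) x y) :=
    (continuousOn_extChartAt_symm x).continuousAt ht
  have hU : ∀ᶠ w in 𝓝 ((extChartAt 𝓘(ℝ, E) x).symm (extChartAt 𝓘(ℝ, E) x y)), w ∈ U := by
    rw [(extChartAt 𝓘(ℝ, E) x).left_inv hy']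
    exact h.isOpen.mem_nhds hy
  filter_upwards [ht, hc.eventually hU] with w h1 h2 using ⟨h1, h2⟩

theorem flowChart_zero (h : IsLocalFlow X ε U φ) {x y : M} (hy : y ∈ U)
    (hy' : y ∈ (extChartAt 𝓘(ℝ, E) x).source) :
    ∀ᶠ w in 𝓝 (extChartAt 𝓘(ℝ, E) x y), flowChart φ x (0, w) = w := by
  filter_upwards [h.eventually_symm_mem hy hy'] with w hw
  rw [flowChart, h.zero _ hw.2, (extChartAt 𝓘(ℝ, E) x).right_inv hw.1]

theorem fderiv_flowChart (h : IsLocalFlow X ε U φ) {x y : M} (hy : y ∈ U)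
    (hy' : y ∈ (extChartAt 𝓘(ℝ, E) x).source) :
    fderiv ℝ (flowChart φ x) (0, extChartAt 𝓘(ℝ, E) x y) (1, 0)
      = chartField x X (extChartAt 𝓘(ℝ, E) x y) := by
  have hd := (h.contDiffAt_flowChart h.zero_mem hy hy' (by rwa [h.zero y hy])).differentiableAt
    (by simp)
  have h1 := (hasDerivAt_partial_left hd).deriv
  rw [← h1, chartField_extChartAt _ hy']
  have hγ : HasMFDerivAt 𝓘(ℝ, ℝ) 𝓘(ℝ, E) (fun t => φ t y) 0
      ((1 : ℝ →L[ℝ] ℝ).smulRight (X (φ 0 y))) :=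
    (h.integralCurve y hy 0 h.zero_mem).hasMFDerivAt (Ioo_mem_nhds h.zero_mem.1 h.zero_mem.2)
  have he : MDifferentiableAt 𝓘(ℝ, E) 𝓘(ℝ, E) (extChartAt 𝓘(ℝ, E) x) (φ 0 y) := by
    rw [h.zero y hy]; exact mdifferentiableAt_extChartAt_of_mem hy'
  have h2 := HasMFDerivAt.comp (0 : ℝ) he.hasMFDerivAt hγ
  have h4 : (fun s => flowChart φ x (s, extChartAt 𝓘(ℝ, E) x y))
      = extChartAt 𝓘(ℝ, E) x ∘ fun t => φ t y := by
    ext s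
    rw [flowChart, (extChartAt 𝓘(ℝ, E) x).left_inv hy']
    rfl
  rw [h4, ← fderiv_apply_one_eq_deriv, ← mvfderiv_eq_fderiv]
  refine (DFunLike.congr_fun h2.mfderiv (1 : ℝ)).trans ?_
  change mvfderiv 𝓘(ℝ, E) (extChartAt 𝓘(ℝ, E) x) (φ 0 y) ((1 : ℝ) • X (φ 0 y)) = _
  rw [one_smul, h.zero y hy]

theorem fderiv_flowChart_eventually (h : IsLocalFlow X ε U φ) {x y : M} (hy : y ∈ U)
    (hy' : y ∈ (extChartAt 𝓘(ℝ, E) x).source) :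
    ∀ᶠ w in 𝓝 (extChartAt 𝓘(ℝ, E) x y),
      fderiv ℝ (flowChart φ x) (0, w) (1, 0) = chartField x X w := by
  filter_upwards [h.eventually_symm_mem hy hy'] with w hw
  have := h.fderiv_flowChart hw.2 ((extChartAt 𝓘(ℝ, E) x).map_target hw.1)
  rwa [(extChartAt 𝓘(ℝ, E) x).right_inv hw.1] at this

theorem mvfderiv_extChartAt_mfderiv (h : IsLocalFlow X ε U φ) {t : ℝ} (ht : t ∈ Set.Ioo (-ε) ε)
    {x y : M} (hy : y ∈ U) (hy' : y ∈ (extChartAt 𝓘(ℝ, E) x).source)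
    (hφ : φ t y ∈ (extChartAt 𝓘(ℝ, E) x).source) (v : TangentSpace 𝓘(ℝ, E) y) :
    mvfderiv 𝓘(ℝ, E) (extChartAt 𝓘(ℝ, E) x) (φ t y) (mfderiv 𝓘(ℝ, E) 𝓘(ℝ, E) (φ t) y v)
      = (fderiv ℝ (flowChart φ x) (t, extChartAt 𝓘(ℝ, E) x y)).comp
          (ContinuousLinearMap.inr ℝ ℝ E) (mvfderiv 𝓘(ℝ, E) (extChartAt 𝓘(ℝ, E) x) y v) := by
  have hd := (h.contDiffAt_flowChart ht hy hy' hφ).differentiableAt (by simp)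
  have hm := h.mdifferentiableAt ht hy
  have he := mdifferentiableAt_extChartAt_of_mem hφ
  rw [← (hasFDerivAt_partial_right hd).fderiv, ← mvfderiv_fun_comp_apply he hm,
    mvfderiv_eq_fderiv_comp_extChartAt_symm (f := fun q => extChartAt 𝓘(ℝ, E) x (φ t q)) hy'
      (he.comp y hm)]
  rfl

/-- Near `(0, x)` the time `t` map is a local diffeomorphism, and the pullback of vector fields
has the expected coordinate expression. -/
theorem eventually_mpullback (h : IsLocalFlow X ε U φ) {x : M} (hx : x ∈ U)
    (W : Π x : M, TangentSpace 𝓘(ℝ, E) x) :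
    ∀ᶠ p : ℝ × M in 𝓝 (0, x), p.1 ∈ Set.Ioo (-ε) ε ∧ p.2 ∈ U ∧
      p.2 ∈ (extChartAt 𝓘(ℝ, E) x).source ∧ φ p.1 p.2 ∈ (extChartAt 𝓘(ℝ, E) x).source ∧
      (mfderiv 𝓘(ℝ, E) 𝓘(ℝ, E) (φ p.1) p.2).IsInvertible ∧
      mvfderiv 𝓘(ℝ, E) (extChartAt 𝓘(ℝ, E) x) p.2 (mpullback 𝓘(ℝ, E) 𝓘(ℝ, E) (φ p.1) W p.2)
        = flowPullback (flowChart φ x) (chartField x W) (p.1, extChartAt 𝓘(ℝ, E) x p.2) := by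
  have hx' : x ∈ (extChartAt 𝓘(ℝ, E) x).source := mem_extChartAt_source x
  have h1 : ∀ᶠ p : ℝ × M in 𝓝 (0, x), p.1 ∈ Set.Ioo (-ε) ε :=
    continuousAt_fst.eventually (Ioo_mem_nhds h.zero_mem.1 h.zero_mem.2)
  have h2 : ∀ᶠ p : ℝ × M in 𝓝 (0, x), p.2 ∈ U :=
    continuousAt_snd.eventually (h.isOpen.mem_nhds hx)
  have h3 : ∀ᶠ p : ℝ × M in 𝓝 (0, x), p.2 ∈ (extChartAt 𝓘(ℝ, E) x).source :=
    continuousAt_snd.eventually ((isOpen_extChartAt_source x).mem_nhds hx')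
  have h4 : ∀ᶠ p : ℝ × M in 𝓝 (0, x), φ p.1 p.2 ∈ (extChartAt 𝓘(ℝ, E) x).source := by
    refine (h.contMDiffAt h.zero_mem hx).continuousAt.eventually
      (p := fun q => q ∈ (extChartAt 𝓘(ℝ, E) x).source) ?_
    dsimp only
    rw [h.zero x hx]
    exact (isOpen_extChartAt_source x).mem_nhds hx'
  have hψ := h.contDiffAt_flowChart h.zero_mem hx hx' (by rwa [h.zero x hx])
  have h5 : ∀ᶠ p : ℝ × M in 𝓝 (0, x),
      ((fderiv ℝ (flowChart φ x) (p.1, extChartAt 𝓘(ℝ, E) x p.2)).comp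
        (ContinuousLinearMap.inr ℝ ℝ E)).IsInvertible := by
    have hc : ContinuousAt (fun p : ℝ × M => (p.1, extChartAt 𝓘(ℝ, E) x p.2)) (0, x) :=
      continuousAt_fst.prodMk ((continuousAt_extChartAt x).comp (f := Prod.snd) continuousAt_snd)
    exact hc.eventually (eventually_isInvertible_flow hψ (h.flowChart_zero hx hx'))
  filter_upwards [h1, h2, h3, h4, h5] with ⟨t, y⟩ h1 h2 h3 h4 h5
  dsimp only at h1 h2 h3 h4 h5 ⊢
  have : IsManifold 𝓘(ℝ, E) 1 M := IsManifold.of_le (n := ∞) (by simp)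
  obtain ⟨a, ha⟩ := isInvertible_mfderiv_extChartAt (I := 𝓘(ℝ, E)) h3
  obtain ⟨b, hb⟩ := isInvertible_mfderiv_extChartAt (I := 𝓘(ℝ, E)) h4
  obtain ⟨c, hc⟩ := h5
  have hbt : ∀ v, b v = mvfderiv 𝓘(ℝ, E) (extChartAt 𝓘(ℝ, E) x) (φ t y) v :=
    fun v => DFunLike.congr_fun hb v
  have hat : ∀ v, a v = mvfderiv 𝓘(ℝ, E) (extChartAt 𝓘(ℝ, E) x) y v :=
    fun v => DFunLike.congr_fun ha v
  have hct : ∀ v, c v = (fderiv ℝ (flowChart φ x) (t, extChartAt 𝓘(ℝ, E) x y)).comp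
    (ContinuousLinearMap.inr ℝ ℝ E) v := fun v => DFunLike.congr_fun hc v
  -- Factor `dφ_t` as chart derivative, coordinate derivative, inverse chart derivative; this yields
  -- both invertibility and the formula for the pullback.
  have hd : mfderiv 𝓘(ℝ, E) 𝓘(ℝ, E) (φ t) y
      = ((a.trans (c : E ≃L[ℝ] E)).trans b.symm :
          TangentSpace 𝓘(ℝ, E) y ≃L[ℝ] TangentSpace 𝓘(ℝ, E) (φ t y)) := by
    ext v
    have hv : b (mfderiv 𝓘(ℝ, E) 𝓘(ℝ, E) (φ t) y v) = c (a v) :=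
      (hbt _).trans ((h.mvfderiv_extChartAt_mfderiv h1 h2 h3 h4 v).trans
        ((congrArg _ (hat v).symm).trans (hct (a v)).symm))
    exact ((b.symm_apply_eq).2 hv.symm).symm
  refine ⟨h1, h2, h3, h4, ⟨_, hd.symm⟩, ?_⟩
  rw [mpullback_apply, hd, ContinuousLinearMap.inverse_equiv, ← hat]
  simp only [flowPullback]
  rw [← hc, ContinuousLinearMap.inverse_equiv]
  have h6 : flowChart φ x (t, extChartAt 𝓘(ℝ, E) x y) = extChartAt 𝓘(ℝ, E) x (φ t y) := by
    rw [flowChart, (extChartAt 𝓘(ℝ, E) x).left_inv h3]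
  rw [h6, chartField_extChartAt _ h4, ← hbt]
  exact a.apply_symm_apply _

end IsLocalFlow

end Flow

section Fields

variable {E M : Type*} [NormedAddCommGroup E] [NormedSpace ℝ E] [FiniteDimensional ℝ E]
  [CompleteSpace E] [TopologicalSpace M] [ChartedSpace E M] [IsManifold 𝓘(ℝ, E) ∞ M]

/-! ### Extension of vector fields -/

/-- A vector field with prescribed constant coordinates near a point. -/
theorem exists_smoothVectorField_coord_eq [T2Space M] (x : M) (v : TangentSpace 𝓘(ℝ, E) x) :
    ∃ W : SmoothVectorField 𝓘(ℝ, E) M, W x = v ∧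
      ∀ᶠ y in 𝓝 x, mvfderiv 𝓘(ℝ, E) (extChartAt 𝓘(ℝ, E) x) y (W y) = v := by
  obtain ⟨s, hs, hsm⟩ := FiberBundle.exists_contMDiffOn_extend (k := ∞) 𝓘(ℝ, E) E v
  obtain ⟨f, -, hf⟩ := (SmoothBumpFunction.nhds_basis_tsupport (I := 𝓘(ℝ, E)) x).mem_iff.1
    (interior_mem_nhds.2 hs)
  have h1 := ContMDiffOn.smul_section_of_tsupport (f.contMDiff.contMDiffOn (s := interior s))
    isOpen_interior hf (hsm.mono interior_subset)
  let W : SmoothVectorField 𝓘(ℝ, E) M := ⟨_, h1⟩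
  have hW : ∀ᶠ y in 𝓝 x, W y = FiberBundle.extend E v y := by
    filter_upwards [f.eventuallyEq_one] with y hy
    change f y • FiberBundle.extend E v y = _
    rw [hy, Pi.one_apply, one_smul]
  refine ⟨W, by rw [hW.self_of_nhds]; simp, ?_⟩
  filter_upwards [hW, (isOpen_extChartAt_source (I := 𝓘(ℝ, E)) x).mem_nhds
    (mem_extChartAt_source x)] with y hy hys
  rw [← trivializationAt_tangent_apply hys, hy]
  have hb : ∀ z ∈ (extChartAt 𝓘(ℝ, E) x).source,
      z ∈ (trivializationAt E (TangentSpace 𝓘(ℝ, E)) x).baseSet := by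
    intro z hz
    rw [extChartAt_source] at hz
    simpa using hz
  rw [FiberBundle.extend, Bundle.Trivialization.apply_mk_symm _ (hb y hys),
    trivializationAt_tangent_apply (mem_extChartAt_source x), mvfderiv_extChartAt_self]

theorem exists_smoothVectorField_eq [T2Space M] {x : M} (v : TangentSpace 𝓘(ℝ, E) x) :
    ∃ W : SmoothVectorField 𝓘(ℝ, E) M, W x = v :=
  let ⟨W, hW, _⟩ := exists_smoothVectorField_coord_eq x v
  ⟨W, hW⟩

/-! ### Connections on smooth vector fields -/

namespace AffineConnection

variable (D : AffineConnection E M)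

theorem map_add (X Y : SmoothVectorField 𝓘(ℝ, E) M) (x : M) :
    D (X + Y : SmoothVectorField 𝓘(ℝ, E) M) x = D X x + D Y x :=
  D.isCovariantDerivativeOnUniv.add (X.mdiff x) (Y.mdiff x)

theorem map_smul (c : ℝ) (X : SmoothVectorField 𝓘(ℝ, E) M) (x : M) :
    D (c • X : SmoothVectorField 𝓘(ℝ, E) M) x = c • D X x :=
  D.isCovariantDerivativeOnUniv.smul_const c (X.mdiff x)

theorem map_zero (x : M) : D (0 : SmoothVectorField 𝓘(ℝ, E) M) x = 0 :=
  D.isCovariantDerivativeOnUniv.zero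

theorem map_sub (X Y : SmoothVectorField 𝓘(ℝ, E) M) (x : M) :
    D (X - Y : SmoothVectorField 𝓘(ℝ, E) M) x = D X x - D Y x := by
  have h := D.map_add (X - Y) Y x
  rw [sub_add_cancel] at h
  rw [h, add_sub_cancel_right]

variable {D}

theorem lie_eq (hD : CovariantDerivative.torsion D = 0) (X Y : SmoothVectorField 𝓘(ℝ, E) M)
    (x : M) :
    (⁅X, Y⁆ : SmoothVectorField 𝓘(ℝ, E) M) x = D Y x (X x) - D X x (Y x) := by
  have h := CovariantDerivative.torsion_apply D (X.mdiff x) (Y.mdiff x)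
  rw [hD] at h
  exact (sub_eq_zero.1 h.symm).symm

/-- The vector field `D_X Y`. -/
def along (hD : D.IsSmooth) (X Y : SmoothVectorField 𝓘(ℝ, E) M) :
    SmoothVectorField 𝓘(ℝ, E) M :=
  ⟨fun x => D Y x (X x), (hD Y).clm_bundle_apply X.contMDiff⟩

theorem along_apply (hD : D.IsSmooth) (X Y : SmoothVectorField 𝓘(ℝ, E) M) (x : M) :
    along hD X Y x = D Y x (X x) := rfl

/-- The connection and the coordinate derivative obey the same Leibniz rule, so the terms containing
`df` cancel in their difference. -/
theorem tensorialAt_sub_mvfderiv (D : AffineConnection E M) (x : M) :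
    TensorialAt 𝓘(ℝ, E) E (fun σ : Π x : M, TangentSpace 𝓘(ℝ, E) x => (show E →L[ℝ] E from D σ x)
      - (show E →L[ℝ] E from mvfderiv 𝓘(ℝ, E)
        (fun q => mvfderiv 𝓘(ℝ, E) (extChartAt 𝓘(ℝ, E) x) q (σ q)) x)) x where
  smul {f σ} hf hσ := by
    have h1 := (mdifferentiableAt_vectorField_iff (mem_extChartAt_source x)).1 hσ
    have h2 : (fun q => mvfderiv 𝓘(ℝ, E) (extChartAt 𝓘(ℝ, E) x) q ((f • σ) q))
        = fun q => f q • mvfderiv 𝓘(ℝ, E) (extChartAt 𝓘(ℝ, E) x) q (σ q) := by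
      ext q
      exact ContinuousLinearMap.map_smul _ _ _
    rw [h2, mvfderiv_fun_smul hf h1, D.isCovariantDerivativeOnUniv.leibniz hσ hf,
      mvfderiv_extChartAt_self, smul_sub]
    exact add_sub_add_right_eq_sub _ _ _
  add {σ σ'} hσ hσ' := by
    have h1 := (mdifferentiableAt_vectorField_iff (mem_extChartAt_source x)).1 hσ
    have h1' := (mdifferentiableAt_vectorField_iff (mem_extChartAt_source x)).1 hσ'
    have h2 : (fun q => mvfderiv 𝓘(ℝ, E) (extChartAt 𝓘(ℝ, E) x) q ((σ + σ') q))
        = fun q => mvfderiv 𝓘(ℝ, E) (extChartAt 𝓘(ℝ, E) x) q (σ q)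
          + mvfderiv 𝓘(ℝ, E) (extChartAt 𝓘(ℝ, E) x) q (σ' q) := by
      ext q
      exact ContinuousLinearMap.map_add _ _ _
    rw [h2, mvfderiv_fun_add h1 h1', D.isCovariantDerivativeOnUniv.add hσ hσ']
    exact add_sub_add_comm _ _ _ _

/-- In a chart, a connection is the derivative of the coordinates plus a zeroth order term. -/
theorem exists_christoffel (D : AffineConnection E M) (x : M) :
    ∃ Γ : E →L[ℝ] E →L[ℝ] E, ∀ σ : Π x : M, TangentSpace 𝓘(ℝ, E) x,
      MDifferentiableAt 𝓘(ℝ, E) 𝓘(ℝ, E).tangent (fun q => (⟨q, σ q⟩ : TangentBundle 𝓘(ℝ, E) M)) x →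
      (show E →L[ℝ] E from D σ x) = (show E →L[ℝ] E from mvfderiv 𝓘(ℝ, E)
        (fun q => mvfderiv 𝓘(ℝ, E) (extChartAt 𝓘(ℝ, E) x) q (σ q)) x) + Γ (show E from σ x) := by
  refine ⟨TensorialAt.mkHom _ x (tensorialAt_sub_mvfderiv D x), fun σ hσ => ?_⟩
  have h := TensorialAt.mkHom_apply (tensorialAt_sub_mvfderiv D x) hσ
  exact (sub_eq_iff_eq_add'.1 h.symm)

end AffineConnection

/-! ### Derivatives of pulled back vector fields -/

namespace IsLocalFlow

variable {X : SmoothVectorField 𝓘(ℝ, E) M} {ε : ℝ} {U : Set M} {φ : ℝ → M → M}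

theorem contDiffAt_flowPullback (h : IsLocalFlow X ε U φ) {x : M} (hx : x ∈ U)
    (W : SmoothVectorField 𝓘(ℝ, E) M) :
    ContDiffAt ℝ ∞ (flowPullback (flowChart φ x) (chartField x W))
      (0, extChartAt 𝓘(ℝ, E) x x) :=
  _root_.contDiffAt_flowPullback (h.contDiffAt_flowChart h.zero_mem hx (mem_extChartAt_source x)
    (by rw [h.zero x hx]; exact mem_extChartAt_source x))
    (h.flowChart_zero hx (mem_extChartAt_source x))
    (contDiffAt_chartField W (mem_extChartAt_source x))

/-- Holding on a neighbourhood rather than at one point, the identity can be differentiated once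
more in `z`, as is needed when a connection is applied to the pulled back field. -/
theorem fderiv_flowPullback_eventually (h : IsLocalFlow X ε U φ) {x : M} (hx : x ∈ U)
    (W : SmoothVectorField 𝓘(ℝ, E) M) :
    ∀ᶠ z in 𝓝 (extChartAt 𝓘(ℝ, E) x x),
      fderiv ℝ (flowPullback (flowChart φ x) (chartField x W)) (0, z) (1, 0)
        = chartField x (⁅X, W⁆ : SmoothVectorField 𝓘(ℝ, E) M) z := by
  filter_upwards [h.eventually_symm_mem hx (mem_extChartAt_source x)] with z ⟨hz, hzU⟩
  obtain ⟨y, hy, rfl⟩ : ∃ y ∈ (extChartAt 𝓘(ℝ, E) x).source, extChartAt 𝓘(ℝ, E) x y = z :=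
    ⟨_, (extChartAt 𝓘(ℝ, E) x).map_target hz, (extChartAt 𝓘(ℝ, E) x).right_inv hz⟩
  rw [(extChartAt 𝓘(ℝ, E) x).left_inv hy] at hzU
  rw [_root_.fderiv_flowPullback (h.contDiffAt_flowChart h.zero_mem hzU hy
      (by rwa [h.zero y hzU])) (h.flowChart_zero hzU hy) (h.fderiv_flowChart_eventually hzU hy)
      (contDiffAt_chartField W hy), lieBracket_chartField X W hy]

/-- The derivative of the pullback of a vector field along a local flow is the Lie bracket. -/
theorem hasDerivAt_mpullback (h : IsLocalFlow X ε U φ) {x : M} (hx : x ∈ U)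
    (W : SmoothVectorField 𝓘(ℝ, E) M) :
    HasDerivAt (fun t => (show E from mpullback 𝓘(ℝ, E) 𝓘(ℝ, E) (φ t) W x))
      (show E from (⁅X, W⁆ : SmoothVectorField 𝓘(ℝ, E) M) x) 0 := by
  have h1 := hasDerivAt_partial_left ((h.contDiffAt_flowPullback hx W).differentiableAt (by simp))
  rw [(h.fderiv_flowPullback_eventually hx W).self_of_nhds,
    chartField_extChartAt _ (mem_extChartAt_source x), mvfderiv_extChartAt_self] at h1
  refine h1.congr_of_eventuallyEq ?_
  have hc : ContinuousAt (fun t : ℝ => (t, x)) 0 := by fun_prop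
  filter_upwards [hc.eventually (h.eventually_mpullback hx W)] with t ht
  rw [← ht.2.2.2.2.2, mvfderiv_extChartAt_self]

theorem eventually_isInvertible (h : IsLocalFlow X ε U φ) {x : M} (hx : x ∈ U) :
    ∀ᶠ t in 𝓝 (0 : ℝ), t ∈ Set.Ioo (-ε) ε ∧
      (mfderiv 𝓘(ℝ, E) 𝓘(ℝ, E) (φ t) x).IsInvertible := by
  have hc : ContinuousAt (fun t : ℝ => (t, x)) 0 := by fun_prop
  filter_upwards [hc.eventually (h.eventually_mpullback hx X)] with t ht
  exact ⟨ht.1, ht.2.2.2.2.1⟩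

theorem mpullback_zero (h : IsLocalFlow X ε U φ) {x : M} (hx : x ∈ U)
    (W : SmoothVectorField 𝓘(ℝ, E) M) : mpullback 𝓘(ℝ, E) 𝓘(ℝ, E) (φ 0) W x = W x := by
  have h2 := (h.eventually_mpullback hx W).self_of_nhds.2.2.2.2.2
  dsimp only at h2
  rw [mvfderiv_extChartAt_self, _root_.flowPullback_zero (h.contDiffAt_flowChart h.zero_mem hx
    (mem_extChartAt_source x) (by rw [h.zero x hx]; exact mem_extChartAt_source x))
    (h.flowChart_zero hx (mem_extChartAt_source x)), chartField_extChartAt _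
    (mem_extChartAt_source x), mvfderiv_extChartAt_self] at h2
  exact h2

/-- In the chart `D` is the coordinate derivative plus a Christoffel term. The first commutes with
`∂_t` by symmetry of second derivatives, the second is linear in the value at `x`; so `∂_t` passes
inside `D` and turns the pullback into the bracket. -/
theorem hasDerivAt_conn_mpullback (h : IsLocalFlow X ε U φ) {x : M} (hx : x ∈ U)
    (D : AffineConnection E M) (W : SmoothVectorField 𝓘(ℝ, E) M) :
    HasDerivAt (fun t => (show E →L[ℝ] E from D (mpullback 𝓘(ℝ, E) 𝓘(ℝ, E) (φ t) W) x))
      (show E →L[ℝ] E from D (⁅X, W⁆ : SmoothVectorField 𝓘(ℝ, E) M) x) 0 := by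
  obtain ⟨Γ, hΓ⟩ := D.exists_christoffel x
  have hx' := mem_extChartAt_source (I := 𝓘(ℝ, E)) x
  set σ := flowPullback (flowChart φ x) (chartField x W) with hσdef
  have hσ := h.contDiffAt_flowPullback hx W
  have h1 := hasDerivAt_fderiv_partial_right (hσ.of_le two_le_infty)
  rw [Filter.EventuallyEq.fderiv_eq (h.fderiv_flowPullback_eventually hx W)] at h1
  have h2 := h1.add (Γ.hasFDerivAt.comp_hasDerivAt (0 : ℝ) (h.hasDerivAt_mpullback hx W))
  have hlie : (show E →L[ℝ] E from D (⁅X, W⁆ : SmoothVectorField 𝓘(ℝ, E) M) x)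
      = fderiv ℝ (chartField x (⁅X, W⁆ : SmoothVectorField 𝓘(ℝ, E) M)) (extChartAt 𝓘(ℝ, E) x x)
        + Γ (show E from (⁅X, W⁆ : SmoothVectorField 𝓘(ℝ, E) M) x) := by
    refine (hΓ _ (SmoothVectorField.mdiff ⁅X, W⁆ x)).trans ?_
    congr 1
    ext u
    refine (mvfderiv_eq_fderiv_comp_extChartAt_symm hx' ((mdifferentiableAt_vectorField_iff hx').1
      (SmoothVectorField.mdiff ⁅X, W⁆ x)) u).trans ?_
    exact congrArg _ (mvfderiv_extChartAt_self x (show TangentSpace 𝓘(ℝ, E) x from u))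
  rw [hlie]
  refine h2.congr_of_eventuallyEq ?_
  have hev := h.eventually_mpullback hx W
  rw [nhds_prod_eq] at hev
  have hd : ∀ᶠ p in 𝓝 ((0 : ℝ), extChartAt 𝓘(ℝ, E) x x), DifferentiableAt ℝ σ p := by
    filter_upwards [(hσ.of_le two_le_infty).eventually (by simp)] with p hp
    exact hp.differentiableAt (by simp)
  have hc : ContinuousAt (fun t : ℝ => (t, extChartAt 𝓘(ℝ, E) x x)) 0 := by fun_prop
  -- Currying the neighbourhood of `(0, x)` gives, for each fixed small `t`, the coordinate formula
  -- as a germ in the space variable, which is what a connection sees.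
  filter_upwards [hev.curry, hc.eventually hd] with t ht hdt
  have heq : (fun q => mvfderiv 𝓘(ℝ, E) (extChartAt 𝓘(ℝ, E) x) q
      (mpullback 𝓘(ℝ, E) 𝓘(ℝ, E) (φ t) W q)) =ᶠ[𝓝 x]
      fun q => σ (t, extChartAt 𝓘(ℝ, E) x q) := by
    filter_upwards [ht] with q hq using hq.2.2.2.2.2
  have hp := hasFDerivAt_partial_right hdt
  have hm : MDifferentiableAt 𝓘(ℝ, E) 𝓘(ℝ, E) (fun q => σ (t, extChartAt 𝓘(ℝ, E) x q)) x :=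
    DifferentiableAt.comp_mdifferentiableAt (g := fun w => σ (t, w)) hp.differentiableAt
      (mdifferentiableAt_extChartAt_of_mem hx')
  refine (hΓ _ ((mdifferentiableAt_vectorField_iff hx').2
    (hm.congr_of_eventuallyEq heq))).trans ?_
  rw [heq.mvfderiv_eq]
  refine congrArg₂ (· + ·) ?_ rfl
  ext u
  refine (HasFDerivAt.mvfderiv_comp_apply (g := fun w => σ (t, w)) hp
    (mdifferentiableAt_extChartAt_of_mem hx') u).trans ?_
  exact congrArg _ (mvfderiv_extChartAt_self x (show TangentSpace 𝓘(ℝ, E) x from u))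

end IsLocalFlow

end Fields

/-! ### Infinitesimal form of the automorphism conditions -/

section Automorphisms

variable {E M : Type*} [NormedAddCommGroup E] [NormedSpace ℝ E] [FiniteDimensional ℝ E]
  [CompleteSpace E] [TopologicalSpace M] [ChartedSpace E M] [IsManifold 𝓘(ℝ, E) ∞ M]

/-- The derivative of a function along a local flow. -/
theorem IsLocalFlow.hasDerivAt_comp {X : SmoothVectorField 𝓘(ℝ, E) M} {ε : ℝ} {U : Set M}
    {φ : ℝ → M → M} (h : IsLocalFlow X ε U φ) {x : M} (hx : x ∈ U) {F : Type*}
    [NormedAddCommGroup F] [NormedSpace ℝ F] {f : M → F}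
    (hf : MDifferentiableAt 𝓘(ℝ, E) 𝓘(ℝ, F) f x) :
    HasDerivAt (fun t => f (φ t x)) (mvfderiv 𝓘(ℝ, E) f x (X x)) 0 := by
  have hγ : HasMFDerivAt 𝓘(ℝ, ℝ) 𝓘(ℝ, E) (fun t => φ t x) 0
      ((1 : ℝ →L[ℝ] ℝ).smulRight (X (φ 0 x))) :=
    (h.integralCurve x hx 0 h.zero_mem).hasMFDerivAt (Ioo_mem_nhds h.zero_mem.1 h.zero_mem.2)
  have hf' : MDifferentiableAt 𝓘(ℝ, E) 𝓘(ℝ, F) f (φ 0 x) := by rwa [h.zero x hx]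
  have h2 : HasMFDerivAt 𝓘(ℝ, ℝ) 𝓘(ℝ, F) (fun t => f (φ t x)) 0 _ :=
    HasMFDerivAt.comp (0 : ℝ) hf'.hasMFDerivAt hγ
  have hd : DifferentiableAt ℝ (fun t => f (φ t x)) 0 :=
    mdifferentiableAt_iff_differentiableAt.1 h2.mdifferentiableAt
  convert! hd.hasDerivAt using 1
  rw [← fderiv_apply_one_eq_deriv, ← mvfderiv_eq_fderiv]
  refine Eq.trans ?_ (DFunLike.congr_fun h2.mfderiv (1 : ℝ)).symm
  change _ = mvfderiv 𝓘(ℝ, E) f (φ 0 x) ((1 : ℝ) • X (φ 0 x))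
  rw [one_smul, h.zero x hx]

namespace CASKManifold

variable (S : CASKManifold E M)

theorem omega_apply (x : M) (u v : TangentSpace 𝓘(ℝ, E) x) :
    S.omega x u v = S.g x (S.J x u) v := rfl

theorem omega_antisymm (x : M) (u v : TangentSpace 𝓘(ℝ, E) x) :
    S.omega x u v = -S.omega x v u := by
  rw [omega_apply, omega_apply, ← S.g_J x (S.J x u) v, S.J_sq, S.g_symm x (S.J x v)]
  simp

theorem contMDiff_J (V : SmoothVectorField 𝓘(ℝ, E) M) :
    ContMDiff 𝓘(ℝ, E) 𝓘(ℝ, E).tangent ∞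
      (fun x => (⟨x, S.J x (V x)⟩ : TangentBundle 𝓘(ℝ, E) M)) :=
  S.J_smooth.clm_bundle_apply V.contMDiff

/-- The vector field `JV`. -/
def JField (V : SmoothVectorField 𝓘(ℝ, E) M) : SmoothVectorField 𝓘(ℝ, E) M :=
  ⟨fun x => S.J x (V x), S.contMDiff_J V⟩

theorem contMDiff_g (V W : SmoothVectorField 𝓘(ℝ, E) M) :
    ContMDiff 𝓘(ℝ, E) 𝓘(ℝ, ℝ) ∞ (fun x => S.g x (V x) (W x)) := by
  have h := ContMDiff.clm_bundle_apply₂ (E₃ := Bundle.Trivial M ℝ) (F₃ := ℝ) (b := fun x => x)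
    S.g_smooth V.contMDiff W.contMDiff
  intro x
  exact (contMDiffAt_totalSpace.1 (h x)).2

theorem contMDiff_omega (V W : SmoothVectorField 𝓘(ℝ, E) M) :
    ContMDiff 𝓘(ℝ, E) 𝓘(ℝ, ℝ) ∞ (fun x => S.omega x (V x) (W x)) :=
  S.contMDiff_g (S.JField V) W

theorem mvfderiv_omega (V W : SmoothVectorField 𝓘(ℝ, E) M) (x : M) (u : TangentSpace 𝓘(ℝ, E) x) :
    mvfderiv 𝓘(ℝ, E) (fun y => S.omega y (V y) (W y)) x u
      = S.omega x (S.conn V x u) (W x) + S.omega x (V x) (S.conn W x u) :=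
  S.conn_omega V W x u

/-- The infinitesimal conditions satisfied by automorphisms: `∇X` is skew with respect to `ω`,
`∇_ξ X = X`, and `∇X` is parallel. -/
structure IsInfinitesimalSymmetry (X : SmoothVectorField 𝓘(ℝ, E) M) : Prop where
  skew : ∀ x u v, S.omega x (S.conn X x u) v = -S.omega x u (S.conn X x v)
  conn_xi : ∀ x, S.conn X x (S.ξ x) = X x
  parallel : ∀ (U W : SmoothVectorField 𝓘(ℝ, E) M) (x : M),
    S.conn (AffineConnection.along S.conn_smooth W X) x (U x) = S.conn X x (S.conn W x (U x))

variable {S}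

theorem PreservesAt.omega {f : M → M} {x : M} (h : S.PreservesAt f x)
    (u v : TangentSpace 𝓘(ℝ, E) x) :
    S.omega (f x) (mfderiv 𝓘(ℝ, E) 𝓘(ℝ, E) f x u) (mfderiv 𝓘(ℝ, E) 𝓘(ℝ, E) f x v)
      = S.omega x u v := by
  rw [omega_apply, omega_apply, ← h.J, h.g]

theorem mfderiv_mpullback {f : M → M} {x : M}
    (h : (mfderiv 𝓘(ℝ, E) 𝓘(ℝ, E) f x).IsInvertible) (W : Π x : M, TangentSpace 𝓘(ℝ, E) x) :
    mfderiv 𝓘(ℝ, E) 𝓘(ℝ, E) f x (mpullback 𝓘(ℝ, E) 𝓘(ℝ, E) f W x) = W (f x) := by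
  obtain ⟨e, he⟩ := h
  rw [mpullback_apply, ← he, ContinuousLinearMap.inverse_equiv]
  exact e.apply_symm_apply _

theorem injective_mfderiv {f : M → M} {x : M}
    (h : (mfderiv 𝓘(ℝ, E) 𝓘(ℝ, E) f x).IsInvertible) :
    Function.Injective (mfderiv 𝓘(ℝ, E) 𝓘(ℝ, E) f x) := by
  obtain ⟨e, he⟩ := h
  rw [← he]
  exact e.injective

variable {X : SmoothVectorField 𝓘(ℝ, E) M}

/-- The pullback `φ_t^*ξ = ξ` is constant in `t`, so its derivative, the bracket, vanishes. -/
theorem IsInfinitesimalAutomorphism.lie_xi (h : S.IsInfinitesimalAutomorphism X) (x : M) :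
    (⁅X, S.ξ⁆ : SmoothVectorField 𝓘(ℝ, E) M) x = 0 := by
  obtain ⟨ε, U, φ, hx, hφ, hp⟩ := h x
  have h1 := hφ.hasDerivAt_mpullback hx S.ξ
  refine h1.unique ((hasDerivAt_const (0 : ℝ) (show E from S.ξ x)).congr_of_eventuallyEq ?_)
  filter_upwards [hφ.eventually_isInvertible hx] with t ht
  exact injective_mfderiv ht.2 ((mfderiv_mpullback ht.2 _).trans (hp t ht.1 x hx).ξ.symm)

/-- Invariance reads `ω(V, W)(φ_t x) = ω_x(φ_t^*V, φ_t^*W)`. On the right all vectors lie in the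
fixed space `T_xM`, so both sides can be differentiated at `t = 0`. -/
theorem IsInfinitesimalAutomorphism.lie_omega (h : S.IsInfinitesimalAutomorphism X)
    (V W : SmoothVectorField 𝓘(ℝ, E) M) (x : M) :
    mvfderiv 𝓘(ℝ, E) (fun y => S.omega y (V y) (W y)) x (X x)
      = S.omega x ((⁅X, V⁆ : SmoothVectorField 𝓘(ℝ, E) M) x) (W x)
        + S.omega x (V x) ((⁅X, W⁆ : SmoothVectorField 𝓘(ℝ, E) M) x) := by
  obtain ⟨ε, U, φ, hx, hφ, hp⟩ := h x
  have h1 := hφ.hasDerivAt_comp hx ((S.contMDiff_omega V W).mdifferentiable (by simp) x)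
  set b : E →L[ℝ] E →L[ℝ] ℝ := S.omega x with hb
  have h2 := (b.hasFDerivAt.comp_hasDerivAt (0 : ℝ) (hφ.hasDerivAt_mpullback hx V)).clm_apply
    (hφ.hasDerivAt_mpullback hx W)
  refine h1.unique (HasDerivAt.congr_of_eventuallyEq ?_ (f := fun t => b
      (show E from mpullback 𝓘(ℝ, E) 𝓘(ℝ, E) (φ t) V x)
      (show E from mpullback 𝓘(ℝ, E) 𝓘(ℝ, E) (φ t) W x)) ?_)
  · convert! h2 using 1
    simp only [Function.comp]
    rw [hφ.mpullback_zero hx, hφ.mpullback_zero hx]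
    rfl
  · filter_upwards [hφ.eventually_isInvertible hx] with t ht
    have h3 := (hp t ht.1 x hx).omega (mpullback 𝓘(ℝ, E) 𝓘(ℝ, E) (φ t) V x)
      (mpullback 𝓘(ℝ, E) 𝓘(ℝ, E) (φ t) W x)
    rw [mfderiv_mpullback ht.2, mfderiv_mpullback ht.2] at h3
    exact h3

/-- This is the derivative at `t = 0` of `φ_t^*(∇_V W) = ∇_{φ_t^*V}(φ_t^*W)`. -/
theorem IsInfinitesimalAutomorphism.lie_conn (h : S.IsInfinitesimalAutomorphism X)
    (V W : SmoothVectorField 𝓘(ℝ, E) M) (x : M) :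
    (⁅X, AffineConnection.along S.conn_smooth V W⁆ : SmoothVectorField 𝓘(ℝ, E) M) x
      = S.conn (⁅X, W⁆ : SmoothVectorField 𝓘(ℝ, E) M) x (V x)
        + S.conn W x ((⁅X, V⁆ : SmoothVectorField 𝓘(ℝ, E) M) x) := by
  obtain ⟨ε, U, φ, hx, hφ, hp⟩ := h x
  have h1 := hφ.hasDerivAt_mpullback hx (AffineConnection.along S.conn_smooth V W)
  have h2 := (hφ.hasDerivAt_conn_mpullback hx S.conn W).clm_apply (hφ.hasDerivAt_mpullback hx V)
  -- The map `φ 0` is the identity only on `U`, so `φ_0^*W` is replaced by `W` through locality of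
  -- the connection.
  have h0 : mpullback 𝓘(ℝ, E) 𝓘(ℝ, E) (φ 0) W =ᶠ[𝓝 x] W := by
    filter_upwards [hφ.isOpen.mem_nhds hx] with y hy using hφ.mpullback_zero hy W
  have h0d : MDifferentiableAt 𝓘(ℝ, E) 𝓘(ℝ, E).tangent
      (fun q => (⟨q, mpullback 𝓘(ℝ, E) 𝓘(ℝ, E) (φ 0) W q⟩ : TangentBundle 𝓘(ℝ, E) M)) x :=
    (W.mdiff x).congr_of_eventuallyEq (h0.mono fun y hy => congrArg (TotalSpace.mk y) hy)
  have h0c : S.conn (mpullback 𝓘(ℝ, E) 𝓘(ℝ, E) (φ 0) W) x = S.conn W x :=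
    S.conn.isCovariantDerivativeOnUniv.congr_of_eventuallyEq h0d (W.mdiff x) Filter.univ_mem h0
  rw [h0c, hφ.mpullback_zero hx] at h2
  refine (h1.unique (h2.congr_of_eventuallyEq ?_))
  filter_upwards [hφ.eventually_isInvertible hx] with t ht
  have h3 := (hp t ht.1 x hx).conn W (mpullback 𝓘(ℝ, E) 𝓘(ℝ, E) (φ t) V x)
  rw [mfderiv_mpullback ht.2] at h3
  exact injective_mfderiv ht.2 ((mfderiv_mpullback ht.2 _).trans h3.symm)

theorem IsInfinitesimalAutomorphism.isInfinitesimalSymmetry [T2Space M]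
    (h : S.IsInfinitesimalAutomorphism X) : S.IsInfinitesimalSymmetry X where
  skew x u v := by
    obtain ⟨V, rfl⟩ := exists_smoothVectorField_eq u
    obtain ⟨W, rfl⟩ := exists_smoothVectorField_eq v
    have h1 := h.lie_omega V W x
    rw [mvfderiv_omega, AffineConnection.lie_eq S.conn_torsion,
      AffineConnection.lie_eq S.conn_torsion] at h1
    simp only [map_sub, _root_.sub_apply] at h1
    linarith
  conn_xi x := by
    have h1 := h.lie_xi x
    rw [AffineConnection.lie_eq S.conn_torsion, S.conn_ξ, sub_eq_zero] at h1
    exact h1.symm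
  parallel U W x := by
    have h1 := h.lie_conn U W x
    -- Expanding the brackets without torsion turns `h1` into `∇_X∇_U W - ∇_{∇_U W}X = ∇_U∇_X W -
    -- ∇_U∇_W X + ∇_{[X,U]}W`. Flatness removes the terms that differentiate `W` twice and leaves
    -- `∇_U∇_W X = ∇_{∇_U W}X`.
    have h2 := S.conn_flat X U W x
    have h3 : ∀ y, (⁅X, W⁆ : SmoothVectorField 𝓘(ℝ, E) M) y
        = (AffineConnection.along S.conn_smooth X W - AffineConnection.along S.conn_smooth W X :
          SmoothVectorField 𝓘(ℝ, E) M) y :=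
      fun y => AffineConnection.lie_eq S.conn_torsion X W y
    have h4 : (⁅X, W⁆ : SmoothVectorField 𝓘(ℝ, E) M)
        = AffineConnection.along S.conn_smooth X W - AffineConnection.along S.conn_smooth W X := by
      ext y; exact h3 y
    rw [h4, AffineConnection.map_sub, AffineConnection.lie_eq S.conn_torsion] at h1
    have h5 : S.conn (AffineConnection.along S.conn_smooth U W) x (X x)
      - S.conn (AffineConnection.along S.conn_smooth X W) x (U x)
      - S.conn W x ((⁅X, U⁆ : SmoothVectorField 𝓘(ℝ, E) M) x) = 0 := h2
    rw [sub_eq_zero, sub_eq_iff_eq_add] at h5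
    rw [h5, AffineConnection.along_apply] at h1
    simp only [_root_.sub_apply] at h1
    rw [sub_eq_iff_eq_add] at h1
    have h6 := h1
    rw [← sub_eq_zero] at h6 ⊢
    rw [← h6]
    abel

/-- Write `[X₁, X₂] = ∇_{X₁}X₂ - ∇_{X₂}X₁`; parallelism of `∇X₂` gives `∇_U∇_{X₁}X₂ = ∇_{∇_U X₁}X₂`,
and likewise with the indices exchanged. -/
theorem conn_lie [T2Space M] {X₁ X₂ : SmoothVectorField 𝓘(ℝ, E) M}
    (h₁ : S.IsInfinitesimalSymmetry X₁) (h₂ : S.IsInfinitesimalSymmetry X₂) (x : M)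
    (u : TangentSpace 𝓘(ℝ, E) x) :
    S.conn (⁅X₁, X₂⁆ : SmoothVectorField 𝓘(ℝ, E) M) x u
      = S.conn X₂ x (S.conn X₁ x u) - S.conn X₁ x (S.conn X₂ x u) := by
  obtain ⟨U, rfl⟩ := exists_smoothVectorField_eq u
  have h4 : (⁅X₁, X₂⁆ : SmoothVectorField 𝓘(ℝ, E) M)
      = AffineConnection.along S.conn_smooth X₁ X₂ - AffineConnection.along S.conn_smooth X₂ X₁ := by
    ext y; exact AffineConnection.lie_eq S.conn_torsion X₁ X₂ y
  rw [h4, AffineConnection.map_sub, _root_.sub_apply, h₁.parallel, h₂.parallel]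

namespace IsInfinitesimalSymmetry

variable {X₁ X₂ : SmoothVectorField 𝓘(ℝ, E) M}

theorem zero : S.IsInfinitesimalSymmetry 0 where
  skew x u v := by simp
  conn_xi x := by simp
  parallel U W x := by
    have : AffineConnection.along S.conn_smooth W (0 : SmoothVectorField 𝓘(ℝ, E) M) = 0 := by
      ext y; simp [AffineConnection.along_apply]
    rw [this, AffineConnection.map_zero]
    rfl

theorem add (h₁ : S.IsInfinitesimalSymmetry X₁) (h₂ : S.IsInfinitesimalSymmetry X₂) :
    S.IsInfinitesimalSymmetry (X₁ + X₂) where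
  skew x u v := by
    simp only [AffineConnection.map_add, _root_.add_apply, _root_.map_add, h₁.skew, h₂.skew]
    ring
  conn_xi x := by
    rw [AffineConnection.map_add, _root_.add_apply, h₁.conn_xi, h₂.conn_xi]
    rfl
  parallel U W x := by
    have : AffineConnection.along S.conn_smooth W (X₁ + X₂)
        = AffineConnection.along S.conn_smooth W X₁ + AffineConnection.along S.conn_smooth W X₂ := by
      ext y
      exact DFunLike.congr_fun (AffineConnection.map_add S.conn X₁ X₂ y) (W y)
    rw [this, AffineConnection.map_add, AffineConnection.map_add, _root_.add_apply,
      _root_.add_apply, h₁.parallel, h₂.parallel]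

theorem smul (c : ℝ) (h₁ : S.IsInfinitesimalSymmetry X₁) :
    S.IsInfinitesimalSymmetry (c • X₁) where
  skew x u v := by
    simp only [AffineConnection.map_smul, _root_.smul_apply, _root_.map_smul, h₁.skew, smul_neg]
  conn_xi x := by
    rw [AffineConnection.map_smul, _root_.smul_apply, h₁.conn_xi]
    rfl
  parallel U W x := by
    have : AffineConnection.along S.conn_smooth W (c • X₁)
        = c • AffineConnection.along S.conn_smooth W X₁ := by
      ext y
      exact DFunLike.congr_fun (AffineConnection.map_smul S.conn c X₁ y) (W y)
    rw [this, AffineConnection.map_smul, AffineConnection.map_smul, _root_.smul_apply,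
      _root_.smul_apply, h₁.parallel]

/-- By `conn_lie` this reduces to commutators: those of skew endomorphisms are skew, those of
parallel ones are parallel, and `(A₂A₁ - A₁A₂)ξ = A₂X₁ - A₁X₂ = [X₁, X₂]`. -/
theorem lie [T2Space M] (h₁ : S.IsInfinitesimalSymmetry X₁) (h₂ : S.IsInfinitesimalSymmetry X₂) :
    S.IsInfinitesimalSymmetry ⁅X₁, X₂⁆ where
  skew x u v := by
    simp only [conn_lie h₁ h₂, map_sub, _root_.sub_apply, h₁.skew, h₂.skew]
    ring
  conn_xi x := by
    rw [conn_lie h₁ h₂, h₁.conn_xi, h₂.conn_xi, AffineConnection.lie_eq S.conn_torsion]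
  parallel U W x := by
    have : AffineConnection.along S.conn_smooth W ⁅X₁, X₂⁆
        = AffineConnection.along S.conn_smooth (AffineConnection.along S.conn_smooth W X₁) X₂
          - AffineConnection.along S.conn_smooth (AffineConnection.along S.conn_smooth W X₂) X₁ := by
      ext y
      exact conn_lie h₁ h₂ y (W y)
    rw [this, AffineConnection.map_sub, conn_lie h₁ h₂, _root_.sub_apply, h₁.parallel,
      h₂.parallel, h₁.parallel, h₂.parallel]

end IsInfinitesimalSymmetry

/-- Infinitesimal symmetries form a Lie subalgebra containing the generators of the Lie span. Thus
no flow of a sum or a bracket has to be constructed. -/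
theorem isInfinitesimalSymmetry_of_mem_aut [T2Space M] (hX : X ∈ S.aut) :
    S.IsInfinitesimalSymmetry X := by
  let K : LieSubalgebra ℝ (SmoothVectorField 𝓘(ℝ, E) M) :=
    { carrier := {X | S.IsInfinitesimalSymmetry X}
      add_mem' := IsInfinitesimalSymmetry.add
      zero_mem' := IsInfinitesimalSymmetry.zero
      smul_mem' := fun c _ h => IsInfinitesimalSymmetry.smul c h
      lie_mem' := IsInfinitesimalSymmetry.lie }
  exact LieSubalgebra.lieSpan_le (K := K).2 (fun _ h => h.isInfinitesimalSymmetry) hX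

end CASKManifold

end Automorphisms

/-! ### Testing regularity of operator-valued maps vector by vector -/

section FiniteDim

variable {E F : Type*} [NormedAddCommGroup E] [NormedSpace ℝ E] [FiniteDimensional ℝ E]
  [NormedAddCommGroup F] [NormedSpace ℝ F]

/-- An operator on a finite-dimensional space is a fixed continuous linear expression in its values
on a basis, so regularity of these values suffices. -/
theorem exists_clm_reconstruction (E F : Type*) [NormedAddCommGroup E] [NormedSpace ℝ E]
    [FiniteDimensional ℝ E] [NormedAddCommGroup F] [NormedSpace ℝ F] :
    ∃ (n : ℕ) (b : Fin n → E) (L : Fin n → F →L[ℝ] (E →L[ℝ] F)),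
      ∀ f : E →L[ℝ] F, f = ∑ i, L i (f (b i)) := by
  let b := Module.finBasis ℝ E
  refine ⟨_, b, fun i => ContinuousLinearMap.smulRightL ℝ E F
    (LinearMap.toContinuousLinearMap (b.coord i)), fun f => ?_⟩
  ext v
  have h := congrArg f (b.sum_repr v)
  rw [map_sum] at h
  simpa using h.symm

variable {E' H' P : Type*} [NormedAddCommGroup E'] [NormedSpace ℝ E'] [TopologicalSpace H']
  {I' : ModelWithCorners ℝ E' H'} [TopologicalSpace P] [ChartedSpace H' P]

theorem contMDiffAt_clm_of_apply {f : P → E →L[ℝ] F} {p : P}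
    (h : ∀ v, ContMDiffAt I' 𝓘(ℝ, F) ∞ (fun q => f q v) p) :
    ContMDiffAt I' 𝓘(ℝ, E →L[ℝ] F) ∞ f p := by
  obtain ⟨n, b, L, hL⟩ := exists_clm_reconstruction E F
  have : f = fun q => ∑ i, L i (f q (b i)) := by ext1 q; exact hL (f q)
  rw [this]
  exact contMDiffAt_finsetSum fun i _ => (L i).contMDiff.contMDiffAt.comp p (h (b i))

theorem mdifferentiableAt_clm_of_apply {f : P → E →L[ℝ] F} {p : P}
    (h : ∀ v, MDifferentiableAt I' 𝓘(ℝ, F) (fun q => f q v) p) :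
    MDifferentiableAt I' 𝓘(ℝ, E →L[ℝ] F) f p := by
  obtain ⟨n, b, L, hL⟩ := exists_clm_reconstruction E F
  have : f = ∑ i, L i ∘ fun q => f q (b i) := by
    ext1 q
    rw [Finset.sum_apply]
    exact hL (f q)
  rw [this]
  exact MDifferentiableAt.sum fun i _ => (L i).mdifferentiableAt.comp p (h (b i))

end FiniteDim

section CotangentBundle

variable {E M : Type*} [NormedAddCommGroup E] [NormedSpace ℝ E] [FiniteDimensional ℝ E]
  [CompleteSpace E] [TopologicalSpace M] [ChartedSpace E M] [IsManifold 𝓘(ℝ, E) ∞ M]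

/-! ### Fibre coordinates on the cotangent bundle -/

/-- The fibre coordinate of a covector in the chart at `x`. -/
def cotangentCoord (x : M) (β : Cotangent E M) : E →L[ℝ] ℝ :=
  (trivializationAt (E →L[ℝ] ℝ) (fun x : M => TangentSpace 𝓘(ℝ, E) x →L[ℝ] ℝ) x β).2

theorem extChartAt_cotangent (α β : Cotangent E M) :
    extChartAt (cotangentModel E) α β
      = (extChartAt 𝓘(ℝ, E) α.proj β.proj, cotangentCoord α.proj β) := by
  rw [FiberBundle.extChartAt]
  rfl

/-- Keeping `v` and `w` separate lets the lemma be used with a field of constant coordinates `v`: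
its pairing is then a fibre coordinate function. -/
theorem cotangentCoord_apply {x : M} {β : Cotangent E M}
    (hβ : β.proj ∈ (extChartAt 𝓘(ℝ, E) x).source) {v : E} {w : TangentSpace 𝓘(ℝ, E) β.proj}
    (hw : mvfderiv 𝓘(ℝ, E) (extChartAt 𝓘(ℝ, E) x) β.proj w = v) :
    cotangentCoord x β v = β.2 w := by
  have hb : β.proj ∈ (trivializationAt E (TangentSpace 𝓘(ℝ, E)) x).baseSet := by
    rw [extChartAt_source] at hβ
    simpa using hβ
  have h1 : cotangentCoord x β v
      = β.2 ((trivializationAt E (TangentSpace 𝓘(ℝ, E)) x).symm β.proj v) := by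
    have : cotangentCoord x β = ContinuousLinearMap.inCoordinates E
        (TangentSpace 𝓘(ℝ, E) : M → Type _) ℝ (Bundle.Trivial M ℝ) x β.proj x β.proj β.2 := rfl
    rw [this, ContinuousLinearMap.inCoordinates_eq hb (Set.mem_univ _)]
    simp
  rw [h1, ← hw, ← trivializationAt_tangent_apply hβ,
    Bundle.Trivialization.symm_apply_apply_mk _ hb]

theorem continuous_proj_cotangent : Continuous (TotalSpace.proj : Cotangent E M → M) :=
  FiberBundle.continuous_proj (E →L[ℝ] ℝ) (fun x : M => TangentSpace 𝓘(ℝ, E) x →L[ℝ] ℝ)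

theorem eventually_proj {α : Cotangent E M} {p : M → Prop} (h : ∀ᶠ y in 𝓝 α.proj, p y) :
    ∀ᶠ β in 𝓝 α, p β.proj :=
  continuous_proj_cotangent.continuousAt.eventually h

theorem contMDiff_proj_cotangent :
    ContMDiff (cotangentModel E) 𝓘(ℝ, E) ∞ (TotalSpace.proj : Cotangent E M → M) :=
  contMDiff_proj _

theorem contMDiff_pairing (W : SmoothVectorField 𝓘(ℝ, E) M) :
    ContMDiff (cotangentModel E) 𝓘(ℝ, ℝ) ∞ (pairing W) := by
  have h1 : ContMDiff (cotangentModel E) (cotangentModel E) ∞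
      (fun β : Cotangent E M => (⟨β.proj, β.2⟩ : Cotangent E M)) := contMDiff_id
  have h2 : ContMDiff (cotangentModel E) 𝓘(ℝ, E).tangent ∞
      (fun β : Cotangent E M => (⟨β.proj, W β.proj⟩ : TangentBundle 𝓘(ℝ, E) M)) :=
    W.contMDiff.comp contMDiff_proj_cotangent
  intro α
  exact (contMDiffAt_totalSpace.1
    ((ContMDiff.clm_bundle_apply (E₂ := Bundle.Trivial M ℝ) (F₂ := ℝ) h1 h2) α)).2

theorem mdifferentiable_pairing (W : SmoothVectorField 𝓘(ℝ, E) M) (α : Cotangent E M) :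
    MDifferentiableAt (cotangentModel E) 𝓘(ℝ, ℝ) (pairing W) α :=
  (contMDiff_pairing W).mdifferentiable (by simp) α

/-! ### Tangent vectors of the cotangent bundle as derivations -/

theorem mvfderiv_comp_proj {F : Type*} [NormedAddCommGroup F] [NormedSpace ℝ F] {f : M → F}
    {α : Cotangent E M} (hf : MDifferentiableAt 𝓘(ℝ, E) 𝓘(ℝ, F) f α.proj)
    (A : TangentSpace (cotangentModel E) α) :
    mvfderiv (cotangentModel E) (fun β : Cotangent E M => f β.proj) α A
      = mvfderiv 𝓘(ℝ, E) f α.proj (dproj α A) :=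
  mvfderiv_fun_comp_apply hf (mdifferentiableAt_proj α) A

theorem mvfderiv_extChartAt_comp_proj {α : Cotangent E M}
    (A : TangentSpace (cotangentModel E) α) :
    mvfderiv (cotangentModel E) (fun β : Cotangent E M => extChartAt 𝓘(ℝ, E) α.proj β.proj) α A
      = dproj α A := by
  rw [mvfderiv_comp_proj (mdifferentiableAt_extChartAt_of_mem (mem_extChartAt_source _)),
    mvfderiv_extChartAt_self]

/-- Tensoriality allows the vertical part, built from a chosen local extension of a vector, to be
evaluated with any smooth field `W`. This is the bridge between the splitting and derivations. -/
theorem mvfderiv_pairing (D : AffineConnection E M) {α : Cotangent E M}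
    (A : TangentSpace (cotangentModel E) α) (W : SmoothVectorField 𝓘(ℝ, E) M) :
    mvfderiv (cotangentModel E) (pairing W) α A
      = verticalPart D α A (W α.proj) + α.2 (D W α.proj (dproj α A)) := by
  have h : verticalPart D α A (W α.proj) = verticalPartAux D α A W :=
    TensorialAt.mkHom_apply (tensorialAt_verticalPartAux D α A) (W.mdiff _)
  rw [h, verticalPartAux, sub_add_cancel]

theorem splitting_fst (D : AffineConnection E M) (α : Cotangent E M)
    (A : TangentSpace (cotangentModel E) α) : (splitting D α A).1 = dproj α A := rfl

/-- Once the projections agree, `mvfderiv_pairing` shows that the vertical parts agree on `W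
α.proj`, and every tangent vector is such a value. -/
theorem cotangent_tangent_ext [T2Space M] (D : AffineConnection E M) {α : Cotangent E M}
    {A B : TangentSpace (cotangentModel E) α} (h1 : dproj α A = dproj α B)
    (h2 : ∀ W : SmoothVectorField 𝓘(ℝ, E) M, mvfderiv (cotangentModel E) (pairing W) α A
      = mvfderiv (cotangentModel E) (pairing W) α B) : A = B := by
  refine (splitting D α).injective (Prod.ext h1 ?_)
  ext w
  obtain ⟨W, rfl⟩ := exists_smoothVectorField_eq w
  have h := h2 W
  rw [mvfderiv_pairing D, mvfderiv_pairing D, h1] at h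
  exact add_right_cancel h

/-- A field of tangent vectors on the cotangent bundle is smooth if it acts smoothly on functions
pulled back from the base and on pairings with vector fields. -/
theorem contMDiff_cotangent_vectorField [T2Space M]
    {V : Π α : Cotangent E M, TangentSpace (cotangentModel E) α} (X : SmoothVectorField 𝓘(ℝ, E) M)
    (hX : ∀ α, dproj α (V α) = X α.proj)
    (hV : ∀ W : SmoothVectorField 𝓘(ℝ, E) M, ContMDiff (cotangentModel E) 𝓘(ℝ, ℝ) ∞
      (fun α => mvfderiv (cotangentModel E) (pairing W) α (V α))) :
    ContMDiff (cotangentModel E) (cotangentModel E).tangent ∞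
      (fun α => (⟨α, V α⟩ : TangentBundle (cotangentModel E) (Cotangent E M))) := by
  intro α
  rw [contMDiffAt_vectorField_iff (mem_extChartAt_source α)]
  set e := extChartAt (cotangentModel E) α with he
  have hes : ∀ᶠ β in 𝓝 α, MDifferentiableAt (cotangentModel E) 𝓘(ℝ, E × (E →L[ℝ] ℝ)) e β := by
    filter_upwards [(isOpen_extChartAt_source (I := cotangentModel E) α).mem_nhds
      (mem_extChartAt_source α)] with β hβ
    exact mdifferentiableAt_extChartAt_of_mem hβ
  have hxs : ∀ᶠ β : Cotangent E M in 𝓝 α, β.proj ∈ (extChartAt 𝓘(ℝ, E) α.proj).source :=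
    eventually_proj ((isOpen_extChartAt_source (I := 𝓘(ℝ, E)) α.proj).mem_nhds
      (mem_extChartAt_source α.proj))
  have h1 : ContMDiffAt (cotangentModel E) 𝓘(ℝ, E) ∞
      (fun β => (mvfderiv (cotangentModel E) e β (V β)).1) α := by
    have hs : ContMDiffAt (cotangentModel E) 𝓘(ℝ, E) ∞ (fun β : Cotangent E M =>
        mvfderiv 𝓘(ℝ, E) (extChartAt 𝓘(ℝ, E) α.proj) β.proj (X β.proj)) α :=
      ContMDiffAt.comp α ((contMDiffAt_vectorField_iff (mem_extChartAt_source α.proj)).1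
        (X.contMDiff α.proj)) (contMDiff_proj_cotangent α)
    refine hs.congr_of_eventuallyEq ?_
    filter_upwards [hes, hxs] with β hβ hβx
    have h3 := HasFDerivAt.mvfderiv_comp_apply
      (ContinuousLinearMap.fst ℝ E (E →L[ℝ] ℝ)).hasFDerivAt hβ (V β)
    refine h3.symm.trans ?_
    have h4 : (fun γ : Cotangent E M => (ContinuousLinearMap.fst ℝ E (E →L[ℝ] ℝ)) (e γ))
        = fun γ => extChartAt 𝓘(ℝ, E) α.proj γ.proj := by
      ext γ
      rw [he, extChartAt_cotangent]
      rfl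
    rw [h4, mvfderiv_comp_proj (mdifferentiableAt_extChartAt_of_mem hβx), hX]
  have h2 : ContMDiffAt (cotangentModel E) 𝓘(ℝ, E →L[ℝ] ℝ) ∞
      (fun β => (mvfderiv (cotangentModel E) e β (V β)).2) α := by
    refine contMDiffAt_clm_of_apply fun w => ?_
    -- For `W` with constant coordinates `w` near the base point, the function `λ(W)` is locally the
    -- fibre coordinate in direction `w`.
    obtain ⟨W, -, hW⟩ := exists_smoothVectorField_coord_eq α.proj
      (show TangentSpace 𝓘(ℝ, E) α.proj from w)
    refine (hV W α).congr_of_eventuallyEq ?_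
    filter_upwards [hes, (eventually_proj hW).eventually_nhds, hxs.eventually_nhds]
      with β hβ hβW hβx
    let L : E × (E →L[ℝ] ℝ) →L[ℝ] ℝ := (ContinuousLinearMap.apply ℝ ℝ w).comp
      (ContinuousLinearMap.snd ℝ E (E →L[ℝ] ℝ))
    have h3 := HasFDerivAt.mvfderiv_comp_apply L.hasFDerivAt hβ (V β)
    refine h3.symm.trans (DFunLike.congr_fun (Filter.EventuallyEq.mvfderiv_eq ?_) (V β))
    filter_upwards [hβW, hβx] with γ hγ hγx
    rw [he, extChartAt_cotangent]
    exact cotangentCoord_apply hγx hγ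
  exact h1.prodMk_space h2

/-- A curve in the cotangent bundle is differentiable if its projection and its pairings with
vector fields are. -/
theorem mdifferentiableAt_cotangent_curve [T2Space M] {c : ℝ → Cotangent E M} {t : ℝ}
    (h1 : MDifferentiableAt 𝓘(ℝ, ℝ) 𝓘(ℝ, E) (fun s => (c s).proj) t)
    (h2 : ∀ W : SmoothVectorField 𝓘(ℝ, E) M, DifferentiableAt ℝ (fun s => pairing W (c s)) t) :
    MDifferentiableAt 𝓘(ℝ, ℝ) (cotangentModel E) c t := by
  rw [mdifferentiableAt_totalSpace]
  refine ⟨h1, mdifferentiableAt_clm_of_apply fun w => ?_⟩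
  obtain ⟨W, -, hW⟩ := exists_smoothVectorField_coord_eq (c t).proj
    (show TangentSpace 𝓘(ℝ, E) (c t).proj from w)
  refine (h2 W).mdifferentiableAt.congr_of_eventuallyEq ?_
  filter_upwards [h1.continuousAt.eventually hW, h1.continuousAt.eventually
    ((isOpen_extChartAt_source (I := 𝓘(ℝ, E)) (c t).proj).mem_nhds
      (mem_extChartAt_source (c t).proj))] with s hs hsx
  exact cotangentCoord_apply hsx hs

end CotangentBundle

section CanonicalLift

variable {E M : Type*} [NormedAddCommGroup E] [NormedSpace ℝ E] [FiniteDimensional ℝ E]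
  [CompleteSpace E] [TopologicalSpace M] [ChartedSpace E M] [IsManifold 𝓘(ℝ, E) ∞ M]

namespace CASKManifold

variable (S : CASKManifold E M)

/-! ### The canonical lift of a vector field -/

theorem splitting_canonicalLift (X : Π x : M, TangentSpace 𝓘(ℝ, E) x) (α : Cotangent E M) :
    splitting S.conn α (S.canonicalLift X α) = (X α.proj, -S.lambdaNabla X α) :=
  (splitting S.conn α).apply_symm_apply _

theorem dproj_canonicalLift (X : Π x : M, TangentSpace 𝓘(ℝ, E) x) (α : Cotangent E M) :
    dproj α (S.canonicalLift X α) = X α.proj :=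
  congrArg Prod.fst (S.splitting_canonicalLift X α)

theorem verticalPart_canonicalLift (X : Π x : M, TangentSpace 𝓘(ℝ, E) x) (α : Cotangent E M) :
    verticalPart S.conn α (S.canonicalLift X α) = -S.lambdaNabla X α :=
  congrArg Prod.snd (S.splitting_canonicalLift X α)

/-- The canonical lift acts on pairings by the Lie bracket. -/
theorem mvfderiv_pairing_canonicalLift (X W : SmoothVectorField 𝓘(ℝ, E) M) (α : Cotangent E M) :
    mvfderiv (cotangentModel E) (pairing W) α (S.canonicalLift X α)
      = pairing (⁅X, W⁆ : SmoothVectorField 𝓘(ℝ, E) M) α := by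
  rw [mvfderiv_pairing S.conn, verticalPart_canonicalLift, dproj_canonicalLift, pairing,
    AffineConnection.lie_eq S.conn_torsion, map_sub, lambdaNabla]
  exact neg_add_eq_sub _ _

theorem contMDiff_canonicalLift [T2Space M] (X : SmoothVectorField 𝓘(ℝ, E) M) :
    ContMDiff (cotangentModel E) (cotangentModel E).tangent ∞
      (fun α => (⟨α, S.canonicalLift X α⟩ : TangentBundle (cotangentModel E) (Cotangent E M))) := by
  refine contMDiff_cotangent_vectorField X (S.dproj_canonicalLift X) fun W => ?_
  simp only [S.mvfderiv_pairing_canonicalLift X W]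
  exact contMDiff_pairing _

/-- The canonical lift as a smooth vector field. -/
def liftField [T2Space M] (X : SmoothVectorField 𝓘(ℝ, E) M) :
    SmoothVectorField (cotangentModel E) (Cotangent E M) :=
  ⟨fun α => S.canonicalLift X α, S.contMDiff_canonicalLift X⟩

theorem liftField_apply [T2Space M] (X : SmoothVectorField 𝓘(ℝ, E) M) (α : Cotangent E M) :
    S.liftField X α = S.canonicalLift X α := rfl

theorem lambdaNabla_add (X Y : SmoothVectorField 𝓘(ℝ, E) M) (α : Cotangent E M) :
    S.lambdaNabla (X + Y : SmoothVectorField 𝓘(ℝ, E) M) α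
      = S.lambdaNabla X α + S.lambdaNabla Y α := by
  rw [lambdaNabla, AffineConnection.map_add, ContinuousLinearMap.comp_add]
  rfl

theorem lambdaNabla_smul (c : ℝ) (X : SmoothVectorField 𝓘(ℝ, E) M) (α : Cotangent E M) :
    S.lambdaNabla (c • X : SmoothVectorField 𝓘(ℝ, E) M) α = c • S.lambdaNabla X α := by
  rw [lambdaNabla, AffineConnection.map_smul, ContinuousLinearMap.comp_smul]
  rfl

theorem canonicalLift_add (X Y : SmoothVectorField 𝓘(ℝ, E) M) (α : Cotangent E M) :
    S.canonicalLift (X + Y : SmoothVectorField 𝓘(ℝ, E) M) α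
      = S.canonicalLift X α + S.canonicalLift Y α := by
  apply (splitting S.conn α).injective
  rw [_root_.map_add, splitting_canonicalLift, splitting_canonicalLift, splitting_canonicalLift,
    lambdaNabla_add, neg_add]
  rfl

theorem canonicalLift_smul (c : ℝ) (X : SmoothVectorField 𝓘(ℝ, E) M) (α : Cotangent E M) :
    S.canonicalLift (c • X : SmoothVectorField 𝓘(ℝ, E) M) α = c • S.canonicalLift X α := by
  apply (splitting S.conn α).injective
  rw [_root_.map_smul, splitting_canonicalLift, splitting_canonicalLift, lambdaNabla_smul]
  exact Prod.ext rfl (smul_neg c (S.lambdaNabla X α)).symm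

/-- Tested on base coordinates, this says that brackets of `π`-related fields are `π`-related;
tested on the functions `λ(W)`, it is the Jacobi identity. -/
theorem lie_liftField [T2Space M] (X₁ X₂ : SmoothVectorField 𝓘(ℝ, E) M) :
    ⁅S.liftField X₁, S.liftField X₂⁆ = S.liftField ⁅X₁, X₂⁆ := by
  ext α
  rw [SmoothVectorField.lie_apply]
  refine cotangent_tangent_ext S.conn ?_ fun W => ?_
  · have hx := mem_extChartAt_source (I := 𝓘(ℝ, E)) α.proj
    have hf : ContMDiffAt (cotangentModel E) 𝓘(ℝ, E) ∞
        (fun β : Cotangent E M => extChartAt 𝓘(ℝ, E) α.proj β.proj) α :=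
      ContMDiffAt.comp α contMDiffAt_extChartAt (contMDiff_proj_cotangent α)
    have h1 := mvfderiv_mlieBracket ((S.liftField X₁).mdiff α) ((S.liftField X₂).mdiff α) hf
    have h2 := mvfderiv_mlieBracket (X₁.mdiff α.proj) (X₂.mdiff α.proj)
      (contMDiffAt_extChartAt (I := 𝓘(ℝ, E)) (n := ∞))
    have key : ∀ U V : SmoothVectorField 𝓘(ℝ, E) M,
        mvfderiv (cotangentModel E) (fun β => mvfderiv (cotangentModel E)
          (fun β : Cotangent E M => extChartAt 𝓘(ℝ, E) α.proj β.proj) β (S.liftField U β)) α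
          (S.liftField V α)
        = mvfderiv 𝓘(ℝ, E) (fun y => mvfderiv 𝓘(ℝ, E) (extChartAt 𝓘(ℝ, E) α.proj) y (U y)) α.proj
          (V α.proj) := by
      intro U V
      rw [← S.dproj_canonicalLift V α, ← S.liftField_apply, ← mvfderiv_comp_proj
        ((mdifferentiableAt_vectorField_iff hx).1 (U.mdiff α.proj))]
      refine DFunLike.congr_fun (Filter.EventuallyEq.mvfderiv_eq ?_) _
      filter_upwards [eventually_proj ((isOpen_extChartAt_source (I := 𝓘(ℝ, E)) α.proj).mem_nhds
        hx)] with β hβ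
      rw [mvfderiv_comp_proj (mdifferentiableAt_extChartAt_of_mem hβ), S.liftField_apply,
        S.dproj_canonicalLift]
    rw [key, key, ← h2, mvfderiv_extChartAt_comp_proj, mvfderiv_extChartAt_self] at h1
    rw [S.liftField_apply, S.dproj_canonicalLift]
    exact h1
  · have h1 := mvfderiv_mlieBracket ((S.liftField X₁).mdiff α) ((S.liftField X₂).mdiff α)
      (contMDiff_pairing W α)
    rw [h1]
    simp only [liftField_apply, mvfderiv_pairing_canonicalLift]
    have h2 := congrArg (fun V : SmoothVectorField 𝓘(ℝ, E) M => V α.proj) (lie_lie X₁ X₂ W)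
    refine Eq.trans ?_ (congrArg α.2 h2.symm)
    exact (_root_.map_sub α.2 _ _).symm

theorem cotangent_comp_inverse_mfderiv {f : M → M} {x : M} (h : f =ᶠ[𝓝 x] id)
    (a : TangentSpace 𝓘(ℝ, E) x →L[ℝ] ℝ) :
    (⟨f x, a.comp (mfderiv 𝓘(ℝ, E) 𝓘(ℝ, E) f x).inverse⟩ : Cotangent E M) = ⟨x, a⟩ := by
  refine TotalSpace.ext h.eq_of_nhds (heq_of_eq ?_)
  have h1 : (mfderiv 𝓘(ℝ, E) 𝓘(ℝ, E) f x : E →L[ℝ] E) = ContinuousLinearMap.id ℝ E :=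
    h.mfderiv_eq.trans (mfderiv_id ..)
  -- The covectors sit over `f x` and `x`, which are only propositionally equal; all the tangent
  -- spaces are definitionally `E`, and there the comparison can be made.
  have h2 : ∀ (b : E →L[ℝ] ℝ) (L : E →L[ℝ] E), L = ContinuousLinearMap.id ℝ E →
      b.comp L.inverse = b := by
    rintro b _ rfl
    rw [ContinuousLinearMap.inverse_id, ContinuousLinearMap.comp_id]
  exact h2 a _ h1

/-- The canonical lift generates the induced local flow on covectors. -/
theorem hasMFDerivAt_cotangent_flow [T2Space M] {X : SmoothVectorField 𝓘(ℝ, E) M} {ε : ℝ}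
    {U : Set M} {φ : ℝ → M → M} (h : IsLocalFlow X ε U φ) (α : Cotangent E M) (hα : α.proj ∈ U) :
    HasMFDerivAt 𝓘(ℝ, ℝ) (cotangentModel E)
      (fun t : ℝ => (⟨φ t α.proj,
        α.2.comp (mfderiv 𝓘(ℝ, E) 𝓘(ℝ, E) (φ t) α.proj).inverse⟩ : Cotangent E M)) 0
      ((1 : ℝ →L[ℝ] ℝ).smulRight (S.canonicalLift X α)) := by
  set c : ℝ → Cotangent E M := fun t => ⟨φ t α.proj,
    α.2.comp (mfderiv 𝓘(ℝ, E) 𝓘(ℝ, E) (φ t) α.proj).inverse⟩ with hc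
  have hγ : HasMFDerivAt 𝓘(ℝ, ℝ) 𝓘(ℝ, E) (fun t => φ t α.proj) 0
      ((1 : ℝ →L[ℝ] ℝ).smulRight (X (φ 0 α.proj))) :=
    (h.integralCurve α.proj hα 0 h.zero_mem).hasMFDerivAt
      (Ioo_mem_nhds h.zero_mem.1 h.zero_mem.2)
  have hW : ∀ W : SmoothVectorField 𝓘(ℝ, E) M, HasDerivAt (fun t => pairing W (c t))
      (pairing (⁅X, W⁆ : SmoothVectorField 𝓘(ℝ, E) M) α) 0 := fun W =>
    -- By definition `λ(W)` along the curve is `α(dφ_t⁻¹ W(φ_t x)) = α(φ_t^*W)`.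
    (show E →L[ℝ] ℝ from α.2).hasFDerivAt.comp_hasDerivAt (0 : ℝ) (h.hasDerivAt_mpullback hα W)
  have hd : MDifferentiableAt 𝓘(ℝ, ℝ) (cotangentModel E) c 0 :=
    mdifferentiableAt_cotangent_curve hγ.mdifferentiableAt fun W => (hW W).differentiableAt
  have hc0 : c 0 = α := cotangent_comp_inverse_mfderiv
    (by filter_upwards [h.isOpen.mem_nhds hα] with y hy using h.zero y hy) α.2
  obtain ⟨A, hA⟩ : ∃ A : TangentSpace (cotangentModel E) α,
      HasMFDerivAt 𝓘(ℝ, ℝ) (cotangentModel E) c 0 ((1 : ℝ →L[ℝ] ℝ).smulRight A) := by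
    refine ⟨(mfderiv 𝓘(ℝ, ℝ) (cotangentModel E) c 0 : ℝ →L[ℝ] E × (E →L[ℝ] ℝ)) 1, ?_⟩
    have h1 : ∀ L : ℝ →L[ℝ] E × (E →L[ℝ] ℝ), (1 : ℝ →L[ℝ] ℝ).smulRight (L 1) = L := by
      intro L
      ext <;> simp
    exact (congrArg (fun L : ℝ →L[ℝ] E × (E →L[ℝ] ℝ) =>
      HasMFDerivAt 𝓘(ℝ, ℝ) (cotangentModel E) c 0 L) (h1 _)).mpr hd.hasMFDerivAt
  have hAeq : A = S.canonicalLift X α := by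
    refine cotangent_tangent_ext S.conn ?_ fun W => ?_
    -- The chain rule wants a derivative at `c 0`, which is only propositionally `α`; quantifying
    -- over `β = α` transports it.
    · have h1 : ∀ β : Cotangent E M, β = α → HasMFDerivAt (cotangentModel E) 𝓘(ℝ, E)
          (TotalSpace.proj : Cotangent E M → M) β (dproj α : E × (E →L[ℝ] ℝ) →L[ℝ] E) := by
        rintro _ rfl
        exact (_root_.mdifferentiableAt_proj _).hasMFDerivAt
      have h2 := DFunLike.congr_fun (hasMFDerivAt_unique (HasMFDerivAt.comp (0 : ℝ)
        (h1 _ hc0) hA) hγ) (1 : ℝ)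
      have h3 : dproj α ((1 : ℝ) • A) = (1 : ℝ) • X (φ 0 α.proj) := h2
      rw [one_smul, one_smul, h.zero _ hα] at h3
      rw [h3, S.dproj_canonicalLift]
    · have h1 : ∀ β : Cotangent E M, β = α → HasMFDerivAt (cotangentModel E) 𝓘(ℝ, ℝ)
          (pairing W) β (mvfderiv (cotangentModel E) (pairing W) α :
            E × (E →L[ℝ] ℝ) →L[ℝ] ℝ) := by
        rintro _ rfl
        exact (mdifferentiable_pairing W _).hasMFDerivAt
      have h2 := DFunLike.congr_fun (hasMFDerivAt_unique (HasMFDerivAt.comp (0 : ℝ)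
        (h1 _ hc0) hA) (hW W).hasFDerivAt.hasMFDerivAt) (1 : ℝ)
      have h3 : mvfderiv (cotangentModel E) (pairing W) α ((1 : ℝ) • A)
        = (1 : ℝ) • pairing (⁅X, W⁆ : SmoothVectorField 𝓘(ℝ, E) M) α := h2
      rw [one_smul, one_smul] at h3
      rw [h3, S.mvfderiv_pairing_canonicalLift]
  rw [← hAeq]
  exact hA

end CASKManifold

end CanonicalLift

/-! ### Exterior derivatives of one-forms -/

section ExteriorDerivative

variable {E : Type*} [NormedAddCommGroup E] [NormedSpace ℝ E] {H : Type*} [TopologicalSpace H]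
  {I : ModelWithCorners ℝ E H} {P : Type*} [TopologicalSpace P] [ChartedSpace H P]
  {F : Type*} [NormedAddCommGroup F] [NormedSpace ℝ F]
  {F' : Type*} [NormedAddCommGroup F'] [NormedSpace ℝ F']
  [I.Boundaryless] [IsManifold I ∞ P]

theorem mdifferentiableAt_mvfderiv_apply {V : Π p : P, TangentSpace I p} {p : P} {f : P → F}
    (hV : MDifferentiableAt I I.tangent (fun q => (⟨q, V q⟩ : TangentBundle I P)) p)
    (hf : ContMDiffAt I 𝓘(ℝ, F) ∞ f p) :
    MDifferentiableAt I 𝓘(ℝ, F) (fun q => mvfderiv I f q (V q)) p := by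
  have hp : p ∈ (extChartAt I p).source := mem_extChartAt_source p
  have hf2 : ContMDiffAt I 𝓘(ℝ, F) 2 f p := hf.of_le two_le_infty
  have hgd := contDiffAt_comp_extChartAt_symm two_le_infty hp hf2
  have hdg := (hgd.fderiv_right (m := 1) (by norm_num)).differentiableAt (by simp)
  have h1 := (mdifferentiableAt_vectorField_iff hp).1 hV
  have h2 := hdg.clm_apply (mdifferentiableAt_comp_extChartAt_symm hp h1)
  refine (h2.mdifferentiableAt.comp p
    (mdifferentiableAt_extChartAt_of_mem hp)).congr_of_eventuallyEq ?_
  have : IsManifold I 2 P := IsManifold.of_le (n := ∞) two_le_infty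
  filter_upwards [(contMDiffAt_iff_contMDiffAt_nhds (by simp)).1 hf2,
    (isOpen_extChartAt_source p).mem_nhds hp] with q hq hqs
  rw [mvfderiv_eq_fderiv_comp_extChartAt_symm hqs (hq.mdifferentiableAt (by simp))]
  simp only [Function.comp]
  rw [(extChartAt I p).left_inv hqs]

/-- The exterior derivative of the one-form `L dh`. -/
theorem extDeriv_clm_mvfderiv [CompleteSpace E] {A B : Π p : P, TangentSpace I p} {p : P}
    {h : P → F} {L : P → F →L[ℝ] F'}
    (hA : MDifferentiableAt I I.tangent (fun q => (⟨q, A q⟩ : TangentBundle I P)) p)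
    (hB : MDifferentiableAt I I.tangent (fun q => (⟨q, B q⟩ : TangentBundle I P)) p)
    (hh : ContMDiffAt I 𝓘(ℝ, F) ∞ h p) (hL : MDifferentiableAt I 𝓘(ℝ, F →L[ℝ] F') L p) :
    mvfderiv I (fun q => L q (mvfderiv I h q (B q))) p (A p)
      - mvfderiv I (fun q => L q (mvfderiv I h q (A q))) p (B p)
      - L p (mvfderiv I h p (mlieBracket I A B p))
    = mvfderiv I L p (A p) (mvfderiv I h p (B p))
      - mvfderiv I L p (B p) (mvfderiv I h p (A p)) := by
  rw [mvfderiv_mlieBracket hA hB hh,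
    mvfderiv_clm_apply_apply hL (mdifferentiableAt_mvfderiv_apply hA hh),
    mvfderiv_clm_apply_apply hL (mdifferentiableAt_mvfderiv_apply hB hh), map_sub]
  abel

end ExteriorDerivative

/-! ### Exterior derivative of forms pulled back from the base -/

section Pullback

variable {E M : Type*} [NormedAddCommGroup E] [NormedSpace ℝ E] [FiniteDimensional ℝ E]
  [CompleteSpace E] [TopologicalSpace M] [ChartedSpace E M] [IsManifold 𝓘(ℝ, E) ∞ M]

/-- A one-form is `L dh` near `x` for the chart `h` at `x`. -/
theorem exists_oneForm_coord [T2Space M] {η : Π x : M, TangentSpace 𝓘(ℝ, E) x →L[ℝ] ℝ}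
    (hη : ∀ W : SmoothVectorField 𝓘(ℝ, E) M, ContMDiff 𝓘(ℝ, E) 𝓘(ℝ, ℝ) ∞ fun y => η y (W y))
    (x : M) : ∃ L : M → E →L[ℝ] ℝ, ContMDiffAt 𝓘(ℝ, E) 𝓘(ℝ, E →L[ℝ] ℝ) ∞ L x ∧
      ∀ y ∈ (extChartAt 𝓘(ℝ, E) x).source, ∀ v : TangentSpace 𝓘(ℝ, E) y,
        L y (mvfderiv 𝓘(ℝ, E) (extChartAt 𝓘(ℝ, E) x) y v) = η y v := by
  have hinv : ∀ y ∈ (extChartAt 𝓘(ℝ, E) x).source,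
      (mfderiv 𝓘(ℝ, E) 𝓘(ℝ, E) (extChartAt 𝓘(ℝ, E) x) y).IsInvertible := by
    have : IsManifold 𝓘(ℝ, E) 1 M := IsManifold.of_le (n := ∞) (by simp)
    exact fun y hy => isInvertible_mfderiv_extChartAt hy
  have key : ∀ y ∈ (extChartAt 𝓘(ℝ, E) x).source, ∀ v : TangentSpace 𝓘(ℝ, E) y,
      (η y).comp (mfderiv 𝓘(ℝ, E) 𝓘(ℝ, E) (extChartAt 𝓘(ℝ, E) x) y).inverse
        (mvfderiv 𝓘(ℝ, E) (extChartAt 𝓘(ℝ, E) x) y v) = η y v :=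
    fun y hy v => congrArg (η y) ((hinv y hy).inverse_apply_self v)
  refine ⟨fun y => (η y).comp (mfderiv 𝓘(ℝ, E) 𝓘(ℝ, E) (extChartAt 𝓘(ℝ, E) x) y).inverse,
    contMDiffAt_clm_of_apply fun w => ?_, key⟩
  obtain ⟨W, -, hW⟩ := exists_smoothVectorField_coord_eq x (show TangentSpace 𝓘(ℝ, E) x from w)
  refine (hη W x).congr_of_eventuallyEq ?_
  filter_upwards [hW, (isOpen_extChartAt_source (I := 𝓘(ℝ, E)) x).mem_nhds
    (mem_extChartAt_source x)] with y hy hys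
  rw [← key y hys, hy]
  rfl

/-- `d(π^*η) = π^*dη`. -/
theorem extDerivOneForm_pullback [T2Space M] {η : Π x : M, TangentSpace 𝓘(ℝ, E) x →L[ℝ] ℝ}
    (hη : ∀ W : SmoothVectorField 𝓘(ℝ, E) M, ContMDiff 𝓘(ℝ, E) 𝓘(ℝ, ℝ) ∞ fun y => η y (W y))
    (A B : SmoothVectorField (cotangentModel E) (Cotangent E M)) (α : Cotangent E M)
    {U V : SmoothVectorField 𝓘(ℝ, E) M} (hU : U α.proj = dproj α (A α))
    (hV : V α.proj = dproj α (B α)) :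
    CASKManifold.extDerivOneForm (fun β C => η β.proj (dproj β C)) A B α
      = mvfderiv 𝓘(ℝ, E) (fun y => η y (V y)) α.proj (U α.proj)
        - mvfderiv 𝓘(ℝ, E) (fun y => η y (U y)) α.proj (V α.proj)
        - η α.proj ((⁅U, V⁆ : SmoothVectorField 𝓘(ℝ, E) M) α.proj) := by
  obtain ⟨L, hLs, hL⟩ := exists_oneForm_coord hη α.proj
  have hx := mem_extChartAt_source (I := 𝓘(ℝ, E)) α.proj
  have hxs := (isOpen_extChartAt_source (I := 𝓘(ℝ, E)) α.proj).mem_nhds hx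
  have hLd : MDifferentiableAt 𝓘(ℝ, E) 𝓘(ℝ, E →L[ℝ] ℝ) L α.proj :=
    hLs.mdifferentiableAt (by simp)
  have hM : ∀ W : SmoothVectorField 𝓘(ℝ, E) M, mvfderiv 𝓘(ℝ, E) (fun y => η y (W y)) α.proj
      = mvfderiv 𝓘(ℝ, E) (fun y => L y (mvfderiv 𝓘(ℝ, E) (extChartAt 𝓘(ℝ, E) α.proj) y (W y)))
        α.proj := by
    intro W
    apply Filter.EventuallyEq.mvfderiv_eq
    filter_upwards [hxs] with y hy using (hL y hy _).symm
  have hN' : ∀ β : Cotangent E M, β.proj ∈ (extChartAt 𝓘(ℝ, E) α.proj).source →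
      ∀ C : TangentSpace (cotangentModel E) β, L β.proj (mvfderiv (cotangentModel E)
        (fun γ : Cotangent E M => extChartAt 𝓘(ℝ, E) α.proj γ.proj) β C)
        = η β.proj (dproj β C) := by
    intro β hβ C
    rw [mvfderiv_comp_proj (mdifferentiableAt_extChartAt_of_mem hβ), hL _ hβ]
  have hN : ∀ C : SmoothVectorField (cotangentModel E) (Cotangent E M),
      mvfderiv (cotangentModel E) (fun β => η β.proj (dproj β (C β))) α
      = mvfderiv (cotangentModel E) (fun β => L β.proj (mvfderiv (cotangentModel E)
        (fun γ : Cotangent E M => extChartAt 𝓘(ℝ, E) α.proj γ.proj) β (C β))) α := by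
    intro C
    apply Filter.EventuallyEq.mvfderiv_eq
    filter_upwards [eventually_proj hxs] with β hβ using (hN' β hβ _).symm
  have hf : ContMDiffAt (cotangentModel E) 𝓘(ℝ, E) ∞
      (fun β : Cotangent E M => extChartAt 𝓘(ℝ, E) α.proj β.proj) α :=
    ContMDiffAt.comp α contMDiffAt_extChartAt (contMDiff_proj_cotangent α)
  have hLp : MDifferentiableAt (cotangentModel E) 𝓘(ℝ, E →L[ℝ] ℝ)
      (fun β : Cotangent E M => L β.proj) α :=
    MDifferentiableAt.comp α hLd (_root_.mdifferentiableAt_proj α)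
  -- With `η = L dh`, both sides reduce to `dL(U)(dh V) - dL(V)(dh U)`, which depends on point
  -- values only. Hence `U`, `V` need to match `A`, `B` only at `α`, and `A`, `B` need not be
  -- projectable.
  rw [CASKManifold.extDerivOneForm, hN, hN, ← hN' α hx,
    extDeriv_clm_mvfderiv (A.mdiff α) (B.mdiff α) hf hLp, hM, hM, ← hL _ hx,
    SmoothVectorField.lie_apply,
    extDeriv_clm_mvfderiv (U.mdiff α.proj) (V.mdiff α.proj) contMDiffAt_extChartAt hLd,
    mvfderiv_comp_proj hLd, mvfderiv_comp_proj hLd, mvfderiv_extChartAt_comp_proj,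
    mvfderiv_extChartAt_comp_proj, mvfderiv_extChartAt_self, mvfderiv_extChartAt_self, hU, hV]

end Pullback

section HermitianForm

variable {E M : Type*} [NormedAddCommGroup E] [NormedSpace ℝ E] [FiniteDimensional ℝ E]
  [CompleteSpace E] [TopologicalSpace M] [ChartedSpace E M] [IsManifold 𝓘(ℝ, E) ∞ M]

theorem isInvertible_of_nondegenerate {L : E →L[ℝ] E →L[ℝ] ℝ}
    (h : ∀ u, (∀ v, L u v = 0) → u = 0) : L.IsInvertible := by
  have hinj : Function.Injective (L : E →ₗ[ℝ] E →L[ℝ] ℝ) := by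
    rw [← LinearMap.ker_eq_bot, LinearMap.ker_eq_bot']
    exact fun u hu => h u fun v => DFunLike.congr_fun hu v
  have hd : Module.finrank ℝ E = Module.finrank ℝ (E →L[ℝ] ℝ) := by
    rw [← (LinearMap.toContinuousLinearMap : (E →ₗ[ℝ] ℝ) ≃ₗ[ℝ] E →L[ℝ] ℝ).finrank_eq]
    exact Subspace.dual_finrank_eq.symm
  refine ⟨(LinearEquiv.ofInjectiveOfFinrankEq _ hinj hd).toContinuousLinearEquiv, ?_⟩
  ext u v
  rfl

namespace CASKManifold

variable (S : CASKManifold E M)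

/-! ### The two-form `ω_H` -/

theorem isInvertible_g (x : M) : (S.g x).IsInvertible :=
  isInvertible_of_nondegenerate (E := E) (L := S.g x) (S.g_nondegenerate x)

theorem isInvertible_omega (x : M) : (S.omega x).IsInvertible := by
  refine isInvertible_of_nondegenerate (E := E) (L := S.omega x) fun u hu => ?_
  have h1 : S.J x u = 0 := S.g_nondegenerate x _ hu
  have h2 := S.J_sq x u
  rw [h1, _root_.map_zero] at h2
  exact neg_eq_zero.1 h2.symm

theorem omegaInv_omega (x : M) (u : TangentSpace 𝓘(ℝ, E) x) (b : TangentSpace 𝓘(ℝ, E) x →L[ℝ] ℝ) :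
    S.omegaInv x (S.omega x u) b = b u := by
  rw [omegaInv, (S.isInvertible_omega x).inverse_apply_self]

theorem exists_omega_eq (x : M) (a : TangentSpace 𝓘(ℝ, E) x →L[ℝ] ℝ) :
    ∃ u, S.omega x u = a :=
  ⟨_, (S.isInvertible_omega x).self_apply_inverse a⟩

/-- For `a = ω(u, ·)` one has `a ∘ J = g(Ju, J·) = g(u, ·)`, so both sides equal `b(u)`. This
identifies the vertical block of `ω₁`. -/
theorem gInv_comp_J (x : M) (a b : TangentSpace 𝓘(ℝ, E) x →L[ℝ] ℝ) :
    S.gInv x (a.comp (S.J x)) b = S.omegaInv x a b := by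
  obtain ⟨u, rfl⟩ := S.exists_omega_eq x a
  have h : (S.omega x u).comp (S.J x) = S.g x u := by
    ext v
    exact S.g_J x u v
  rw [omegaInv_omega, h, gInv, (S.isInvertible_g x).inverse_apply_self]

theorem omega₁_apply (α : Cotangent E M) (A B : TangentSpace (cotangentModel E) α) :
    S.omega₁ α A B = S.omega α.proj (dproj α A) (dproj α B)
      + S.omegaInv α.proj (verticalPart S.conn α A) (verticalPart S.conn α B) := by
  rw [← S.gInv_comp_J, omega_apply, omega₁, gN, I₁, LinearEquiv.apply_symm_apply]
  rfl

theorem gN_Z (α : Cotangent E M) (C : TangentSpace (cotangentModel E) α) :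
    S.gN α (S.Z α) C = -S.omega α.proj (S.ξ α.proj) (dproj α C) := by
  rw [gN, Z, _root_.map_neg, horizontalLift, LinearEquiv.apply_symm_apply, gInv]
  simp [omega_apply, splitting_fst]

theorem mvfderiv_omega_xi (V : SmoothVectorField 𝓘(ℝ, E) M) (x : M) (u : TangentSpace 𝓘(ℝ, E) x) :
    mvfderiv 𝓘(ℝ, E) (fun y => S.omega y (S.ξ y) (V y)) x u
      = S.omega x u (V x) + S.omega x (S.ξ x) (S.conn V x u) := by
  rw [mvfderiv_omega, S.conn_ξ]

/-- `d(ι_Z g_N) = -2 π^*ω`. -/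
theorem extDerivOneForm_gN_Z [T2Space M]
    (A B : SmoothVectorField (cotangentModel E) (Cotangent E M)) (α : Cotangent E M) :
    extDerivOneForm (fun β C => S.gN β (S.Z β) C) A B α
      = -2 * S.omega α.proj (dproj α (A α)) (dproj α (B α)) := by
  obtain ⟨U, hU⟩ := exists_smoothVectorField_eq (dproj α (A α))
  obtain ⟨V, hV⟩ := exists_smoothVectorField_eq (dproj α (B α))
  have h1 : (fun (β : Cotangent E M) C => S.gN β (S.Z β) C)
      = fun β C => (-S.omega β.proj (S.ξ β.proj)) (dproj β C) := by
    ext β C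
    rw [gN_Z]
    rfl
  have h2 : ∀ W : SmoothVectorField 𝓘(ℝ, E) M,
      (fun y => (-S.omega y (S.ξ y)) (W y)) = fun y => S.omega y ((-S.ξ) y) (W y) := by
    intro W
    ext y
    exact (DFunLike.congr_fun (_root_.map_neg (S.omega y) (S.ξ y)) (W y)).symm
  have h3 : ∀ (W : SmoothVectorField 𝓘(ℝ, E) M) (u : TangentSpace 𝓘(ℝ, E) α.proj),
      mvfderiv 𝓘(ℝ, E) (fun y => (-S.omega y (S.ξ y)) (W y)) α.proj u
        = -(S.omega α.proj u (W α.proj) + S.omega α.proj (S.ξ α.proj) (S.conn W α.proj u)) := by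
    intro W u
    rw [← mvfderiv_omega_xi]
    exact DFunLike.congr_fun (mvfderiv_fun_neg ..) u
  rw [h1, extDerivOneForm_pullback (η := fun y => -S.omega y (S.ξ y))
    (fun W => by rw [h2]; exact S.contMDiff_omega _ _) A B α hU hV, h3, h3,
    AffineConnection.lie_eq S.conn_torsion, ← hU, ← hV, S.omega_antisymm _ (V _) (U _)]
  simp only [_root_.neg_apply, _root_.map_sub]
  ring

/-- `ω_H = -π^*ω ⊕ π^*ω⁻¹`. -/
theorem omegaH_apply [T2Space M] (A B : SmoothVectorField (cotangentModel E) (Cotangent E M))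
    (α : Cotangent E M) :
    S.omegaH A B α = -S.omega α.proj (dproj α (A α)) (dproj α (B α))
      + S.omegaInv α.proj (verticalPart S.conn α (A α)) (verticalPart S.conn α (B α)) := by
  rw [omegaH, omega₁_apply, extDerivOneForm_gN_Z]
  ring

theorem omegaH_canonicalLift [T2Space M] (X : SmoothVectorField 𝓘(ℝ, E) M)
    (B : SmoothVectorField (cotangentModel E) (Cotangent E M)) (α : Cotangent E M) :
    S.omegaH (S.canonicalLift X) B α = -S.omega α.proj (X α.proj) (dproj α (B α))
      - S.omegaInv α.proj (S.lambdaNabla X α) (verticalPart S.conn α (B α)) := by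
  refine (S.omegaH_apply (S.liftField X) B α).trans ?_
  rw [liftField_apply, dproj_canonicalLift, verticalPart_canonicalLift, omegaInv, omegaInv,
    _root_.map_neg, _root_.map_neg, sub_eq_add_neg]

end CASKManifold

end HermitianForm

section MomentMap

variable {E M : Type*} [NormedAddCommGroup E] [NormedSpace ℝ E] [FiniteDimensional ℝ E]
  [CompleteSpace E] [TopologicalSpace M] [ChartedSpace E M] [IsManifold 𝓘(ℝ, E) ∞ M]

theorem contMDiffAt_cotangentCoord (α : Cotangent E M) :
    ContMDiffAt (cotangentModel E) 𝓘(ℝ, E →L[ℝ] ℝ) ∞ (cotangentCoord α.proj) α := by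
  have h : cotangentCoord α.proj = fun β => (extChartAt (cotangentModel E) α β).2 := by
    ext1 β
    rw [extChartAt_cotangent]
  rw [h]
  exact (ContinuousLinearMap.snd ℝ E (E →L[ℝ] ℝ)).contMDiff.contMDiffAt.comp α
    contMDiffAt_extChartAt

namespace CASKManifold

variable (S : CASKManifold E M)

/-! ### The moment map -/

/-- The coordinate expression of `a ↦ ω⁻¹(a ∘ ∇X)`. -/
theorem exists_omegaInv_conn_coord [T2Space M] (X : SmoothVectorField 𝓘(ℝ, E) M) (x : M) :
    ∃ T : M → (E →L[ℝ] ℝ) →L[ℝ] E, ContMDiffAt 𝓘(ℝ, E) 𝓘(ℝ, (E →L[ℝ] ℝ) →L[ℝ] E) ∞ T x ∧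
      ∀ y ∈ (extChartAt 𝓘(ℝ, E) x).source, ∀ (a : TangentSpace 𝓘(ℝ, E) y →L[ℝ] ℝ)
        (q : E →L[ℝ] ℝ), (∀ v, q (mvfderiv 𝓘(ℝ, E) (extChartAt 𝓘(ℝ, E) x) y v) = a v) →
        mvfderiv 𝓘(ℝ, E) (extChartAt 𝓘(ℝ, E) x) y ((S.omega y).inverse (a.comp (S.conn X y)))
          = T y q := by
  have hx := mem_extChartAt_source (I := 𝓘(ℝ, E)) x
  have hxs := (isOpen_extChartAt_source (I := 𝓘(ℝ, E)) x).mem_nhds hx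
  let d : M → E →L[ℝ] E := fun y => mvfderiv 𝓘(ℝ, E) (extChartAt 𝓘(ℝ, E) x) y
  have hd : ∀ y ∈ (extChartAt 𝓘(ℝ, E) x).source, (d y).IsInvertible := by
    have : IsManifold 𝓘(ℝ, E) 1 M := IsManifold.of_le (n := ∞) (by simp)
    exact fun y hy => isInvertible_mfderiv_extChartAt hy
  let om : M → E →L[ℝ] E →L[ℝ] ℝ := fun y => S.omega y
  let cn : M → E →L[ℝ] E := fun y => S.conn X y
  -- The coordinate frame agrees near `x` with global smooth fields, so the smoothness of `ω` and
  -- `∇X` on fields passes to their matrices.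
  have frame : ∀ w : E, ∃ W : SmoothVectorField 𝓘(ℝ, E) M,
      ∀ᶠ y in 𝓝 x, (W y : E) = (d y).inverse w := by
    intro w
    obtain ⟨W, -, hW⟩ := exists_smoothVectorField_coord_eq x (show TangentSpace 𝓘(ℝ, E) x from w)
    refine ⟨W, ?_⟩
    filter_upwards [hW, hxs] with y hy hys
    have h1 : d y (W y) = w := hy
    exact ((hd y hys).inverse_apply_self (W y)).symm.trans (congrArg (d y).inverse h1)
  let Ω : M → E →L[ℝ] E →L[ℝ] ℝ := fun y => (om y).bilinearComp (d y).inverse (d y).inverse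
  have hΩ : ContMDiffAt 𝓘(ℝ, E) 𝓘(ℝ, E →L[ℝ] E →L[ℝ] ℝ) ∞ Ω x := by
    refine contMDiffAt_clm_of_apply fun u => contMDiffAt_clm_of_apply fun v => ?_
    obtain ⟨U, hU⟩ := frame u
    obtain ⟨V, hV⟩ := frame v
    refine (S.contMDiff_omega U V x).congr_of_eventuallyEq ?_
    filter_upwards [hU, hV] with y hy hy'
    change om y ((d y).inverse u) ((d y).inverse v) = om y (U y) (V y)
    rw [hy, hy']
  have hΩi : ∀ y ∈ (extChartAt 𝓘(ℝ, E) x).source, (Ω y).IsInvertible := by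
    intro y hy
    refine isInvertible_of_nondegenerate fun u hu => ?_
    have h1 : om y ((d y).inverse u) = 0 := by
      ext v
      have h2 : om y ((d y).inverse u) ((d y).inverse (d y v)) = 0 := hu (d y v)
      rwa [(hd y hy).inverse_apply_self] at h2
    have h3 : (d y).inverse u = 0 := by
      have h4 : (om y).IsInvertible := S.isInvertible_omega y
      rw [← h4.inverse_apply_self ((d y).inverse u), h1, _root_.map_zero]
    rw [← (hd y hy).self_apply_inverse u, h3, _root_.map_zero]
  have hΩs : ContMDiffAt 𝓘(ℝ, E) 𝓘(ℝ, (E →L[ℝ] ℝ) →L[ℝ] E) ∞ (fun y => (Ω y).inverse) x := by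
    obtain ⟨e, he⟩ := hΩi x hx
    have h1 : ContDiffAt ℝ ∞ ContinuousLinearMap.inverse (Ω x) := he ▸ contDiffAt_map_inverse e
    exact h1.contMDiffAt.comp x hΩ
  let A : M → E →L[ℝ] E := fun y => (d y).comp ((cn y).comp (d y).inverse)
  have hA : ContMDiffAt 𝓘(ℝ, E) 𝓘(ℝ, E →L[ℝ] E) ∞ A x := by
    refine contMDiffAt_clm_of_apply fun w => ?_
    obtain ⟨W, hW⟩ := frame w
    refine ((contMDiffAt_vectorField_iff hx).1
      ((AffineConnection.along S.conn_smooth W X).contMDiff x)).congr_of_eventuallyEq ?_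
    filter_upwards [hW] with y hy
    change d y (cn y ((d y).inverse w)) = d y (cn y (W y))
    rw [hy]
  -- With `Ω` and `A` the coordinate matrices of `ω` and `∇X`, the operator is `q ↦ Ω⁻¹(q ∘ A)`.
  refine ⟨fun y => (Ω y).inverse.comp ((A y).precomp ℝ), ?_, ?_⟩
  · exact hΩs.clm_comp hA.clm_precomp
  · intro y hy a q hq
    obtain ⟨u, hu⟩ := S.exists_omega_eq y (a.comp (S.conn X y))
    have h1 : Ω y (d y u) = q.comp (A y) := by
      ext v
      change om y ((d y).inverse (d y u)) ((d y).inverse v) = q (d y (cn y ((d y).inverse v)))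
      refine (congrArg (fun z => om y z ((d y).inverse v))
        ((hd y hy).inverse_apply_self u)).trans ?_
      exact (DFunLike.congr_fun hu ((d y).inverse v)).trans (hq _).symm
    rw [← hu, (S.isInvertible_omega y).inverse_apply_self]
    refine ((hΩi y hy).inverse_apply_self (d y u)).symm.trans ?_
    rw [h1]
    rfl

/-- The function `α ↦ ω⁻¹(α ∘ ∇X, α)` on the cotangent bundle. -/
def momentQuadratic (X : Π x : M, TangentSpace 𝓘(ℝ, E) x) (α : Cotangent E M) : ℝ :=
  S.omegaInv α.proj (S.lambdaNabla X α) α.2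

theorem momentMap_apply (X : Π x : M, TangentSpace 𝓘(ℝ, E) x) (α : Cotangent E M) :
    S.momentMap X α = (1 / 2 : ℝ) * (-S.omega α.proj (S.ξ α.proj) (X α.proj)
      + S.momentQuadratic X α) := by
  rw [momentMap, gN_Z, dproj_canonicalLift, momentQuadratic]

theorem contMDiff_momentQuadratic [T2Space M] (X : SmoothVectorField 𝓘(ℝ, E) M) :
    ContMDiff (cotangentModel E) 𝓘(ℝ, ℝ) ∞ (S.momentQuadratic X) := by
  intro α
  obtain ⟨T, hT, hTe⟩ := S.exists_omegaInv_conn_coord X α.proj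
  have hp := contMDiffAt_cotangentCoord α
  refine ContMDiffAt.congr_of_eventuallyEq (hp.clm_apply (ContMDiffAt.clm_apply
    (hT.comp α (contMDiff_proj_cotangent α)) hp)) ?_
  filter_upwards [eventually_proj ((isOpen_extChartAt_source (I := 𝓘(ℝ, E)) α.proj).mem_nhds
    (mem_extChartAt_source α.proj))] with β hβ
  have h1 := hTe β.proj hβ β.2 (cotangentCoord α.proj β) fun v => cotangentCoord_apply hβ rfl
  exact (cotangentCoord_apply hβ h1).symm

theorem contMDiff_momentMap [T2Space M] (X : SmoothVectorField 𝓘(ℝ, E) M) :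
    ContMDiff (cotangentModel E) 𝓘(ℝ, ℝ) ∞ (S.momentMap X) := by
  have h : S.momentMap X = fun α => (1 / 2 : ℝ) * (-S.omega α.proj (S.ξ α.proj) (X α.proj)
      + S.momentQuadratic X α) := by
    ext α
    exact S.momentMap_apply X α
  rw [h]
  have h1 : ContMDiff (cotangentModel E) 𝓘(ℝ, ℝ) ∞
      (fun α : Cotangent E M => S.omega α.proj (S.ξ α.proj) (X α.proj)) :=
    (S.contMDiff_omega S.ξ X).comp contMDiff_proj_cotangent
  exact contMDiff_const.mul (h1.neg.add (S.contMDiff_momentQuadratic X))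

theorem momentMap_add (X Y : SmoothVectorField 𝓘(ℝ, E) M) (α : Cotangent E M) :
    S.momentMap (X + Y : SmoothVectorField 𝓘(ℝ, E) M) α = S.momentMap X α + S.momentMap Y α := by
  have h : (X + Y : SmoothVectorField 𝓘(ℝ, E) M) α.proj = X α.proj + Y α.proj := rfl
  rw [momentMap_apply, momentQuadratic, lambdaNabla_add, h]
  simp only [momentMap_apply, momentQuadratic, omegaInv, _root_.map_add]
  ring

theorem momentMap_smul (c : ℝ) (X : SmoothVectorField 𝓘(ℝ, E) M) (α : Cotangent E M) :
    S.momentMap (c • X : SmoothVectorField 𝓘(ℝ, E) M) α = c * S.momentMap X α := by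
  have h : (c • X : SmoothVectorField 𝓘(ℝ, E) M) α.proj = c • X α.proj := rfl
  rw [momentMap_apply, momentQuadratic, lambdaNabla_smul, h]
  simp only [momentMap_apply, momentQuadratic, omegaInv, _root_.map_smul, smul_eq_mul]
  ring

variable {S}

/-- `ω⁻¹(ω(s,·) ∘ ∇X) = -∇_s X`. -/
theorem IsInfinitesimalSymmetry.omegaInv_omega_comp {X : SmoothVectorField 𝓘(ℝ, E) M}
    (h : S.IsInfinitesimalSymmetry X) (x : M) (s : TangentSpace 𝓘(ℝ, E) x)
    (b : TangentSpace 𝓘(ℝ, E) x →L[ℝ] ℝ) :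
    S.omegaInv x ((S.omega x s).comp (S.conn X x)) b = -b (S.conn X x s) := by
  have h1 : (S.omega x s).comp (S.conn X x) = S.omega x (-S.conn X x s) := by
    ext v
    have h2 := h.skew x s v
    change S.omega x s (S.conn X x v) = _
    rw [_root_.map_neg, _root_.neg_apply, h2, neg_neg]
  rw [h1, omegaInv_omega, _root_.map_neg]

/-- Together with `omegaInv_omega_comp` this is the symmetry of `(a, b) ↦ ω⁻¹(a ∘ ∇X, b)`, the dual
form of skewness of `∇X`. -/
theorem IsInfinitesimalSymmetry.omegaInv_comp_omega {X : SmoothVectorField 𝓘(ℝ, E) M}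
    (h : S.IsInfinitesimalSymmetry X) (x : M) (s : TangentSpace 𝓘(ℝ, E) x)
    (a : TangentSpace 𝓘(ℝ, E) x →L[ℝ] ℝ) :
    S.omegaInv x (a.comp (S.conn X x)) (S.omega x s) = -a (S.conn X x s) := by
  obtain ⟨t, rfl⟩ := S.exists_omega_eq x a
  rw [h.omegaInv_omega_comp, S.omega_antisymm, h.skew, neg_neg]

/-- The polarization of `α ↦ ω⁻¹(α ∘ ∇X, α)` around the one-form `ω(s,·)`. -/
theorem IsInfinitesimalSymmetry.momentQuadratic_eq {X : SmoothVectorField 𝓘(ℝ, E) M}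
    (h : S.IsInfinitesimalSymmetry X) (s : SmoothVectorField 𝓘(ℝ, E) M) (β : Cotangent E M) :
    S.momentQuadratic X β
      = S.omegaInv β.proj ((β.2 - S.omega β.proj (s β.proj)).comp (S.conn X β.proj))
          (β.2 - S.omega β.proj (s β.proj))
        + (-2 * pairing (AffineConnection.along S.conn_smooth s X) β
        + S.omega β.proj (s β.proj) (AffineConnection.along S.conn_smooth s X β.proj)) := by
  have h1 := h.omegaInv_omega_comp β.proj (s β.proj) β.2
  have h2 := h.omegaInv_omega_comp β.proj (s β.proj) (S.omega β.proj (s β.proj))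
  have h3 := h.omegaInv_comp_omega β.proj (s β.proj) β.2
  rw [momentQuadratic, lambdaNabla, pairing, AffineConnection.along_apply]
  have h4 : ∀ a b c d : TangentSpace 𝓘(ℝ, E) β.proj →L[ℝ] ℝ, S.omegaInv β.proj (a - b) (c - d)
      = S.omegaInv β.proj a c - S.omegaInv β.proj b c - S.omegaInv β.proj a d
        + S.omegaInv β.proj b d := by
    intro a b c d
    simp only [omegaInv, _root_.map_sub, _root_.sub_apply]
    ring
  rw [ContinuousLinearMap.sub_comp, h4, h1, h2, h3]
  ring

end CASKManifold

end MomentMap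

section Comoment

variable {E M : Type*} [NormedAddCommGroup E] [NormedSpace ℝ E] [FiniteDimensional ℝ E]
  [CompleteSpace E] [TopologicalSpace M] [ChartedSpace E M] [IsManifold 𝓘(ℝ, E) ∞ M]

variable {F H N : Type*} [NormedAddCommGroup F] [NormedSpace ℝ F] [TopologicalSpace H]
  {I : ModelWithCorners ℝ F H} [TopologicalSpace N] [ChartedSpace H N]

theorem mvfderiv_add_apply {f g : N → ℝ} {p : N} (hf : MDifferentiableAt I 𝓘(ℝ, ℝ) f p)
    (hg : MDifferentiableAt I 𝓘(ℝ, ℝ) g p) (v : TangentSpace I p) :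
    mvfderiv I (fun q => f q + g q) p v = mvfderiv I f p v + mvfderiv I g p v := by
  rw [mvfderiv_fun_add hf hg]
  rfl

theorem mvfderiv_const_mul_apply {c : ℝ} {f : N → ℝ} {p : N}
    (hf : MDifferentiableAt I 𝓘(ℝ, ℝ) f p) (v : TangentSpace I p) :
    mvfderiv I (fun q => c * f q) p v = c * mvfderiv I f p v :=
  HasFDerivAt.mvfderiv_comp_apply ((ContinuousLinearMap.mul ℝ ℝ c).hasFDerivAt (x := f p)) hf v

namespace CASKManifold

/-! ### The differential of the moment map -/

/-- A quadratic function of the difference of covectors has vanishing derivative where the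
difference vanishes. -/
theorem mvfderiv_omegaInv_sub_eq_zero [T2Space M] (S : CASKManifold E M)
    (X s : SmoothVectorField 𝓘(ℝ, E) M) {α : Cotangent E M}
    (hs : S.omega α.proj (s α.proj) = α.2) :
    MDifferentiableAt (cotangentModel E) 𝓘(ℝ, ℝ) (fun β : Cotangent E M => S.omegaInv β.proj
      ((β.2 - S.omega β.proj (s β.proj)).comp (S.conn X β.proj))
      (β.2 - S.omega β.proj (s β.proj))) α ∧
    ∀ C, mvfderiv (cotangentModel E) (fun β : Cotangent E M => S.omegaInv β.proj
      ((β.2 - S.omega β.proj (s β.proj)).comp (S.conn X β.proj))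
      (β.2 - S.omega β.proj (s β.proj))) α C = 0 := by
  obtain ⟨T, hT, hTe⟩ := S.exists_omegaInv_conn_coord X α.proj
  obtain ⟨L, hL, hLe⟩ := exists_oneForm_coord (S.contMDiff_omega s) α.proj
  have hx := mem_extChartAt_source (I := 𝓘(ℝ, E)) α.proj
  -- The coordinates of `β - ω(s, ·)`: the function is `r(T r)` near `α`, and `r` vanishes at `α`,
  -- so both terms of the product rule do.
  let r : Cotangent E M → E →L[ℝ] ℝ := fun β => cotangentCoord α.proj β - L β.proj
  have hr : MDifferentiableAt (cotangentModel E) 𝓘(ℝ, E →L[ℝ] ℝ) r α :=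
    ((contMDiffAt_cotangentCoord α).sub (hL.comp α (contMDiff_proj_cotangent α))).mdifferentiableAt
      (by simp)
  have hTd : MDifferentiableAt (cotangentModel E) 𝓘(ℝ, (E →L[ℝ] ℝ) →L[ℝ] E)
      (fun β : Cotangent E M => T β.proj) α :=
    (hT.comp α (contMDiff_proj_cotangent α)).mdifferentiableAt (by simp)
  have hTr : MDifferentiableAt (cotangentModel E) 𝓘(ℝ, E) (fun β => T β.proj (r β)) α :=
    hTd.clm_apply hr
  have hre : ∀ β : Cotangent E M, β.proj ∈ (extChartAt 𝓘(ℝ, E) α.proj).source →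
      ∀ v : TangentSpace 𝓘(ℝ, E) β.proj,
      r β (mvfderiv 𝓘(ℝ, E) (extChartAt 𝓘(ℝ, E) α.proj) β.proj v)
        = (β.2 - S.omega β.proj (s β.proj)) v := by
    intro β hβ v
    have h1 := cotangentCoord_apply hβ (v := mvfderiv 𝓘(ℝ, E) (extChartAt 𝓘(ℝ, E) α.proj) β.proj v)
      rfl
    exact congrArg₂ (· - ·) h1 (hLe _ hβ v)
  have hr0 : r α = 0 := by
    ext v
    have h1 := hre α hx v
    rw [hs, sub_self] at h1
    exact (congrArg (r α) (mvfderiv_extChartAt_self (I := 𝓘(ℝ, E)) α.proj v)).symm.trans h1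
  have heq : (fun β : Cotangent E M => S.omegaInv β.proj
      ((β.2 - S.omega β.proj (s β.proj)).comp (S.conn X β.proj))
      (β.2 - S.omega β.proj (s β.proj))) =ᶠ[𝓝 α] fun β => r β (T β.proj (r β)) := by
    filter_upwards [eventually_proj ((isOpen_extChartAt_source (I := 𝓘(ℝ, E)) α.proj).mem_nhds
      hx)] with β hβ
    rw [← hTe β.proj hβ _ _ (hre β hβ), hre β hβ]
    rfl
  refine ⟨(hr.clm_apply hTr).congr_of_eventuallyEq heq, fun C => ?_⟩
  rw [heq.mvfderiv_eq, mvfderiv_clm_apply_apply hr hTr, hr0, _root_.map_zero, _root_.map_zero]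
  exact add_zero _

variable {S : CASKManifold E M}

namespace IsInfinitesimalSymmetry

/-- A connection on `T^*M` is avoided by choosing a field `s` with `ω(s, ·) = α` at the base point.
By `momentQuadratic_eq` the function is then a part with zero derivative at `α` plus `-2λ(∇_s X) +
ω(s, ∇_s X)`, whose derivative is known. -/
theorem mvfderiv_momentQuadratic [T2Space M] {X : SmoothVectorField 𝓘(ℝ, E) M}
    (h : S.IsInfinitesimalSymmetry X) (α : Cotangent E M) (C : TangentSpace (cotangentModel E) α) :
    mvfderiv (cotangentModel E) (S.momentQuadratic X) α C
      = 2 * S.omegaInv α.proj (S.lambdaNabla X α) (verticalPart S.conn α C) := by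
  obtain ⟨u, hu⟩ := S.exists_omega_eq α.proj α.2
  obtain ⟨s, rfl⟩ := exists_smoothVectorField_eq u
  obtain ⟨U, hU⟩ := exists_smoothVectorField_eq (dproj α C)
  obtain ⟨hd, h0⟩ := S.mvfderiv_omegaInv_sub_eq_zero X s hu
  have hp := mdifferentiable_pairing (AffineConnection.along S.conn_smooth s X) α
  have ho : MDifferentiableAt 𝓘(ℝ, E) 𝓘(ℝ, ℝ)
      (fun y => S.omega y (s y) (AffineConnection.along S.conn_smooth s X y)) α.proj :=
    (S.contMDiff_omega s _).mdifferentiable (by simp) α.proj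
  have hop : MDifferentiableAt (cotangentModel E) 𝓘(ℝ, ℝ) (fun β : Cotangent E M =>
      S.omega β.proj (s β.proj) (AffineConnection.along S.conn_smooth s X β.proj)) α :=
    MDifferentiableAt.comp α ho (_root_.mdifferentiableAt_proj α)
  have hpd : MDifferentiableAt (cotangentModel E) 𝓘(ℝ, ℝ)
      (fun β => -2 * pairing (AffineConnection.along S.conn_smooth s X) β) α :=
    mdifferentiableAt_const.mul hp
  rw [show S.momentQuadratic X = _ from funext (h.momentQuadratic_eq s),
    mvfderiv_add_apply hd (g := fun β => -2 * pairing (AffineConnection.along S.conn_smooth s X) β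
      + S.omega β.proj (s β.proj) (AffineConnection.along S.conn_smooth s X β.proj))
      (hpd.add hop), h0]
  have h1 := mvfderiv_add_apply hpd hop C
  rw [mvfderiv_const_mul_apply hp, mvfderiv_comp_proj ho, mvfderiv_omega,
    mvfderiv_pairing S.conn] at h1
  refine ((zero_add _).trans h1).trans ?_
  have h2 := h.omegaInv_omega_comp α.proj (s α.proj) (verticalPart S.conn α C)
  have h3 := h.parallel U s α.proj
  rw [hU] at h3
  rw [hu] at h2
  rw [lambdaNabla, h2, h3, ← hu, AffineConnection.along_apply]
  -- With `t = ∇_{dπ(C)} s` the horizontal terms are `-2ω(s, At) + ω(t, As) + ω(s, At)`; they cancel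
  -- since `ω(t, As) = -ω(At, s) = ω(s, At)`.
  have h5 := h.skew α.proj (S.conn s α.proj (dproj α C)) (s α.proj)
  have h6 := S.omega_antisymm α.proj (S.conn X α.proj (S.conn s α.proj (dproj α C))) (s α.proj)
  linarith

theorem mvfderiv_momentMap [T2Space M] {X : SmoothVectorField 𝓘(ℝ, E) M}
    (h : S.IsInfinitesimalSymmetry X) (α : Cotangent E M) (C : TangentSpace (cotangentModel E) α) :
    mvfderiv (cotangentModel E) (S.momentMap X) α C
      = S.omega α.proj (X α.proj) (dproj α C)
        + S.omegaInv α.proj (S.lambdaNabla X α) (verticalPart S.conn α C) := by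
  have ho : MDifferentiableAt 𝓘(ℝ, E) 𝓘(ℝ, ℝ) (fun y => S.omega y (S.ξ y) (X y)) α.proj :=
    (S.contMDiff_omega S.ξ X).mdifferentiable (by simp) α.proj
  have hop : MDifferentiableAt (cotangentModel E) 𝓘(ℝ, ℝ)
      (fun β : Cotangent E M => S.omega β.proj (S.ξ β.proj) (X β.proj)) α :=
    MDifferentiableAt.comp α ho (_root_.mdifferentiableAt_proj α)
  have hq : MDifferentiableAt (cotangentModel E) 𝓘(ℝ, ℝ) (S.momentQuadratic X) α :=
    (S.contMDiff_momentQuadratic X).mdifferentiable (by simp) α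
  have hon : MDifferentiableAt (cotangentModel E) 𝓘(ℝ, ℝ)
      (fun β : Cotangent E M => -S.omega β.proj (S.ξ β.proj) (X β.proj)) α := hop.neg
  have hs : MDifferentiableAt (cotangentModel E) 𝓘(ℝ, ℝ) (fun β : Cotangent E M =>
      -S.omega β.proj (S.ξ β.proj) (X β.proj) + S.momentQuadratic X β) α := hon.add hq
  have h1 : mvfderiv (cotangentModel E)
      (fun β : Cotangent E M => -S.omega β.proj (S.ξ β.proj) (X β.proj)) α C
      = -mvfderiv (cotangentModel E)
        (fun β : Cotangent E M => S.omega β.proj (S.ξ β.proj) (X β.proj)) α C :=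
    DFunLike.congr_fun (mvfderiv_fun_neg ..) C
  rw [show S.momentMap X = _ from funext (S.momentMap_apply X), mvfderiv_const_mul_apply hs,
    mvfderiv_add_apply hon hq, h1, mvfderiv_comp_proj ho, mvfderiv_omega_xi,
    h.mvfderiv_momentQuadratic]
  -- Since `∇_ξ X = X`, skewness gives `ω(ξ, ∇_u X) = -ω(X, u)`, so the two terms of `-½ dω(ξ,
  -- X)(u)` add up to `ω(X, u)`.
  have h5 := h.skew α.proj (S.ξ α.proj) (dproj α C)
  rw [h.conn_xi] at h5
  have h6 := S.omega_antisymm α.proj (X α.proj) (dproj α C)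
  linarith

theorem isHamiltonianFunction [T2Space M] {X : SmoothVectorField 𝓘(ℝ, E) M}
    (h : S.IsInfinitesimalSymmetry X) :
    IsHamiltonianFunction S.omegaH (S.canonicalLift X) (S.momentMap X) := by
  intro B α
  rw [omegaH_canonicalLift, h.mvfderiv_momentMap]
  ring

/-- The moment map is equivariant. -/
theorem mvfderiv_momentMap_canonicalLift [T2Space M] {X₁ X₂ : SmoothVectorField 𝓘(ℝ, E) M}
    (h₁ : S.IsInfinitesimalSymmetry X₁) (h₂ : S.IsInfinitesimalSymmetry X₂) (α : Cotangent E M) :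
    mvfderiv (cotangentModel E) (S.momentMap X₂) α (S.canonicalLift X₁ α)
      = S.momentMap (⁅X₁, X₂⁆ : SmoothVectorField 𝓘(ℝ, E) M) α := by
  obtain ⟨s, hs⟩ := S.exists_omega_eq α.proj α.2
  have ha : ∀ v, α.2 v = S.omega α.proj s v := fun v => by rw [hs]
  rw [h₂.mvfderiv_momentMap, momentMap_apply, momentQuadratic, dproj_canonicalLift,
    verticalPart_canonicalLift, lambdaNabla, lambdaNabla, lambdaNabla]
  have h3 := (h₁.lie h₂).omegaInv_omega_comp α.proj s α.2
  have h4 := h₂.omegaInv_omega_comp α.proj s (-α.2.comp (S.conn X₁ α.proj))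
  rw [hs] at h3 h4
  rw [h3, h4, conn_lie h₁ h₂, AffineConnection.lie_eq S.conn_torsion]
  have h5 : (-α.2.comp (S.conn X₁ α.proj)) (S.conn X₂ α.proj s)
      = -S.omega α.proj s (S.conn X₁ α.proj (S.conn X₂ α.proj s)) := by
    rw [← ha]
    rfl
  rw [h5, ha]
  simp only [_root_.map_sub]
  -- The identities `e1` to `e3` give `-ω(ξ, [X₁, X₂]) = 2ω(X₂, X₁)`; `e4` to `e6` give `ω(s, A₂A₁s)
  -- = -ω(s, A₁A₂s)`. The doubling absorbs the factor one half in `μ`.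
  have e1 := h₂.skew α.proj (S.ξ α.proj) (X₁ α.proj)
  have e2 := h₁.skew α.proj (S.ξ α.proj) (X₂ α.proj)
  rw [h₂.conn_xi] at e1
  rw [h₁.conn_xi] at e2
  have e3 := S.omega_antisymm α.proj (X₁ α.proj) (X₂ α.proj)
  have e4 := h₁.skew α.proj s (S.conn X₂ α.proj s)
  have e5 := h₂.skew α.proj s (S.conn X₁ α.proj s)
  have e6 := S.omega_antisymm α.proj (S.conn X₁ α.proj s) (S.conn X₂ α.proj s)
  linarith

end IsInfinitesimalSymmetry

variable (S)

/-! ### The comoment map -/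

/-- The homomorphism of Lie algebras given by the canonical lift. -/
def liftHom [T2Space M] :
    SmoothVectorField 𝓘(ℝ, E) M →ₗ⁅ℝ⁆ SmoothVectorField (cotangentModel E) (Cotangent E M) where
  toFun := S.liftField
  map_add' X Y := by
    ext α
    exact S.canonicalLift_add X Y α
  map_smul' c X := by
    ext α
    exact S.canonicalLift_smul c X α
  map_lie' := (S.lie_liftField _ _).symm

/-- The moment map as a linear map. -/
def momentLinearMap [T2Space M] : SmoothVectorField 𝓘(ℝ, E) M →ₗ[ℝ]
    C^∞⟮cotangentModel E, Cotangent E M; 𝓘(ℝ, ℝ), ℝ⟯ where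
  toFun X := ⟨S.momentMap X, S.contMDiff_momentMap X⟩
  map_add' X Y := by
    ext α
    exact S.momentMap_add X Y α
  map_smul' c X := by
    ext α
    exact S.momentMap_smul c X α

end CASKManifold

end Comoment

end

theorem mainTheorem6 {E M : Type*} [NormedAddCommGroup E] [NormedSpace ℝ E]
    [FiniteDimensional ℝ E] [CompleteSpace E] [TopologicalSpace M] [T2Space M]
    [SecondCountableTopology M] [ChartedSpace E M] [IsManifold 𝓘(ℝ, E) ∞ M]
    (S : CASKManifold E M) :
    (∀ X : SmoothVectorField 𝓘(ℝ, E) M, S.IsInfinitesimalAutomorphism X →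
      ContMDiff (cotangentModel E) (cotangentModel E).tangent ∞
        (fun α => (⟨α, S.canonicalLift X α⟩ : TangentBundle (cotangentModel E) (Cotangent E M))) ∧
      (∀ (ε : ℝ) (U : Set M) (φ : ℝ → M → M), IsLocalFlow X ε U φ →
        ∀ α : Cotangent E M, α.proj ∈ U →
          HasMFDerivAt 𝓘(ℝ, ℝ) (cotangentModel E)
            (fun t : ℝ => (⟨φ t α.proj,
              α.2.comp (mfderiv 𝓘(ℝ, E) 𝓘(ℝ, E) (φ t) α.proj).inverse⟩ : Cotangent E M)) 0
            ((1 : ℝ →L[ℝ] ℝ).smulRight (S.canonicalLift X α))) ∧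
      ContMDiff (cotangentModel E) 𝓘(ℝ, ℝ) ∞ (S.momentMap X) ∧
      IsHamiltonianFunction S.omegaH (S.canonicalLift X) (S.momentMap X)) ∧
    ∃ (ρ : S.aut →ₗ⁅ℝ⁆ SmoothVectorField (cotangentModel E) (Cotangent E M))
      (μ : S.aut →ₗ[ℝ] C^∞⟮cotangentModel E, Cotangent E M; 𝓘(ℝ, ℝ), ℝ⟯),
      (∀ (X : S.aut) (α : Cotangent E M), ρ X α = S.canonicalLift X.1 α) ∧
      (∀ (X : S.aut) (α : Cotangent E M), μ X α = S.momentMap X.1 α) ∧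
      IsEquivariantComomentMap S.omegaH ρ μ := by
  refine ⟨fun X hX => ⟨S.contMDiff_canonicalLift X,
    fun ε U φ h α hα => S.hasMFDerivAt_cotangent_flow h α hα, S.contMDiff_momentMap X,
    hX.isInfinitesimalSymmetry.isHamiltonianFunction⟩,
    -- Lift and moment map are defined and linear on all vector fields, the lift even as a Lie
    -- homomorphism; the symmetry conditions enter only in the Hamiltonian property and
    -- equivariance.
    S.liftHom.comp S.aut.incl, S.momentLinearMap.comp S.aut.toSubmodule.subtype,
    fun _ _ => rfl, fun _ _ => rfl, ?_, ?_⟩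
  · exact fun X => (CASKManifold.isInfinitesimalSymmetry_of_mem_aut X.2).isHamiltonianFunction
  · exact fun X₁ X₂ p => CASKManifold.IsInfinitesimalSymmetry.mvfderiv_momentMap_canonicalLift
      (CASKManifold.isInfinitesimalSymmetry_of_mem_aut X₁.2)
      (CASKManifold.isInfinitesimalSymmetry_of_mem_aut X₂.2) p
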